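/- Let $k$ be an algebraically closed field of characteristic $0$. For $m\ge 0$ let $\mathfrak{gl}(m|m)$ be the general linear Lie superalgebra with matrix units $e_{i,j}$, $1\le i,j\le 2m$ (indices $1,\dots,m$ even, $m+1,\dots,2m$ odd), Cartan subalgebra $\mathfrak h$ of diagonal matrices, weights $\varepsilon_i$ dual to $e_{i,i}$, $\delta_i=\varepsilon_{m+i}$, form $(\varepsilon_i,\varepsilon_j)=(-1)^{|i|}\delta_{ij}$, and let $\Lambda_m$ be the lattice of integral weights $\lambda=\sum_i a_i\varepsilon_i+\sum_j b_j\delta_j$, $a_i,b_j\in\mathbb Z$. Put $\operatorname{par}(\lambda)=\sum_j b_j\in\mathbb Z/2$. Give $e_{i,j}$ the degree $\bar\jmath-\bar\imath$, where $\bar\imath\in\{1,\dots,m\}$ is congruent to $i$ modulo $m$; let $\mathfrak p$ be the sum of the components of degree $\ge 0$ and $\mathfrak l\cong\mathfrak{gl}(1|1)^{\oplus m}$ the component of degree $0$. For $\lambda\in\Lambda_m$ let $L^{\mathbf o}(\lambda)$ be the irreducible $\mathfrak l$-supermodule with highest weight $\lambda$ with respect to the Borel subalgebra spanned by $\mathfrak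 h$ and $e_{1,m+1},\dots,e_{m,2m}$, its highest weight vector having parity $\operatorname{par}(\lambda)$, and let $$\operatorname{BG}_{m|m}(\lambda)=U(\mathfrak{gl}(m|m))\otimes_{U(\mathfrak p)}L^{\mathbf o}(\lambda),$$ where $\mathfrak p$ acts on $L^{\mathbf o}(\lambda)$ through the projection $\mathfrak p\to\mathfrak l$. Let $\Lambda_m^{\mathrm{maBG}}\subset\Lambda_m$ be the set of $\lambda$ such that the atypicalities of the $m$ weights $a_i\varepsilon+b_i\delta$ of $\mathfrak{gl}(1|1)$ (the restrictions of $\lambda$ to the summands of $\mathfrak l$) add up to $m$. Here the atypicality of a weight $\mu$ of $\mathfrak{gl}(1|1)$ is the maximal number of mutually orthogonal distinct odd roots modulo $\pm1$ that are orthogonal to $\mu$, i.e. it is $1$ if $(\mu,\varepsilon-\delta)=0$ and $0$ otherwise. For an odd $x\in\mathfrak g$ with $[x,x]=0$ and a $\mathfrak g$-supermodule $M$ let $\operatorname{DS}_xM=\ker x_M/\operatorname{im}x_M$, a supermodule over the Lie superalgebra $\operatorname{DS}_x\mathfrak g=\ker\operatorname{ad}x/\operatorname{im}\operatorname{ad}x$.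 Let $n\ge 1$, $\lambda=\sum_i a_i\varepsilon_i+\sum_j b_j\delta_j\in\Lambda_n$, and let $\operatorname{DS}_{\varepsilon_1-\delta_1}=\operatorname{DS}_x$ with $x=e_{1,n+1}\in\mathfrak{gl}(n|n)$. Identify $\operatorname{DS}_x\mathfrak{gl}(n|n)$ with $\mathfrak{gl}(n-1|n-1)$ by means of the inclusion into $\ker \operatorname{ad}x$ of the subalgebra $\mathfrak{gl}(J)$ spanned by the $e_{i,j}$ with $i,j\in J=\{2,\dots,n,n+2,\dots,2n\}$. Let $\operatorname{pr}_J(\lambda)\in\Lambda_{n-1}$ be the restriction of $\lambda$ to $\mathfrak{gl}(J)$, and $\operatorname{pr}_I(\lambda)=a_1\varepsilon_1+b_1\delta_1$. Then $\lambda\in\Lambda_n^{\mathrm{maBG}}$ if and only if $\dim L^{\mathbf o}(\lambda)=1$. If $\lambda\in\Lambda_n^{\mathrm{maBG}}$, then there is an isomorphism of $\mathfrak{gl}(n-1|n-1)$-supermodules $$\operatorname{DS}_{\varepsilon_1-\delta_1}\bigl(\operatorname{BG}_{n|n}(\lambda)\bigr)\cong\Pi^{\operatorname{par}(\operatorname{pr}_I(\lambda))}\operatorname{BG}_{n-1|n-1}\bigl(\operatorname{pr}_J(\lambda)\bigr),$$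 where $\Pi$ is the parity shift, and moreover $\operatorname{pr}_J(\lambda)\in\Lambda_{n-1}^{\mathrm{maBG}}$. -/

import Mathlib

open scoped TensorProduct

universe u

noncomputable section

namespace GLSuper

/-! ## Signs and graded subspaces -/

/-- The Koszul sign `(-1)^{p q}`. -/
def sgn (p q : ZMod 2) : ℤ := if p = 1 ∧ q = 1 then -1 else 1

@[simp] theorem sgn_zero_left (q : ZMod 2) : sgn 0 q = 1 := by simp [sgn]
@[simp] theorem sgn_zero_right (p : ZMod 2) : sgn p 0 = 1 := by simp [sgn]
@[simp] theorem sgn_one_one : sgn 1 1 = -1 := by simp [sgn]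

theorem zmod2_cases (p : ZMod 2) : p = 0 ∨ p = 1 := by
  fin_cases p
  · exact Or.inl rfl
  · exact Or.inr rfl

theorem one_add_one_zmod2 : (1 : ZMod 2) + 1 = 0 := by decide

section Graded

variable {k : Type u} [Field k] {V : Type u} [AddCommGroup V] [Module k V]

/-- A subspace of a `ℤ/2`-graded space is graded if it is spanned by its homogeneous parts. -/
def IsGradedSub (gr : ZMod 2 → Submodule k V) (N : Submodule k V) : Prop :=
  ∀ v ∈ N, ∃ v₀ ∈ gr 0, ∃ v₁ ∈ gr 1, v₀ ∈ N ∧ v₁ ∈ N ∧ v = v₀ + v₁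

theorem exists_decomp {gr : ZMod 2 → Submodule k V} (h : IsCompl (gr 0) (gr 1)) (v : V) :
    ∃ v₀ ∈ gr 0, ∃ v₁ ∈ gr 1, v = v₀ + v₁ := by
  have hv : v ∈ gr 0 ⊔ gr 1 := by rw [h.sup_eq_top]; trivial
  obtain ⟨a, ha, b, hb, rfl⟩ := Submodule.mem_sup.mp hv
  exact ⟨a, ha, b, hb, rfl⟩

theorem decomp_unique {gr : ZMod 2 → Submodule k V} (h : IsCompl (gr 0) (gr 1))
    {a b a' b' : V} (ha : a ∈ gr 0) (hb : b ∈ gr 1) (ha' : a' ∈ gr 0) (hb' : b' ∈ gr 1)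
    (e : a + b = a' + b') : a = a' ∧ b = b' := by
  have h1 : a - a' = b' - b := by
    rw [sub_eq_sub_iff_add_eq_add, e, add_comm]
  have h2 : a - a' = 0 := by
    refine Submodule.disjoint_def.mp h.disjoint _ (Submodule.sub_mem _ ha ha') ?_
    rw [h1]; exact Submodule.sub_mem _ hb' hb
  refine ⟨sub_eq_zero.mp h2, ?_⟩
  rw [h2] at h1
  exact (sub_eq_zero.mp h1.symm).symm

theorem isCompl_comap {gr : ZMod 2 → Submodule k V} (h : IsCompl (gr 0) (gr 1))
    {K : Submodule k V} (hK : IsGradedSub gr K) :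
    IsCompl ((gr 0).comap K.subtype) ((gr 1).comap K.subtype) := by
  constructor
  · rw [Submodule.disjoint_def]
    rintro ⟨v, hv⟩ h0 h1
    have := Submodule.disjoint_def.mp h.disjoint v h0 h1
    exact Subtype.ext this
  · rw [codisjoint_iff, eq_top_iff]
    rintro ⟨v, hv⟩ -
    obtain ⟨a, ha, b, hb, haK, hbK, rfl⟩ := hK v hv
    exact Submodule.mem_sup.mpr ⟨⟨a, haK⟩, ha, ⟨b, hbK⟩, hb, rfl⟩

theorem isCompl_map_mkQ {gr : ZMod 2 → Submodule k V} (h : IsCompl (gr 0) (gr 1))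
    {N : Submodule k V} (hN : IsGradedSub gr N) :
    IsCompl ((gr 0).map N.mkQ) ((gr 1).map N.mkQ) := by
  constructor
  · rw [Submodule.disjoint_def]
    rintro x ⟨a, ha, rfl⟩ ⟨b, hb, hab⟩
    have hmem : a - b ∈ N := by
      rw [← Submodule.ker_mkQ N, LinearMap.mem_ker, map_sub, hab, sub_self]
    obtain ⟨a', ha', b', hb', haN, -, e⟩ := hN _ hmem
    have := decomp_unique h ha (Submodule.neg_mem _ hb) ha' hb' (by rw [← e, sub_eq_add_neg])
    rw [this.1]
    simpa using haN
  · rw [codisjoint_iff, ← Submodule.map_sup, h.sup_eq_top, Submodule.map_top, Submodule.range_mkQ]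

/-- The parity involution `v₀ + v₁ ↦ v₀ - v₁`. -/
def parityOp (gr : ZMod 2 → Submodule k V) (h : IsCompl (gr 0) (gr 1)) : V →ₗ[k] V :=
  (gr 0).projection (gr 1) h - (gr 1).projection (gr 0) h.symm

theorem parityOp_apply {gr : ZMod 2 → Submodule k V} (h : IsCompl (gr 0) (gr 1))
    {p : ZMod 2} {v : V} (hv : v ∈ gr p) : parityOp gr h v = sgn 1 p • v := by
  rcases zmod2_cases p with rfl | rfl
  · simp [parityOp, Submodule.projection_apply_of_mem_left h hv,
      (Submodule.projection_apply_eq_zero_iff h.symm).mpr hv]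
  · simp [parityOp, Submodule.projection_apply_of_mem_left h.symm hv,
      (Submodule.projection_apply_eq_zero_iff h).mpr hv]

theorem parityOp_invol {gr : ZMod 2 → Submodule k V} (h : IsCompl (gr 0) (gr 1)) (v : V) :
    parityOp gr h (parityOp gr h v) = v := by
  obtain ⟨a, ha, b, hb, rfl⟩ := exists_decomp h v
  simp [parityOp_apply h ha, parityOp_apply h hb]

end Graded

section Subquotient

variable {k : Type u} [Field k] {A B C : Type u} [AddCommGroup A] [Module k A]
  [AddCommGroup B] [Module k B] [AddCommGroup C] [Module k C]

/-- The subquotient `K / (N ∩ K)`. -/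
abbrev Subquot (K N : Submodule k A) : Type u := ↥K ⧸ N.comap K.subtype

/-- The bilinear map on subquotients induced by a bilinear map. -/
def subquotBilin (β : A →ₗ[k] B →ₗ[k] C) (KA NA : Submodule k A) (KB NB : Submodule k B)
    (KC NC : Submodule k C)
    (h1 : ∀ a ∈ KA, ∀ b ∈ KB, β a b ∈ KC)
    (h2 : ∀ a ∈ KA, a ∈ NA → ∀ b ∈ KB, β a b ∈ NC)
    (h3 : ∀ a ∈ KA, ∀ b ∈ KB, b ∈ NB → β a b ∈ NC) :
    Subquot KA NA →ₗ[k] Subquot KB NB →ₗ[k] Subquot KC NC :=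
  Submodule.liftQ (NA.comap KA.subtype)
    { toFun := fun a =>
        Submodule.mapQ (NB.comap KB.subtype) (NC.comap KC.subtype)
          ((β a).restrict (p := KB) (q := KC) (fun b hb => h1 a a.2 b hb))
          (fun b hb => h3 a a.2 b b.2 hb)
      map_add' := fun a a' => by
        refine Submodule.linearMap_qext _ (LinearMap.ext fun b => ?_)
        exact congrArg (Submodule.Quotient.mk (p := NC.comap KC.subtype))
          (Subtype.ext (by simp) :
            (⟨β (a + a') b, h1 _ (a + a').2 _ b.2⟩ : KC) =
              ⟨β a b, h1 _ a.2 _ b.2⟩ + ⟨β a' b, h1 _ a'.2 _ b.2⟩)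
      map_smul' := fun c a => by
        refine Submodule.linearMap_qext _ (LinearMap.ext fun b => ?_)
        exact congrArg (Submodule.Quotient.mk (p := NC.comap KC.subtype))
          (Subtype.ext (by simp) :
            (⟨β (c • a) b, h1 _ (c • a).2 _ b.2⟩ : KC) = c • ⟨β a b, h1 _ a.2 _ b.2⟩) }
    (by
      intro a ha
      rw [LinearMap.mem_ker]
      refine Submodule.linearMap_qext _ (LinearMap.ext fun b => ?_)
      simp only [LinearMap.comp_apply, Submodule.mkQ_apply, LinearMap.zero_apply]
      exact (Submodule.Quotient.mk_eq_zero _).mpr (h2 a a.2 ha b b.2))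

theorem subquotBilin_mk (β : A →ₗ[k] B →ₗ[k] C) (KA NA : Submodule k A) (KB NB : Submodule k B)
    (KC NC : Submodule k C) (h1 h2 h3) (a : KA) (b : KB) :
    subquotBilin β KA NA KB NB KC NC h1 h2 h3 (Submodule.Quotient.mk a) (Submodule.Quotient.mk b)
      = Submodule.Quotient.mk ⟨β a b, h1 a a.2 b b.2⟩ := rfl

end Subquotient

/-! ## Lie superalgebras and supermodules -/

/-- A Lie superalgebra over `k`. -/
structure LieSuperalg (k : Type u) [Field k] where
  carrier : Type u
  [acg : AddCommGroup carrier]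
  [mod : Module k carrier]
  gr : ZMod 2 → Submodule k carrier
  isCompl : IsCompl (gr 0) (gr 1)
  br : carrier →ₗ[k] carrier →ₗ[k] carrier
  br_mem : ∀ {p q : ZMod 2} {x y : carrier}, x ∈ gr p → y ∈ gr q → br x y ∈ gr (p + q)
  skew : ∀ {p q : ZMod 2} {x y : carrier}, x ∈ gr p → y ∈ gr q → br x y = -(sgn p q • br y x)
  jacobi : ∀ {p q : ZMod 2} {x y : carrier} (z : carrier), x ∈ gr p → y ∈ gr q →
    br x (br y z) = br (br x y) z + sgn p q • br y (br x z)

attribute [instance] LieSuperalg.acg LieSuperalg.mod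

instance {k : Type u} [Field k] : CoeSort (LieSuperalg k) (Type u) := ⟨LieSuperalg.carrier⟩

variable {k : Type u} [Field k]

/-- A homomorphism of Lie superalgebras (parity preserving). -/
structure LieSuperalg.Hom (L L' : LieSuperalg k) where
  toLin : L →ₗ[k] L'
  map_gr : ∀ {p : ZMod 2} {x : L}, x ∈ L.gr p → toLin x ∈ L'.gr p
  map_br : ∀ x y : L, toLin (L.br x y) = L'.br (toLin x) (toLin y)

/-- The bracket only has to be checked on homogeneous elements. -/
def LieSuperalg.Hom.ofHomog {L L' : LieSuperalg k} (f : L →ₗ[k] L')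
    (hgr : ∀ {p : ZMod 2} {x : L}, x ∈ L.gr p → f x ∈ L'.gr p)
    (hbr : ∀ {p q : ZMod 2} {x y : L}, x ∈ L.gr p → y ∈ L.gr q →
      f (L.br x y) = L'.br (f x) (f y)) : LieSuperalg.Hom L L' where
  toLin := f
  map_gr := hgr
  map_br := fun x y => by
    obtain ⟨x0, hx0, x1, hx1, rfl⟩ := exists_decomp L.isCompl x
    obtain ⟨y0, hy0, y1, hy1, rfl⟩ := exists_decomp L.isCompl y
    simp only [map_add, LinearMap.add_apply, hbr hx0 hy0, hbr hx0 hy1, hbr hx1 hy0, hbr hx1 hy1]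

/-- A supermodule over a Lie superalgebra: a `ℤ/2`-graded vector space with a graded action. -/
structure SuperMod (L : LieSuperalg k) where
  V : Type u
  [acg : AddCommGroup V]
  [mod : Module k V]
  gr : ZMod 2 → Submodule k V
  isCompl : IsCompl (gr 0) (gr 1)
  act : L →ₗ[k] V →ₗ[k] V
  act_mem : ∀ {p q : ZMod 2} {x : L} {v : V}, x ∈ L.gr p → v ∈ gr q → act x v ∈ gr (p + q)
  act_br : ∀ {p q : ZMod 2} {x y : L} (v : V), x ∈ L.gr p → y ∈ L.gr q →
    act (L.br x y) v = act x (act y v) - sgn p q • act y (act x v)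

attribute [instance] SuperMod.acg SuperMod.mod

instance {L : LieSuperalg k} : CoeSort (SuperMod L) (Type u) := ⟨SuperMod.V⟩

/-- An (even) isomorphism of supermodules. -/
structure SuperMod.Iso {L : LieSuperalg k} (M N : SuperMod L) where
  toEquiv : M ≃ₗ[k] N
  map_gr : ∀ {p : ZMod 2} {v : M}, v ∈ M.gr p → toEquiv v ∈ N.gr p
  map_act : ∀ (x : L) (v : M), toEquiv (M.act x v) = N.act x (toEquiv v)

/-- Restriction of a supermodule along a homomorphism. -/
def SuperMod.pullback {L L' : LieSuperalg k} (f : LieSuperalg.Hom L L') (M : SuperMod L') :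
    SuperMod L where
  V := M
  gr := M.gr
  isCompl := M.isCompl
  act := M.act ∘ₗ f.toLin
  act_mem := fun hx hv => M.act_mem (f.map_gr hx) hv
  act_br := fun v hx hy => by
    simp only [LinearMap.comp_apply, f.map_br]
    exact M.act_br v (f.map_gr hx) (f.map_gr hy)

/-- The `p`-fold parity shift `Π^p M`: the same space and action, with parities shifted by `p`.
(The convention that twists the action of odd elements by a sign gives an isomorphic module.) -/
def SuperMod.shift {L : LieSuperalg k} (p : ZMod 2) (M : SuperMod L) : SuperMod L where
  V := M
  gr := fun q => M.gr (q + p)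
  isCompl := by
    rcases zmod2_cases p with rfl | rfl
    · simpa using M.isCompl
    · have := M.isCompl.symm
      simpa [one_add_one_zmod2] using this
  act := M.act
  act_mem := fun hx hv => by rw [add_assoc]; exact M.act_mem hx hv
  act_br := fun v hx hy => M.act_br v hx hy

/-- The adjoint supermodule. -/
def LieSuperalg.adjoint (L : LieSuperalg k) : SuperMod L where
  V := L
  gr := L.gr
  isCompl := L.isCompl
  act := L.br
  act_mem := L.br_mem
  act_br := fun v hx hy => by rw [L.jacobi v hx hy]; abel

/-! ### Subsupermodules, quotients, simple tops -/

/-- `N` is a (graded, invariant) subsupermodule of `M`. -/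
structure SuperMod.IsSub {L : LieSuperalg k} (M : SuperMod L) (N : Submodule k M) : Prop where
  graded : IsGradedSub M.gr N
  invariant : ∀ (x : L), ∀ v ∈ N, M.act x v ∈ N

/-- The quotient of a supermodule by a subsupermodule. -/
def SuperMod.quot {L : LieSuperalg k} (M : SuperMod L) (N : Submodule k M) (hN : M.IsSub N) :
    SuperMod L where
  V := M ⧸ N
  gr := fun p => (M.gr p).map N.mkQ
  isCompl := isCompl_map_mkQ M.isCompl hN.graded
  act :=
    { toFun := fun x => N.mapQ N (M.act x) (fun v hv => hN.invariant x v hv)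
      map_add' := fun x y => by
        refine Submodule.linearMap_qext _ (LinearMap.ext fun b => ?_)
        simp
      map_smul' := fun c x => by
        refine Submodule.linearMap_qext _ (LinearMap.ext fun b => ?_)
        simp }
  act_mem := by
    rintro p q x _ hx ⟨v, hv, rfl⟩
    exact ⟨M.act x v, M.act_mem hx hv, rfl⟩
  act_br := by
    intro p q x y v hx hy
    obtain ⟨v, rfl⟩ := Submodule.mkQ_surjective N v
    have := congrArg N.mkQ (M.act_br v hx hy)
    rw [map_sub, map_zsmul] at this
    exact this

/-- The sum of all proper subsupermodules. -/
def SuperMod.sumProper {L : LieSuperalg k} (M : SuperMod L) : Submodule k M :=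
  sSup {N | M.IsSub N ∧ N ≠ ⊤}

theorem SuperMod.sumProper_isSub {L : LieSuperalg k} (M : SuperMod L) : M.IsSub M.sumProper := by
  constructor
  · intro v hv
    rw [SuperMod.sumProper, sSup_eq_iSup'] at hv
    induction hv using Submodule.iSup_induction' with
    | mem N v hv =>
      obtain ⟨a, ha, b, hb, haN, hbN, e⟩ := N.2.1.graded v hv
      exact ⟨a, ha, b, hb, (le_sSup N.2 : N.1 ≤ _) haN, (le_sSup N.2 : N.1 ≤ _) hbN, e⟩
    | zero => exact ⟨0, zero_mem _, 0, zero_mem _, zero_mem _, zero_mem _, by simp⟩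
    | add v w _ _ hv hw =>
      obtain ⟨a, ha, b, hb, haN, hbN, e⟩ := hv
      obtain ⟨a', ha', b', hb', haN', hbN', e'⟩ := hw
      exact ⟨a + a', add_mem ha ha', b + b', add_mem hb hb', add_mem haN haN',
        add_mem hbN hbN', by rw [e, e']; abel⟩
  · intro x v hv
    rw [SuperMod.sumProper, sSup_eq_iSup'] at hv
    induction hv using Submodule.iSup_induction' with
    | mem N v hv => exact (le_sSup N.2 : N.1 ≤ _) (N.2.1.invariant x v hv)
    | zero => rw [map_zero]; exact zero_mem _
    | add v w _ _ hv hw => rw [map_add]; exact add_mem hv hw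

/-- The simple top of a highest weight supermodule: its quotient by its largest proper
subsupermodule, which is the sum of all of them. -/
def SuperMod.simpleTop {L : LieSuperalg k} (M : SuperMod L) : SuperMod L :=
  M.quot M.sumProper M.sumProper_isSub

/-! ### Subsuperalgebras -/

/-- A Lie subsuperalgebra. -/
structure LieSuperalg.Sub (L : LieSuperalg k) where
  S : Submodule k L
  graded : IsGradedSub L.gr S
  closed : ∀ x ∈ S, ∀ y ∈ S, L.br x y ∈ S

/-- A Lie subsuperalgebra as a Lie superalgebra in its own right. -/
def LieSuperalg.Sub.toAlg {L : LieSuperalg k} (P : L.Sub) : LieSuperalg k where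
  carrier := P.S
  gr := fun p => (L.gr p).comap P.S.subtype
  isCompl := isCompl_comap L.isCompl P.graded
  br := LinearMap.mk₂ k (fun x y => ⟨L.br x y, P.closed x x.2 y y.2⟩)
    (fun _ _ _ => Subtype.ext (by simp)) (fun _ _ _ => Subtype.ext (by simp))
    (fun _ _ _ => Subtype.ext (by simp)) (fun _ _ _ => Subtype.ext (by simp))
  br_mem := fun hx hy => L.br_mem hx hy
  skew := fun hx hy => Subtype.ext (by simpa using L.skew hx hy)
  jacobi := fun z hx hy => Subtype.ext (by simpa using L.jacobi (z : L) hx hy)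

/-- The inclusion of a Lie subsuperalgebra. -/
def LieSuperalg.Sub.incl {L : LieSuperalg k} (P : L.Sub) : LieSuperalg.Hom P.toAlg L where
  toLin := P.S.subtype
  map_gr := fun hx => hx
  map_br := fun _ _ => rfl

/-- The inclusion between two nested Lie subsuperalgebras. -/
def LieSuperalg.Sub.inclLE {L : LieSuperalg k} (P Q : L.Sub) (h : P.S ≤ Q.S) :
    LieSuperalg.Hom P.toAlg Q.toAlg where
  toLin := Submodule.inclusion h
  map_gr := fun hx => hx
  map_br := fun _ _ => rfl

/-! ## Universal enveloping superalgebra and induction -/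

/-- The relations `x y = (-1)^{|x||y|} y x + [x, y]` for homogeneous `x`, `y`. -/
inductive UEARel (L : LieSuperalg k) : TensorAlgebra k L → TensorAlgebra k L → Prop
  | mk {p q : ZMod 2} {x y : L} (hx : x ∈ L.gr p) (hy : y ∈ L.gr q) :
      UEARel L (TensorAlgebra.ι k x * TensorAlgebra.ι k y)
        (sgn p q • (TensorAlgebra.ι k y * TensorAlgebra.ι k x) + TensorAlgebra.ι k (L.br x y))

/-- The universal enveloping (super)algebra `U(L)`. -/
def UEA (L : LieSuperalg k) : Type u := RingQuot (UEARel L)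

instance (L : LieSuperalg k) : Ring (UEA L) := inferInstanceAs (Ring (RingQuot (UEARel L)))
instance (L : LieSuperalg k) : Algebra k (UEA L) :=
  inferInstanceAs (Algebra k (RingQuot (UEARel L)))

/-- The canonical map `L → U(L)`. -/
def UEA.ι (L : LieSuperalg k) : L →ₗ[k] UEA L :=
  (RingQuot.mkAlgHom k (UEARel L)).toLinearMap ∘ₗ TensorAlgebra.ι k

theorem UEA.ι_br (L : LieSuperalg k) {p q : ZMod 2} {x y : L} (hx : x ∈ L.gr p)
    (hy : y ∈ L.gr q) :
    UEA.ι L (L.br x y) = UEA.ι L x * UEA.ι L y - sgn p q • (UEA.ι L y * UEA.ι L x) := by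
  have := RingQuot.mkAlgHom_rel k (UEARel.mk hx hy)
  rw [map_add, map_mul, map_zsmul, map_mul] at this
  exact eq_sub_of_add_eq' this.symm

/-- The universal property of `U(L)`. -/
def UEA.lift (L : LieSuperalg k) {A : Type u} [Ring A] [Algebra k A] (f : L →ₗ[k] A)
    (hf : ∀ {p q : ZMod 2} {x y : L}, x ∈ L.gr p → y ∈ L.gr q →
      f (L.br x y) = f x * f y - sgn p q • (f y * f x)) : UEA L →ₐ[k] A :=
  RingQuot.liftAlgHom k ⟨TensorAlgebra.lift k f, by
    rintro _ _ ⟨hx, hy⟩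
    simp [hf hx hy]⟩

theorem UEA.lift_ι (L : LieSuperalg k) {A : Type u} [Ring A] [Algebra k A] (f : L →ₗ[k] A)
    (hf : ∀ {p q : ZMod 2} {x y : L}, x ∈ L.gr p → y ∈ L.gr q →
      f (L.br x y) = f x * f y - sgn p q • (f y * f x)) (x : L) :
    UEA.lift L f hf (UEA.ι L x) = f x := by
  change RingQuot.liftAlgHom k _ (RingQuot.mkAlgHom k (UEARel L) (TensorAlgebra.ι k x)) = f x
  rw [RingQuot.liftAlgHom_mkAlgHom_apply, TensorAlgebra.lift_ι_apply]

theorem UEA.hom_ext (L : LieSuperalg k) {A : Type u} [Ring A] [Algebra k A]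
    {f g : UEA L →ₐ[k] A} (h : ∀ x, f (UEA.ι L x) = g (UEA.ι L x)) : f = g := by
  apply RingQuot.ringQuot_ext'
  apply TensorAlgebra.hom_ext
  exact LinearMap.ext h

theorem UEA.parity_aux (L : LieSuperalg k) {p q : ZMod 2} {x y : L} (hx : x ∈ L.gr p)
    (hy : y ∈ L.gr q) :
    (UEA.ι L ∘ₗ parityOp L.gr L.isCompl) (L.br x y) =
      (UEA.ι L ∘ₗ parityOp L.gr L.isCompl) x * (UEA.ι L ∘ₗ parityOp L.gr L.isCompl) y -
        sgn p q •
          ((UEA.ι L ∘ₗ parityOp L.gr L.isCompl) y * (UEA.ι L ∘ₗ parityOp L.gr L.isCompl) x) := by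
  simp only [LinearMap.comp_apply, parityOp_apply _ hx, parityOp_apply _ hy,
    parityOp_apply _ (L.br_mem hx hy), map_zsmul, UEA.ι_br L hx hy]
  rcases zmod2_cases p with rfl | rfl <;> rcases zmod2_cases q with rfl | rfl <;>
    simp [one_add_one_zmod2, sub_eq_add_neg, add_comm]

/-- The parity automorphism of `U(L)`, extending `x ↦ (-1)^{|x|} x` on `L`. -/
def UEA.parity (L : LieSuperalg k) : UEA L →ₐ[k] UEA L :=
  UEA.lift L (UEA.ι L ∘ₗ parityOp L.gr L.isCompl) (UEA.parity_aux L)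

theorem UEA.parity_ι (L : LieSuperalg k) (x : L) :
    UEA.parity L (UEA.ι L x) = UEA.ι L (parityOp L.gr L.isCompl x) :=
  UEA.lift_ι L _ (UEA.parity_aux L) x

theorem UEA.parity_invol (L : LieSuperalg k) (a : UEA L) :
    UEA.parity L (UEA.parity L a) = a := by
  have : (UEA.parity L).comp (UEA.parity L) = AlgHom.id k _ :=
    UEA.hom_ext L fun x => by simp [UEA.parity_ι, parityOp_invol]
  exact DFunLike.congr_fun this a

/-- The `ℤ/2`-grading of `U(L)`: eigenspaces of the parity automorphism. -/
def UEA.gr (L : LieSuperalg k) (p : ZMod 2) : Submodule k (UEA L) :=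
  LinearMap.ker ((UEA.parity L).toLinearMap - (sgn 1 p) • LinearMap.id)

theorem UEA.mem_gr (L : LieSuperalg k) {p : ZMod 2} {a : UEA L} :
    a ∈ UEA.gr L p ↔ UEA.parity L a = sgn 1 p • a := by
  simp [UEA.gr, sub_eq_zero]

theorem UEA.ι_mem (L : LieSuperalg k) {p : ZMod 2} {x : L} (hx : x ∈ L.gr p) :
    UEA.ι L x ∈ UEA.gr L p := by
  rw [UEA.mem_gr, UEA.parity_ι, parityOp_apply _ hx, map_zsmul]

theorem UEA.mul_mem (L : LieSuperalg k) {p q : ZMod 2} {a b : UEA L} (ha : a ∈ UEA.gr L p)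
    (hb : b ∈ UEA.gr L q) : a * b ∈ UEA.gr L (p + q) := by
  rw [UEA.mem_gr] at *
  rw [map_mul, ha, hb]
  rcases zmod2_cases p with rfl | rfl <;> rcases zmod2_cases q with rfl | rfl <;>
      simp [one_add_one_zmod2]

theorem UEA.exists_decomp [CharZero k] (L : LieSuperalg k) (a : UEA L) :
    ∃ a₀ ∈ UEA.gr L 0, ∃ a₁ ∈ UEA.gr L 1, a = a₀ + a₁ := by
  refine ⟨(2⁻¹ : k) • (a + UEA.parity L a), ?_, (2⁻¹ : k) • (a - UEA.parity L a), ?_, ?_⟩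
  · rw [UEA.mem_gr, map_smul, map_add, UEA.parity_invol]
    simp [add_comm]
  · rw [UEA.mem_gr, map_smul, map_sub, UEA.parity_invol]
    simp [← smul_neg]
  · rw [← smul_add, add_add_sub_cancel, ← two_smul k a, smul_smul]
    simp

section Ind

variable {P G : LieSuperalg k} (f : LieSuperalg.Hom P G) (M : SuperMod P)

/-- The `U(G)`-submodule of `U(G) ⊗ M` generated by the elements `p ⊗ m - 1 ⊗ p m`, so that
the quotient is `U(G) ⊗_{U(P)} M`. -/
def indRel : Submodule (UEA G) (UEA G ⊗[k] M) :=
  Submodule.span (UEA G)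
    {t | ∃ (p : P) (m : M), t = UEA.ι G (f.toLin p) ⊗ₜ[k] m - 1 ⊗ₜ[k] (M.act p m)}

/-- The underlying space of the induced module, `U(G) ⊗_{U(P)} M`. -/
abbrev IndSpace : Type u := (UEA G ⊗[k] M) ⧸ indRel f M

/-- The class of `a ⊗ m` in the induced module. -/
def indMk : UEA G →ₗ[k] M →ₗ[k] IndSpace f M :=
  (TensorProduct.mk k (UEA G) M).compr₂ ((indRel f M).mkQ.restrictScalars k)

theorem indMk_apply (a : UEA G) (m : M) :
    indMk f M a m = Submodule.Quotient.mk (a ⊗ₜ[k] m) := rfl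

theorem smul_indMk (a b : UEA G) (m : M) : a • indMk f M b m = indMk f M (a * b) m := by
  simp only [indMk_apply, ← Submodule.Quotient.mk_smul]
  rfl

theorem indMk_ι (p : P) (m : M) :
    indMk f M (UEA.ι G (f.toLin p)) m = indMk f M 1 (M.act p m) := by
  rw [indMk_apply, indMk_apply, Submodule.Quotient.eq]
  exact Submodule.subset_span ⟨p, m, rfl⟩

theorem ind_induction {C : IndSpace f M → Prop} (h0 : C 0)
    (hadd : ∀ x y, C x → C y → C (x + y)) (hmk : ∀ a m, C (indMk f M a m)) (x) : C x := by
  obtain ⟨t, rfl⟩ := Submodule.Quotient.mk_surjective _ x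
  induction t using TensorProduct.induction_on with
  | zero => exact h0
  | tmul a m => exact hmk a m
  | add s t hs ht => rw [Submodule.Quotient.mk_add]; exact hadd _ _ hs ht

/-- The grading of the induced module: `a ⊗ m` has parity `|a| + |m|`. -/
def indGr (r : ZMod 2) : Submodule k (IndSpace f M) :=
  Submodule.span k {v | ∃ p q : ZMod 2, p + q = r ∧ ∃ a ∈ UEA.gr G p, ∃ m ∈ M.gr q,
    v = indMk f M a m}

/-- The parity involution on `U(G) ⊗ M`. -/
def tensorParity : (UEA G ⊗[k] M) →ₗ[k] (UEA G ⊗[k] M) :=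
  TensorProduct.map (UEA.parity G).toLinearMap (parityOp M.gr M.isCompl)

theorem tensorParity_smul (a : UEA G) (t : UEA G ⊗[k] M) :
    tensorParity M (a • t) = UEA.parity G a • tensorParity M t := by
  induction t using TensorProduct.induction_on with
  | zero => simp
  | tmul b m => simp [tensorParity, TensorProduct.smul_tmul']
  | add s t hs ht => rw [smul_add, map_add, map_add, smul_add, hs, ht]

theorem parityOp_act (p : P) (m : M) :
    parityOp M.gr M.isCompl (M.act p m) =
      M.act (parityOp P.gr P.isCompl p) (parityOp M.gr M.isCompl m) := by
  obtain ⟨p0, hp0, p1, hp1, rfl⟩ := exists_decomp P.isCompl p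
  obtain ⟨m0, hm0, m1, hm1, rfl⟩ := exists_decomp M.isCompl m
  simp only [map_add, LinearMap.add_apply, parityOp_apply _ hp0, parityOp_apply _ hp1,
    parityOp_apply _ hm0, parityOp_apply _ hm1, parityOp_apply _ (M.act_mem hp0 hm0),
    parityOp_apply _ (M.act_mem hp0 hm1), parityOp_apply _ (M.act_mem hp1 hm0),
    parityOp_apply _ (M.act_mem hp1 hm1)]
  simp [one_add_one_zmod2]

theorem parityOp_hom (p : P) :
    parityOp G.gr G.isCompl (f.toLin p) = f.toLin (parityOp P.gr P.isCompl p) := by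
  obtain ⟨p0, hp0, p1, hp1, rfl⟩ := exists_decomp P.isCompl p
  simp only [map_add, parityOp_apply _ hp0, parityOp_apply _ hp1, parityOp_apply _ (f.map_gr hp0),
    parityOp_apply _ (f.map_gr hp1), map_zsmul]

theorem tensorParity_mem {t : UEA G ⊗[k] M} (ht : t ∈ indRel f M) :
    tensorParity M t ∈ indRel f M := by
  induction ht using Submodule.span_induction with
  | mem t ht =>
    obtain ⟨p, m, rfl⟩ := ht
    refine Submodule.subset_span ⟨parityOp P.gr P.isCompl p, parityOp M.gr M.isCompl m, ?_⟩
    simp [tensorParity, UEA.parity_ι, parityOp_hom, parityOp_act]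
  | zero => rw [map_zero]; exact zero_mem _
  | add s t _ _ hs ht => rw [map_add]; exact add_mem hs ht
  | smul a t _ ht => rw [tensorParity_smul]; exact Submodule.smul_mem _ _ ht

/-- The parity involution on the induced module. -/
def indParity : IndSpace f M →ₗ[k] IndSpace f M :=
  ((indRel f M).restrictScalars k).liftQ
    (((indRel f M).mkQ.restrictScalars k) ∘ₗ tensorParity M) (by
      intro t ht
      rw [LinearMap.mem_ker]
      exact (Submodule.Quotient.mk_eq_zero _).mpr (tensorParity_mem f M ht))

theorem indParity_mk (a : UEA G) (m : M) :
    indParity f M (indMk f M a m) =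
      indMk f M (UEA.parity G a) (parityOp M.gr M.isCompl m) := rfl

theorem indParity_apply {r : ZMod 2} {v : IndSpace f M} (hv : v ∈ indGr f M r) :
    indParity f M v = sgn 1 r • v := by
  induction hv using Submodule.span_induction with
  | mem v hv =>
    obtain ⟨p, q, rfl, a, ha, m, hm, rfl⟩ := hv
    rw [indParity_mk, (UEA.mem_gr G).mp ha, parityOp_apply _ hm]
    rcases zmod2_cases p with rfl | rfl <;> rcases zmod2_cases q with rfl | rfl <;>
      simp [one_add_one_zmod2]
  | zero => simp
  | add s t _ _ hs ht => rw [map_add, hs, ht, smul_add]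
  | smul c t _ ht => rw [map_smul, ht, smul_comm]

theorem indGr_isCompl [CharZero k] : IsCompl (indGr f M 0) (indGr f M 1) := by
  constructor
  · rw [Submodule.disjoint_def]
    intro v h0 h1
    have e0 := indParity_apply f M h0
    have e1 := indParity_apply f M h1
    rw [e0] at e1
    simp only [sgn_zero_right, sgn_one_one, one_smul, neg_smul] at e1
    have h2 : (2 : k) • v = 0 := by rw [two_smul]; nth_rewrite 1 [e1]; simp
    simpa using h2
  · rw [codisjoint_iff, eq_top_iff]
    rintro v -
    induction v using ind_induction with
    | h0 => exact zero_mem _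
    | hadd x y hx hy => exact add_mem hx hy
    | hmk a m =>
      obtain ⟨a0, ha0, a1, ha1, rfl⟩ := UEA.exists_decomp G a
      obtain ⟨m0, hm0, m1, hm1, rfl⟩ := exists_decomp M.isCompl m
      simp only [map_add, LinearMap.add_apply]
      have key : ∀ {p q : ZMod 2} {a : UEA G} {m : M}, a ∈ UEA.gr G p → m ∈ M.gr q →
          indMk f M a m ∈ indGr f M 0 ⊔ indGr f M 1 := by
        intro p q a m ha hm
        have : indMk f M a m ∈ indGr f M (p + q) :=
          Submodule.subset_span ⟨p, q, rfl, a, ha, m, hm, rfl⟩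
        rcases zmod2_cases (p + q) with e | e <;> rw [e] at this
        · exact Submodule.mem_sup_left this
        · exact Submodule.mem_sup_right this
      exact add_mem (add_mem (key ha0 hm0) (key ha1 hm0)) (add_mem (key ha0 hm1) (key ha1 hm1))

/-- The induced supermodule `Ind_P^G M = U(G) ⊗_{U(P)} M`. -/
def Ind [CharZero k] : SuperMod G where
  V := IndSpace f M
  gr := indGr f M
  isCompl := indGr_isCompl f M
  act := (Algebra.lsmul k k (IndSpace f M)).toLinearMap ∘ₗ UEA.ι G
  act_mem := by
    intro r s x v hx hv
    change UEA.ι G x • v ∈ _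
    induction hv using Submodule.span_induction with
    | mem v hv =>
      obtain ⟨p, q, rfl, a, ha, m, hm, rfl⟩ := hv
      rw [smul_indMk]
      exact Submodule.subset_span
        ⟨r + p, q, add_assoc _ _ _, _, UEA.mul_mem G (UEA.ι_mem G hx) ha, m, hm, rfl⟩
    | zero => rw [smul_zero]; exact zero_mem _
    | add s t _ _ hs ht => rw [smul_add]; exact add_mem hs ht
    | smul c t _ ht => rw [smul_comm]; exact Submodule.smul_mem _ _ ht
  act_br := by
    intro p q x y v hx hy
    change UEA.ι G (G.br x y) • v =
      UEA.ι G x • (UEA.ι G y • v) - sgn p q • (UEA.ι G y • (UEA.ι G x • v))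
    rw [UEA.ι_br G hx hy, sub_smul, smul_assoc, mul_smul, mul_smul]

end Ind

/-! ## The Duflo--Serganova functor -/

section DS

/-- The odd elements `x` with `[x, x] = 0`. -/
def LieSuperalg.X (L : LieSuperalg k) : Set L := {x | x ∈ L.gr 1 ∧ L.br x x = 0}

/-- `ker T / im T` for an operator `T` (with `T ∘ T = 0` in the cases of interest). -/
abbrev Homology {V : Type u} [AddCommGroup V] [Module k V] (T : V →ₗ[k] V) : Type u :=
  Subquot (LinearMap.ker T) (LinearMap.range T)

/-- The grading of `ker T / im T` induced by a grading of the space. -/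
def homologyGr {V : Type u} [AddCommGroup V] [Module k V] (gr : ZMod 2 → Submodule k V)
    (T : V →ₗ[k] V) (p : ZMod 2) : Submodule k (Homology T) :=
  ((gr p).comap (LinearMap.ker T).subtype).map
    ((LinearMap.range T).comap (LinearMap.ker T).subtype).mkQ

theorem isCompl_subquot {V : Type u} [AddCommGroup V] [Module k V] {gr : ZMod 2 → Submodule k V}
    (h : IsCompl (gr 0) (gr 1)) {K N : Submodule k V} (hK : IsGradedSub gr K)
    (hN : IsGradedSub gr N) :
    IsCompl (((gr 0).comap K.subtype).map (N.comap K.subtype).mkQ)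
      (((gr 1).comap K.subtype).map (N.comap K.subtype).mkQ) := by
  refine isCompl_map_mkQ (gr := fun p => (gr p).comap K.subtype) (isCompl_comap h hK) ?_
  rintro ⟨v, hv⟩ hvN
  obtain ⟨a, ha, b, hb, haK, hbK, e⟩ := hK v hv
  obtain ⟨a', ha', b', hb', haN, hbN, e'⟩ := hN v hvN
  obtain ⟨rfl, rfl⟩ := decomp_unique h ha hb ha' hb' (e.symm.trans e')
  exact ⟨⟨a, haK⟩, ha, ⟨b, hbK⟩, hb, haN, hbN, Subtype.ext e⟩

variable {L : LieSuperalg k} (M : SuperMod L) {x : L}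

theorem ds_ker_graded (hx : x ∈ L.gr 1) : IsGradedSub M.gr (LinearMap.ker (M.act x)) := by
  intro v hv
  obtain ⟨a, ha, b, hb, rfl⟩ := exists_decomp M.isCompl v
  rw [LinearMap.mem_ker, map_add] at hv
  have h1 := M.act_mem hx ha
  have h2 := M.act_mem hx hb
  rw [add_zero] at h1
  rw [one_add_one_zmod2] at h2
  have := decomp_unique M.isCompl h2 h1 (zero_mem _) (zero_mem _) (by rw [add_comm, hv, add_zero])
  exact ⟨a, ha, b, hb, this.2, this.1, rfl⟩

theorem ds_range_graded (hx : x ∈ L.gr 1) : IsGradedSub M.gr (LinearMap.range (M.act x)) := by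
  rintro _ ⟨v, rfl⟩
  obtain ⟨a, ha, b, hb, rfl⟩ := exists_decomp M.isCompl v
  have h1 := M.act_mem hx ha
  have h2 := M.act_mem hx hb
  rw [add_zero] at h1
  rw [one_add_one_zmod2] at h2
  exact ⟨_, h2, _, h1, ⟨b, rfl⟩, ⟨a, rfl⟩, by rw [map_add, add_comm]⟩

theorem br_ker_graded (hx : x ∈ L.gr 1) : IsGradedSub L.gr (LinearMap.ker (L.br x)) :=
  ds_ker_graded L.adjoint hx

theorem br_range_graded (hx : x ∈ L.gr 1) : IsGradedSub L.gr (LinearMap.range (L.br x)) :=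
  ds_range_graded L.adjoint hx

variable {M} in
theorem act_comm_homog (hx : x ∈ L.gr 1) {q : ZMod 2} {a : L} (ha : a ∈ L.gr q) (v : M) :
    M.act x (M.act a v) = M.act (L.br x a) v + sgn 1 q • M.act a (M.act x v) := by
  rw [M.act_br v hx ha]; abel

theorem ds_h1 (hx : x ∈ L.gr 1) :
    ∀ a ∈ LinearMap.ker (L.br x), ∀ v ∈ LinearMap.ker (M.act x),
      M.act a v ∈ LinearMap.ker (M.act x) := by
  intro a ha v hv
  obtain ⟨a0, h0, a1, h1, ha0, ha1, rfl⟩ := br_ker_graded hx a ha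
  have e0 := act_comm_homog hx h0 v
  have e1 := act_comm_homog hx h1 v
  rw [LinearMap.mem_ker] at *
  rw [hv, ha0] at e0
  rw [hv, ha1] at e1
  rw [map_add, LinearMap.add_apply, map_add, e0, e1]
  simp

theorem ds_h2 (hx : x ∈ L.gr 1) :
    ∀ a ∈ LinearMap.ker (L.br x), a ∈ LinearMap.range (L.br x) →
      ∀ v ∈ LinearMap.ker (M.act x), M.act a v ∈ LinearMap.range (M.act x) := by
  rintro _ - ⟨c, rfl⟩ v hv
  obtain ⟨c0, h0, c1, h1, rfl⟩ := exists_decomp L.isCompl c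
  have e0 := act_comm_homog hx h0 v
  have e1 := act_comm_homog hx h1 v
  rw [LinearMap.mem_ker] at hv
  rw [hv, map_zero, smul_zero, add_zero] at e0 e1
  refine ⟨M.act (c0 + c1) v, ?_⟩
  rw [map_add, LinearMap.add_apply, map_add, e0, e1, map_add, map_add, LinearMap.add_apply]

theorem ds_h3 (hx : x ∈ L.gr 1) :
    ∀ a ∈ LinearMap.ker (L.br x), ∀ v ∈ LinearMap.ker (M.act x),
      v ∈ LinearMap.range (M.act x) → M.act a v ∈ LinearMap.range (M.act x) := by
  rintro a ha _ - ⟨w, rfl⟩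
  obtain ⟨a0, h0, a1, h1, ha0, ha1, rfl⟩ := br_ker_graded hx a ha
  have e0 := act_comm_homog hx h0 w
  have e1 := act_comm_homog hx h1 w
  rw [LinearMap.mem_ker] at ha0 ha1
  rw [ha0, map_zero, LinearMap.zero_apply, zero_add] at e0
  rw [ha1, map_zero, LinearMap.zero_apply, zero_add] at e1
  refine ⟨M.act a0 w - M.act a1 w, ?_⟩
  rw [map_sub, e0, e1, map_add, LinearMap.add_apply]
  simp

/-- The action of `DS_x L` on `DS_x M`, `[a] [v] = [a v]`. -/
def dsAct (hx : x ∈ L.gr 1) :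
    Homology (L.br x) →ₗ[k] Homology (M.act x) →ₗ[k] Homology (M.act x) :=
  subquotBilin M.act _ _ _ _ _ _ (ds_h1 M hx) (ds_h2 M hx) (ds_h3 M hx)

/-- The bracket of `DS_x L`, `[[a], [b]] = [[a, b]]`. -/
def dsBr (hx : x ∈ L.gr 1) :
    Homology (L.br x) →ₗ[k] Homology (L.br x) →ₗ[k] Homology (L.br x) :=
  subquotBilin L.br _ _ _ _ _ _ (ds_h1 L.adjoint hx) (ds_h2 L.adjoint hx) (ds_h3 L.adjoint hx)

theorem dsAct_mem (hx : x ∈ L.gr 1) {p q : ZMod 2} {a : Homology (L.br x)}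
    {v : Homology (M.act x)} (ha : a ∈ homologyGr L.gr (L.br x) p)
    (hv : v ∈ homologyGr M.gr (M.act x) q) :
    dsAct M hx a v ∈ homologyGr M.gr (M.act x) (p + q) := by
  obtain ⟨a, ha, rfl⟩ := ha
  obtain ⟨v, hv, rfl⟩ := hv
  exact ⟨⟨M.act a v, ds_h1 M hx a a.2 v v.2⟩, M.act_mem ha hv, rfl⟩

theorem dsAct_br (hx : x ∈ L.gr 1) {p q : ZMod 2} {a b : Homology (L.br x)}
    (v : Homology (M.act x)) (ha : a ∈ homologyGr L.gr (L.br x) p)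
    (hb : b ∈ homologyGr L.gr (L.br x) q) :
    dsAct M hx (dsBr hx a b) v =
      dsAct M hx a (dsAct M hx b v) - sgn p q • dsAct M hx b (dsAct M hx a v) := by
  obtain ⟨a, ha, rfl⟩ := ha
  obtain ⟨b, hb, rfl⟩ := hb
  obtain ⟨v, rfl⟩ := Submodule.Quotient.mk_surjective _ v
  have key := M.act_br (v : M) ha hb
  have h := ds_h1 M hx
  have hab : M.act a (M.act b v) ∈ LinearMap.ker (M.act x) := h _ a.2 _ (h _ b.2 _ v.2)
  have hba : M.act b (M.act a v) ∈ LinearMap.ker (M.act x) := h _ b.2 _ (h _ a.2 _ v.2)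
  have hbr : M.act (L.br a b) v ∈ LinearMap.ker (M.act x) :=
    h _ (ds_h1 L.adjoint hx _ a.2 _ b.2) _ v.2
  have key' : (⟨_, hbr⟩ : LinearMap.ker (M.act x)) = ⟨_, hab⟩ - sgn p q • ⟨_, hba⟩ :=
    Subtype.ext key
  exact congrArg (Submodule.Quotient.mk
    (p := (LinearMap.range (M.act x)).comap (LinearMap.ker (M.act x)).subtype)) key'

/-- The Lie superalgebra `DS_x L = ker (ad x) / im (ad x)`. -/
def DSAlg (L : LieSuperalg k) {x : L} (hx : x ∈ L.X) : LieSuperalg k where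
  carrier := Homology (L.br x)
  gr := homologyGr L.gr (L.br x)
  isCompl := isCompl_subquot L.isCompl (br_ker_graded hx.1) (br_range_graded hx.1)
  br := dsBr hx.1
  br_mem := dsAct_mem L.adjoint hx.1
  skew := by
    rintro p q _ _ ⟨a, ha, rfl⟩ ⟨b, hb, rfl⟩
    have key := L.skew ha hb
    have h := ds_h1 L.adjoint hx.1
    have key' : (⟨_, h _ a.2 _ b.2⟩ : LinearMap.ker (L.br x)) =
        -(sgn p q • ⟨_, h _ b.2 _ a.2⟩) := Subtype.ext key
    exact congrArg (Submodule.Quotient.mk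
      (p := (LinearMap.range (L.br x)).comap (LinearMap.ker (L.br x)).subtype)) key'
  jacobi := fun {p q a b} z ha hb => by
    have := dsAct_br L.adjoint hx.1 z ha hb
    exact (eq_add_of_sub_eq this.symm)

/-- The `DS_x L`-supermodule `DS_x M = ker x / im x`. -/
def DS (hx : x ∈ L.X) : SuperMod (DSAlg L hx) where
  V := Homology (M.act x)
  gr := homologyGr M.gr (M.act x)
  isCompl := isCompl_subquot M.isCompl (ds_ker_graded M hx.1) (ds_range_graded M hx.1)
  act := dsAct M hx.1
  act_mem := dsAct_mem M hx.1
  act_br := dsAct_br M hx.1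

end DS

/-! ## The general linear Lie superalgebra `gl(n|n)` -/

/-- The index set `{1, …, n} ⊔ {1, …, n}` of `gl(n|n)`: `inl i` is the index `i` (even, `ε_i`),
`inr i` is the index `n + i` (odd, `δ_i`). -/
abbrev Idx (n : ℕ) : Type := Fin n ⊕ Fin n

/-- The parity of an index. -/
def par {n : ℕ} : Idx n → ZMod 2 := Sum.elim (fun _ => 0) (fun _ => 1)

/-- The position of an index in its block; the principal good grading is
`deg e_{i,j} = pos j - pos i`. -/
def pos {n : ℕ} : Idx n → Fin n := Sum.elim id id

section GenLin

variable (k) (n : ℕ)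

/-- Square matrices of size `n|n`. -/
abbrev Mat : Type u := Matrix (Idx n) (Idx n) k

variable {n}

/-- The matrices supported on the positions in a relation `R`. -/
def supp (R : Idx n → Idx n → Prop) : Submodule k (Mat k n) where
  carrier := {A | ∀ i j, ¬ R i j → A i j = 0}
  add_mem' := fun ha hb i j h => by simp [ha i j h, hb i j h]
  zero_mem' := fun _ _ _ => rfl
  smul_mem' := fun c a ha i j h => by simp [ha i j h]

variable {k}

theorem supp_mul {R : Idx n → Idx n → Prop} (hR : ∀ i j l, R i j → R j l → R i l) {A B : Mat k n}
    (hA : A ∈ supp k R) (hB : B ∈ supp k R) : A * B ∈ supp k R := by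
  intro i l h
  rw [Matrix.mul_apply]
  refine Finset.sum_eq_zero fun j _ => ?_
  by_cases h1 : R i j
  · rw [hB j l (fun h2 => h (hR i j l h1 h2)), mul_zero]
  · rw [hA i j h1, zero_mul]

/-- The component of parity `p` of a matrix. -/
def comp (p : ZMod 2) : Mat k n →ₗ[k] Mat k n where
  toFun := fun A => Matrix.of fun i j => if par i + par j = p then A i j else 0
  map_add' := fun A B => by ext i j; by_cases h : par i + par j = p <;> simp [h]
  map_smul' := fun c A => by ext i j; by_cases h : par i + par j = p <;> simp [h]

theorem comp_apply (p : ZMod 2) (A : Mat k n) (i j : Idx n) :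
    comp p A i j = if par i + par j = p then A i j else 0 := rfl

variable (k n) in
/-- The grading of `gl(n|n)`: `e_{i,j}` has parity `|i| + |j|`. -/
def glGr (p : ZMod 2) : Submodule k (Mat k n) := supp k fun i j => par i + par j = p

theorem comp_mem (p : ZMod 2) (A : Mat k n) : comp p A ∈ glGr k n p := by
  intro i j h; rw [comp_apply, if_neg h]

theorem comp_mem_supp {R : Idx n → Idx n → Prop} (p : ZMod 2) {A : Mat k n} (hA : A ∈ supp k R) :
    comp p A ∈ supp k R := by
  intro i j h; rw [comp_apply, hA i j h, ite_self]

theorem comp_add_comp (A : Mat k n) : A = comp 0 A + comp 1 A := by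
  ext i j
  rw [Matrix.add_apply, comp_apply, comp_apply]
  rcases zmod2_cases (par i + par j) with h | h <;> simp [h]

theorem comp_of_mem {p : ZMod 2} {A : Mat k n} (hA : A ∈ glGr k n p) (q : ZMod 2) :
    comp q A = if p = q then A else 0 := by
  ext i j
  rw [comp_apply]
  by_cases h : par i + par j = p
  · rw [h]; split_ifs <;> rfl
  · rw [hA i j h, ite_self]
    split_ifs
    · exact (hA i j h).symm
    · rfl

theorem glGr_mul {p q : ZMod 2} {A B : Mat k n} (hA : A ∈ glGr k n p) (hB : B ∈ glGr k n q) :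
    A * B ∈ glGr k n (p + q) := by
  intro i l h
  rw [Matrix.mul_apply]
  refine Finset.sum_eq_zero fun j _ => ?_
  by_cases h1 : par i + par j = p
  · by_cases h2 : par j + par l = q
    · exfalso; apply h
      rw [← h1, ← h2]
      have : par j + par j = 0 := CharTwo.add_self_eq_zero _
      linear_combination -this
    · rw [hB j l h2, mul_zero]
  · rw [hA i j h1, zero_mul]

theorem glGr_isCompl : IsCompl (glGr k n 0) (glGr k n 1) := by
  constructor
  · rw [Submodule.disjoint_def]
    intro A h0 h1
    ext i j
    by_cases h : par i + par j = 0
    · exact h1 i j (by simp [h])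
    · exact h0 i j h
  · rw [codisjoint_iff, eq_top_iff]
    rintro A -
    exact Submodule.mem_sup.mpr ⟨_, comp_mem 0 A, _, comp_mem 1 A, (comp_add_comp A).symm⟩

/-- The supercommutator, `[A, B] = A B - (-1)^{|A||B|} B A` for homogeneous `A`, `B`. -/
def superBr : Mat k n →ₗ[k] Mat k n →ₗ[k] Mat k n :=
  LinearMap.mk₂ k (fun A B => A * B - ∑ p, ∑ q, sgn p q • (comp q B * comp p A))
    (fun A A' B => by
      simp only [map_add, add_mul, mul_add, smul_add, Finset.sum_add_distrib]; abel)
    (fun c A B => by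
      simp only [map_smul, smul_mul_assoc, mul_smul_comm, smul_sub, Finset.smul_sum,
        smul_comm c (_ : ℤ)])
    (fun A B B' => by
      simp only [map_add, add_mul, mul_add, smul_add, Finset.sum_add_distrib]; abel)
    (fun c A B => by
      simp only [map_smul, smul_mul_assoc, mul_smul_comm, smul_sub, Finset.smul_sum,
        smul_comm c (_ : ℤ)])

theorem superBr_apply (A B : Mat k n) :
    superBr A B = A * B - ∑ p, ∑ q, sgn p q • (comp q B * comp p A) := rfl

theorem superBr_homog {p q : ZMod 2} {A B : Mat k n} (hA : A ∈ glGr k n p) (hB : B ∈ glGr k n q) :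
    superBr A B = A * B - sgn p q • (B * A) := by
  rw [superBr_apply]
  congr 1
  rw [Finset.sum_eq_single p, Finset.sum_eq_single q]
  · rw [comp_of_mem hA, comp_of_mem hB, if_pos rfl, if_pos rfl]
  · intro r _ hr
    rw [comp_of_mem hB, if_neg (Ne.symm hr), zero_mul, smul_zero]
  · simp
  · intro r _ hr
    refine Finset.sum_eq_zero fun s _ => ?_
    rw [comp_of_mem hA, if_neg (Ne.symm hr), mul_zero, smul_zero]
  · simp

variable (k n) in
/-- The general linear Lie superalgebra `gl(n|n)`. -/
abbrev gl : LieSuperalg k where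
  carrier := Mat k n
  gr := glGr k n
  isCompl := glGr_isCompl
  br := superBr
  br_mem := fun {p q A B} hA hB => by
    rw [superBr_homog hA hB]
    refine sub_mem (glGr_mul hA hB) (zsmul_mem ?_ _)
    rw [add_comm]; exact glGr_mul hB hA
  skew := fun {p q A B} hA hB => by
    rw [superBr_homog hA hB, superBr_homog hB hA]
    rcases zmod2_cases p with rfl | rfl <;> rcases zmod2_cases q with rfl | rfl <;>
      simp [add_comm]
  jacobi := fun {p q A B} C hA hB => by
    have hAB : superBr A B ∈ glGr k n (p + q) := by
      rw [superBr_homog hA hB]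
      refine sub_mem (glGr_mul hA hB) (zsmul_mem ?_ _)
      rw [add_comm]; exact glGr_mul hB hA
    have key : ∀ {r : ZMod 2} {C : Mat k n}, C ∈ glGr k n r →
        superBr A (superBr B C) = superBr (superBr A B) C + sgn p q • superBr B (superBr A C) := by
      intro r C hC
      have hBC : superBr B C ∈ glGr k n (q + r) := by
        rw [superBr_homog hB hC]
        refine sub_mem (glGr_mul hB hC) (zsmul_mem ?_ _)
        rw [add_comm]; exact glGr_mul hC hB
      have hAC : superBr A C ∈ glGr k n (p + r) := by
        rw [superBr_homog hA hC]
        refine sub_mem (glGr_mul hA hC) (zsmul_mem ?_ _)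
        rw [add_comm]; exact glGr_mul hC hA
      rw [superBr_homog hA hBC, superBr_homog hAB hC, superBr_homog hB hAC, superBr_homog hB hC,
        superBr_homog hA hC, superBr_homog hA hB]
      rcases zmod2_cases p with rfl | rfl <;> rcases zmod2_cases q with rfl | rfl <;>
        rcases zmod2_cases r with rfl | rfl <;>
        simp only [sgn_zero_left, sgn_zero_right, sgn_one_one, one_add_one_zmod2, add_zero,
          zero_add, one_smul, neg_smul] <;> noncomm_ring
    rw [comp_add_comp C, map_add, map_add, key (comp_mem 0 C), key (comp_mem 1 C), map_add,
      map_add, map_add, smul_add]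
    abel

theorem superBr_mem_supp {R : Idx n → Idx n → Prop} (hR : ∀ i j l, R i j → R j l → R i l)
    {A B : Mat k n} (hA : A ∈ supp k R) (hB : B ∈ supp k R) : superBr A B ∈ supp k R := by
  rw [superBr_apply]
  refine sub_mem (supp_mul hR hA hB) (sum_mem fun p _ => sum_mem fun q _ => zsmul_mem ?_ _)
  exact supp_mul hR (comp_mem_supp q hB) (comp_mem_supp p hA)

variable (k) in
/-- The Lie subsuperalgebra of `gl(n|n)` spanned by the `e_{i,j}` with `R i j`, for a transitive
relation `R`. -/
def suppSub (R : Idx n → Idx n → Prop) (hR : ∀ i j l, R i j → R j l → R i l) : (gl k n).Sub where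
  S := supp k R
  graded := fun A hA => ⟨comp 0 A, comp_mem 0 A, comp 1 A, comp_mem 1 A, comp_mem_supp 0 hA,
    comp_mem_supp 1 hA, comp_add_comp A⟩
  closed := fun _ hA _ hB => superBr_mem_supp hR hA hB

variable (k n)

/-- `p_pr = ⨁_{d ≥ 0} g(d)`, spanned by the `e_{i,j}` with `deg e_{i,j} = pos j - pos i ≥ 0`. -/
def pPr : (gl k n).Sub :=
  suppSub k (fun i j => pos i ≤ pos j) (fun _ _ _ h1 h2 => le_trans h1 h2)

/-- The Levi factor `l_pr = g(0)`, a copy of `gl(1|1)^{⊕ n}` whose `i`-th summand is spanned by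
the matrix units with indices in `{i, n + i}`. -/
def lPr : (gl k n).Sub :=
  suppSub k (fun i j => pos i = pos j) (fun _ _ _ h1 h2 => h1.trans h2)

/-- The Borel subalgebra `o = () ⊕ ⋯ ⊕ ()` of `l_pr`, spanned by the Cartan subalgebra
and the `e_{i, n + i}`. -/
def bO : (gl k n).Sub :=
  suppSub k (fun i j => i = j ∨ ∃ a, i = Sum.inl a ∧ j = Sum.inr a) (by
    rintro i j l (rfl | ⟨a, rfl, rfl⟩) (rfl | ⟨b, h, rfl⟩)
    · exact Or.inl rfl
    · exact Or.inr ⟨b, h, rfl⟩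
    · exact Or.inr ⟨a, rfl, rfl⟩
    · simp at h)

theorem bO_le_lPr : (bO k n).S ≤ (lPr k n).S := by
  intro A hA i j h
  refine hA i j ?_
  rintro (rfl | ⟨a, rfl, rfl⟩)
  · exact h rfl
  · exact h rfl

variable {k n}

/-- The part of a matrix of degree `0` for the principal good grading. -/
def degZero : Mat k n →ₗ[k] Mat k n where
  toFun := fun A => Matrix.of fun i j => if pos i = pos j then A i j else 0
  map_add' := fun A B => by ext i j; by_cases h : pos i = pos j <;> simp [h]
  map_smul' := fun c A => by ext i j; by_cases h : pos i = pos j <;> simp [h]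

theorem degZero_apply (A : Mat k n) (i j : Idx n) :
    degZero A i j = if pos i = pos j then A i j else 0 := rfl

theorem degZero_mem (A : Mat k n) : degZero A ∈ (lPr k n).S := by
  intro i j h; rw [degZero_apply, if_neg h]

theorem degZero_gr {p : ZMod 2} {A : Mat k n} (hA : A ∈ glGr k n p) : degZero A ∈ glGr k n p := by
  intro i j h; rw [degZero_apply, hA i j h, ite_self]

theorem degZero_mul {A B : Mat k n} (hA : A ∈ (pPr k n).S) (hB : B ∈ (pPr k n).S) :
    degZero (A * B) = degZero A * degZero B := by
  ext i l
  rw [degZero_apply, Matrix.mul_apply, Matrix.mul_apply]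
  split_ifs with h
  · refine Finset.sum_congr rfl fun j _ => ?_
    rw [degZero_apply, degZero_apply]
    by_cases h1 : pos i = pos j
    · rw [if_pos h1, if_pos (h1.symm.trans h)]
    · rw [if_neg h1, zero_mul]
      by_cases h2 : pos i ≤ pos j
      · rw [hB j l (fun h3 => h1 (le_antisymm h2 (h ▸ h3))), mul_zero]
      · rw [hA i j h2, zero_mul]
  · symm
    refine Finset.sum_eq_zero fun j _ => ?_
    rw [degZero_apply, degZero_apply]
    by_cases h1 : pos i = pos j
    · rw [if_neg (fun h2 => h (h1.trans h2)), mul_zero]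
    · rw [if_neg h1, zero_mul]

variable (k n)

/-- The projection `p_pr → l_pr` that kills `⨁_{d > 0} g(d)`. -/
def pToL : LieSuperalg.Hom (pPr k n).toAlg (lPr k n).toAlg :=
  LieSuperalg.Hom.ofHomog
    ((degZero ∘ₗ (pPr k n).S.subtype).codRestrict (lPr k n).S fun A => degZero_mem A.1)
    (fun hA => degZero_gr hA)
    (by
      intro p q A B hA hB
      apply Subtype.ext
      change degZero (superBr A.1 B.1) = superBr (degZero A.1) (degZero B.1)
      obtain ⟨A, hA'⟩ := A
      obtain ⟨B, hB'⟩ := B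
      change A ∈ glGr k n p at hA
      change B ∈ glGr k n q at hB
      rw [superBr_homog hA hB, superBr_homog (degZero_gr hA) (degZero_gr hB), map_sub, map_zsmul,
        degZero_mul hA' hB', degZero_mul hB' hA'])

/-! ## Weights -/

/-- The lattice `Λ` of integral weights: `lam` stands for
`∑ lam (inl i) ε_i + ∑ lam (inr j) δ_j`, i.e. `lam i` is its value on `e_{i,i}`. -/
abbrev Weight : Type := Idx n → ℤ

variable {k n}

/-- The bilinear form on weights, `(ε_i, ε_j) = (-1)^{|i|} δ_{i,j}`. -/
def form (lam mu : Weight n) : ℤ := ∑ i, sgn 1 (par i) * (lam i * mu i)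

/-- The odd root `ε_i - δ_j`; these represent the odd roots modulo `±1`. -/
def oddRoot (r : Fin n × Fin n) : Weight n :=
  Pi.single (Sum.inl r.1) 1 - Pi.single (Sum.inr r.2) 1

variable (n) in
/-- The integral Weyl vector `ρ = ρ_0 - ρ_1 + ber / 2 = ∑ (1 - i) ε_i + ∑ (n - j) δ_j`
of the distinguished (upper triangular) Borel subalgebra. It vanishes for `n = 1`. -/
def rho : Weight n := Sum.elim (fun i => -(i : ℤ)) (fun j => (n : ℤ) - 1 - (j : ℤ))

/-- The atypicality of the simple `gl(n|n)`-module of highest weight `lam` with respect to the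
distinguished Borel subalgebra: the maximal number of distinct mutually orthogonal odd roots
(modulo `±1`) that are orthogonal to `lam + ρ`. -/
def aty (lam : Weight n) : ℕ :=
  (Finset.univ.filter fun S : Finset (Fin n × Fin n) =>
    (∀ r ∈ S, form (lam + rho n) (oddRoot r) = 0) ∧
      ∀ r ∈ S, ∀ s ∈ S, r ≠ s → form (oddRoot r) (oddRoot s) = 0).sup Finset.card

/-- The restriction of a weight to the `i`-th summand of `l_pr = gl(1|1)^{⊕ n}`. -/
def restr (i : Fin n) (lam : Weight n) : Weight 1 :=
  Sum.elim (fun _ => lam (Sum.inl i)) (fun _ => lam (Sum.inr i))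

variable (n) in
/-- `Λ^{maBG}`: the weights such that the atypicalities over the `n` summands `gl(1|1)` add up to
`n`. -/
def LambdaMaBG : Set (Weight n) := {lam | ∑ i, aty (restr i lam) = n}

/-- The parity `par(lam) = ∑ lam (inr j)` in `ℤ/2` of the weight `lam`. It satisfies `par(0) = 0`
and `par(lam + ε_i - ε_j) = par(lam) + |i| + |j|`. -/
def wtPar (lam : Weight n) : ZMod 2 := ((∑ j, lam (Sum.inr j) : ℤ) : ZMod 2)

/-- `pr_I`, the restriction to `gl(I)`, `I = {1, n + 1}`. -/
def prI (lam : Weight (n + 1)) : Weight 1 := restr 0 lam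

/-- `pr_J`, the restriction to `gl(J)`, where `J` consists of all other indices. -/
def prJ (lam : Weight (n + 1)) : Weight n := fun i => lam (Sum.map Fin.succ Fin.succ i)

/-! ## The Brundan--Goodwin modules -/

/-- `lam` as a linear functional on (the diagonal part of) matrices. -/
def wtFun (lam : Weight n) : Mat k n →ₗ[k] k :=
  ∑ i, (lam i : k) • Matrix.entryLinearMap k k i i

theorem wtFun_apply (lam : Weight n) (A : Mat k n) : wtFun lam A = ∑ i, (lam i : k) * A i i := by
  simp [wtFun]

theorem bO_diag_mul {A B : Mat k n} (hA : A ∈ (bO k n).S) (hB : B ∈ (bO k n).S) (i : Idx n) :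
    (A * B) i i = A i i * B i i := by
  rw [Matrix.mul_apply, Finset.sum_eq_single i]
  · intro j _ hj
    by_cases h : ∃ a, i = Sum.inl a ∧ j = Sum.inr a
    · obtain ⟨a, rfl, rfl⟩ := h
      rw [hB (Sum.inr a) (Sum.inl a) (by rintro (h | ⟨b, h, -⟩) <;> simp at h), mul_zero]
    · rw [hA i j (by rintro (h1 | h1); exacts [hj h1.symm, h h1]), zero_mul]
  · simp

theorem wtFun_odd (lam : Weight n) {A : Mat k n} (hA : A ∈ glGr k n 1) : wtFun lam A = 0 := by
  rw [wtFun_apply]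
  refine Finset.sum_eq_zero fun i _ => ?_
  rw [hA i i (by simp [CharTwo.add_self_eq_zero]), mul_zero]

theorem wtFun_br (lam : Weight n) {p q : ZMod 2} {A B : Mat k n} (hA : A ∈ glGr k n p)
    (hB : B ∈ glGr k n q) (hA' : A ∈ (bO k n).S) (hB' : B ∈ (bO k n).S) :
    wtFun lam (superBr A B) = 0 := by
  rw [superBr_homog hA hB, wtFun_apply]
  refine Finset.sum_eq_zero fun i _ => ?_
  rw [Matrix.sub_apply, Matrix.smul_apply, bO_diag_mul hA' hB', bO_diag_mul hB' hA']
  rcases zmod2_cases p with rfl | rfl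
  · simp [mul_comm]
  · have : A i i = 0 := hA i i (by simp [CharTwo.add_self_eq_zero])
    simp [this]

variable (k)

/-- The one-dimensional even module over the Borel subalgebra `o` on which the Cartan subalgebra
acts by `lam` and the odd part by zero. -/
def oneDim (lam : Weight n) : SuperMod (bO k n).toAlg where
  V := k
  gr := fun p => if p = 0 then ⊤ else ⊥
  isCompl := by simpa using isCompl_top_bot
  act := (LinearMap.lsmul k k) ∘ₗ wtFun lam ∘ₗ (bO k n).S.subtype
  act_mem := by
    intro p q x v hx hv
    obtain ⟨A, hA⟩ := x
    change A ∈ glGr k n p at hx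
    change wtFun lam A • v ∈ _
    rcases zmod2_cases p with rfl | rfl
    · rw [zero_add]; exact Submodule.smul_mem _ _ hv
    · rw [wtFun_odd lam hx, zero_smul]; exact zero_mem _
  act_br := by
    intro p q x y v hx hy
    obtain ⟨A, hA⟩ := x
    obtain ⟨B, hB⟩ := y
    change A ∈ glGr k n p at hx
    change B ∈ glGr k n q at hy
    change wtFun lam (superBr A B) • v =
      wtFun lam A • (wtFun lam B • v) - sgn p q • (wtFun lam B • (wtFun lam A • v))
    rw [wtFun_br lam hx hy hA hB]
    rcases zmod2_cases p with rfl | rfl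
    · simp only [sgn_zero_left, one_smul, zero_smul, smul_smul]
      rw [mul_comm, sub_self]
    · simp [wtFun_odd lam hx]

variable [CharZero k]

/-- The Verma module `M^o(lam)` of `l_pr = gl(1|1)^{⊕ n}`, with highest weight vector of parity
`par(lam)`. -/
def vermaO (lam : Weight n) : SuperMod (lPr k n).toAlg :=
  (Ind ((bO k n).inclLE (lPr k n) (bO_le_lPr k n)) (oneDim k lam)).shift (wtPar lam)

/-- The irreducible module `L^o(lam)` of `l_pr = gl(1|1)^{⊕ n}`, the simple top of `M^o(lam)`. -/
def LO (lam : Weight n) : SuperMod (lPr k n).toAlg := (vermaO k lam).simpleTop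

/-- The Brundan--Goodwin functor (on objects), `Ind_{p_pr}^g ∘ Infl_{l_pr}^{p_pr}`. -/
def BGfun (M : SuperMod (lPr k n).toAlg) : SuperMod (gl k n) :=
  Ind (pPr k n).incl (M.pullback (pToL k n))

/-- `BG_{n|n}(lam)`. -/
def BG (lam : Weight n) : SuperMod (gl k n) := BGfun k (LO k lam)

end GenLin

/-! ## `DS_{ε_1 - δ_1}` of `gl(n+1|n+1)` -/

section DSgl

variable (k) (n : ℕ)

/-- The root vector `e_{1, n + 1}` of the odd root `ε_1 - δ_1` (here of `gl(n+1|n+1)`, so that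
`1` and `n + 2` are the usual numbers of its indices). -/
def xRoot : Mat k (n + 1) := Matrix.single (Sum.inl 0) (Sum.inr 0) 1

theorem xRoot_odd : xRoot k n ∈ glGr k (n + 1) 1 := by
  intro i j h
  refine Matrix.single_apply_of_ne _ _ _ _ _ ?_
  rintro ⟨rfl, rfl⟩
  exact h (by simp [par])

theorem xRoot_mem : (xRoot k n : gl k (n + 1)) ∈ (gl k (n + 1)).X := by
  refine ⟨xRoot_odd k n, ?_⟩
  have h : xRoot k n * xRoot k n = 0 := Matrix.single_mul_single_of_ne _ _ _ _ (by simp) _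
  refine (superBr_homog (xRoot_odd k n) (xRoot_odd k n)).trans ?_
  rw [h, smul_zero, sub_zero]

/-- The inclusion of index sets that identifies `{1, …, n} ⊔ {1, …, n}` with `J`. -/
def sJ {n : ℕ} : Idx n → Idx (n + 1) := Sum.map Fin.succ Fin.succ

theorem sJ_inj {n : ℕ} : Function.Injective (sJ (n := n)) :=
  Sum.map_injective.mpr ⟨Fin.succ_injective n, Fin.succ_injective n⟩

theorem par_sJ {n : ℕ} (a : Idx n) : par (sJ a) = par a := by
  rcases a with a | a <;> rfl

theorem idx_cases {n : ℕ} (i : Idx (n + 1)) :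
    i = Sum.inl 0 ∨ i = Sum.inr 0 ∨ ∃ a : Idx n, i = sJ a := by
  rcases i with i | i
  · rcases Fin.eq_zero_or_eq_succ i with rfl | ⟨a, rfl⟩
    · exact Or.inl rfl
    · exact Or.inr (Or.inr ⟨Sum.inl a, rfl⟩)
  · rcases Fin.eq_zero_or_eq_succ i with rfl | ⟨a, rfl⟩
    · exact Or.inr (Or.inl rfl)
    · exact Or.inr (Or.inr ⟨Sum.inr a, rfl⟩)

theorem sJ_ne_inl {n : ℕ} (a : Idx n) : sJ a ≠ Sum.inl 0 := by
  rcases a with a | a <;> simp [sJ]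

theorem sJ_ne_inr {n : ℕ} (a : Idx n) : sJ a ≠ Sum.inr 0 := by
  rcases a with a | a <;> simp [sJ]

/-- Extension of matrices by zero, `e_{a,b} ↦ e_{sJ a, sJ b}`: the identification of `gl(n|n)`
with `gl(J)`. -/
def extJ : Mat k n →ₗ[k] Mat k (n + 1) where
  toFun := fun A => ∑ a, ∑ b, Matrix.single (sJ a) (sJ b) (A a b)
  map_add' := fun A B => by simp [Matrix.single_add, Finset.sum_add_distrib]
  map_smul' := fun c A => by simp [Finset.smul_sum, Matrix.smul_single]

variable {k n}

theorem extJ_apply (A : Mat k n) (i j : Idx (n + 1)) :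
    extJ k n A i j = ∑ a, ∑ b, if sJ a = i ∧ sJ b = j then A a b else 0 := by
  simp [extJ, Matrix.sum_apply, Matrix.single_apply]

theorem extJ_sJ (A : Mat k n) (a b : Idx n) : extJ k n A (sJ a) (sJ b) = A a b := by
  rw [extJ_apply, Finset.sum_eq_single a, Finset.sum_eq_single b]
  · simp
  · intro c _ hc; rw [if_neg]; rintro ⟨-, h⟩; exact hc (sJ_inj h)
  · simp
  · intro c _ hc
    refine Finset.sum_eq_zero fun d _ => ?_
    rw [if_neg]; rintro ⟨h, -⟩; exact hc (sJ_inj h)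
  · simp

theorem extJ_left (A : Mat k n) {i : Idx (n + 1)} (hi : ∀ a, sJ a ≠ i) (j) :
    extJ k n A i j = 0 := by
  rw [extJ_apply]
  exact Finset.sum_eq_zero fun a _ => Finset.sum_eq_zero fun b _ => if_neg fun h => hi a h.1

theorem extJ_right (A : Mat k n) {j : Idx (n + 1)} (hj : ∀ a, sJ a ≠ j) (i) :
    extJ k n A i j = 0 := by
  rw [extJ_apply]
  exact Finset.sum_eq_zero fun a _ => Finset.sum_eq_zero fun b _ => if_neg fun h => hj b h.2

theorem extJ_gr {p : ZMod 2} {A : Mat k n} (hA : A ∈ glGr k n p) :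
    extJ k n A ∈ glGr k (n + 1) p := by
  intro i j h
  rw [extJ_apply]
  refine Finset.sum_eq_zero fun a _ => Finset.sum_eq_zero fun b _ => ?_
  split_ifs with h1
  · obtain ⟨rfl, rfl⟩ := h1
    refine hA a b fun h2 => h ?_
    change par (sJ a) + par (sJ b) = p
    rw [par_sJ, par_sJ]; exact h2
  · rfl

theorem extJ_mul (A B : Mat k n) : extJ k n (A * B) = extJ k n A * extJ k n B := by
  ext i j
  rw [Matrix.mul_apply]
  have key : ∑ l, extJ k n A i l * extJ k n B l j
      = ∑ c, extJ k n A i (sJ c) * extJ k n B (sJ c) j := by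
    rw [Fintype.sum_sum_type, Fin.sum_univ_succ, Fin.sum_univ_succ, Fintype.sum_sum_type,
      extJ_right A (fun a => sJ_ne_inl a), extJ_right A (fun a => sJ_ne_inr a)]
    simp [sJ]
  rw [key]
  by_cases hi : ∃ a, sJ a = i
  · obtain ⟨a, rfl⟩ := hi
    by_cases hj : ∃ b, sJ b = j
    · obtain ⟨b, rfl⟩ := hj
      simp only [extJ_sJ, Matrix.mul_apply]
    · have hj' := not_exists.mp hj
      rw [extJ_right _ hj']
      exact (Finset.sum_eq_zero fun c _ => by rw [extJ_right B hj', mul_zero]).symm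
  · have hi' := not_exists.mp hi
    rw [extJ_left _ hi']
    exact (Finset.sum_eq_zero fun c _ => by rw [extJ_left A hi', zero_mul]).symm

/-- The entries of `[e_{1,n+1}, B]`. -/
theorem xRoot_br (B : Mat k (n + 1)) (i j : Idx (n + 1)) :
    superBr (xRoot k n) B i j =
      (if i = Sum.inl 0 then B (Sum.inr 0) j else 0) -
        sgn 1 (par i) • (if j = Sum.inr 0 then B i (Sum.inl 0) else 0) := by
  have hL : ∀ C : Mat k (n + 1), (xRoot k n * C) i j =
      if i = Sum.inl 0 then C (Sum.inr 0) j else 0 := by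
    intro C
    split_ifs with h
    · subst h; simp [xRoot]
    · simp [xRoot, h]
  have hR : ∀ C : Mat k (n + 1), (C * xRoot k n) i j =
      if j = Sum.inr 0 then C i (Sum.inl 0) else 0 := by
    intro C
    split_ifs with h
    · subst h; simp [xRoot]
    · simp [xRoot, h]
  have e : superBr (xRoot k n) B =
      xRoot k n * B - comp 0 B * xRoot k n
        + comp 1 B * xRoot k n := by
    conv_lhs => rw [comp_add_comp B]
    rw [map_add, superBr_homog (xRoot_odd k n) (comp_mem 0 B),
      superBr_homog (xRoot_odd k n) (comp_mem 1 B)]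
    conv_rhs => rw [comp_add_comp B]
    simp only [map_add, comp_of_mem (comp_mem 0 B), comp_of_mem (comp_mem 1 B)]
    simp [mul_add]
    abel
  rw [e, Matrix.add_apply, Matrix.sub_apply, hL, hR, hR, comp_apply, comp_apply]
  have hp : par (Sum.inl 0 : Idx (n + 1)) = 0 := rfl
  rw [hp, add_zero]
  rcases zmod2_cases (par i) with h | h <;> rw [h] <;> split_ifs <;> simp_all

theorem extJ_mem_ker (A : Mat k n) :
    extJ k n A ∈ LinearMap.ker ((gl k (n + 1)).br (xRoot k n)) := by
  change superBr (xRoot k n) (extJ k n A) = 0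
  refine Matrix.ext fun i j => ?_
  rw [xRoot_br]
  rw [extJ_left A (fun a => sJ_ne_inr a), extJ_right A (fun a => sJ_ne_inl a)]
  simp

variable (k n)

/-- The homomorphism `gl(n|n) = gl(J) → DS_x gl(n+1|n+1)`, `A ↦ [A]`, for `x = e_{1,n+1}`.
It is an isomorphism, see `glJ_bijective`. -/
def glJ : LieSuperalg.Hom (gl k n) (DSAlg (gl k (n + 1)) (xRoot_mem k n)) :=
  LieSuperalg.Hom.ofHomog
    (((LinearMap.range ((gl k (n + 1)).br (xRoot k n))).comap
      (LinearMap.ker ((gl k (n + 1)).br (xRoot k n))).subtype).mkQ ∘ₗ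
        (extJ k n).codRestrict (LinearMap.ker ((gl k (n + 1)).br (xRoot k n))) extJ_mem_ker)
    (fun {p A} hA => ⟨⟨extJ k n A, extJ_mem_ker A⟩, extJ_gr hA, rfl⟩)
    (by
      intro p q (A : Mat k n) (B : Mat k n) hA hB
      have key : extJ k n (superBr A B) = superBr (extJ k n A) (extJ k n B) := by
        rw [superBr_homog hA hB, superBr_homog (extJ_gr hA) (extJ_gr hB), map_sub, map_zsmul,
          extJ_mul, extJ_mul]
      have key' : (⟨_, extJ_mem_ker (superBr A B)⟩ :
          LinearMap.ker ((gl k (n + 1)).br (xRoot k n))) =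
          ⟨superBr (extJ k n A) (extJ k n B), key ▸ extJ_mem_ker (superBr A B)⟩ :=
        Subtype.ext key
      exact congrArg (Submodule.Quotient.mk
        (p := (LinearMap.range ((gl k (n + 1)).br (xRoot k n))).comap
          (LinearMap.ker ((gl k (n + 1)).br (xRoot k n))).subtype)) key')

theorem glJ_bijective : Function.Bijective (glJ k n).toLin := by
  constructor
  · rw [← LinearMap.ker_eq_bot, LinearMap.ker_eq_bot']
    intro (A : Mat k n) hA
    obtain ⟨(B : Mat k (n + 1)), hB⟩ := (Submodule.Quotient.mk_eq_zero _).mp hA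
    change superBr (xRoot k n) B = extJ k n A at hB
    refine Matrix.ext fun a b => ?_
    have := congrFun (congrFun hB (sJ a)) (sJ b)
    rw [xRoot_br, extJ_sJ, if_neg (sJ_ne_inl a), if_neg (sJ_ne_inr b)] at this
    rw [Matrix.zero_apply]
    simpa using this.symm
  · intro c
    obtain ⟨⟨(C : Mat k (n + 1)), hC⟩, rfl⟩ := Submodule.Quotient.mk_surjective _ c
    have hC0 : ∀ i j, superBr (xRoot k n) C i j = 0 := fun i j => congrFun (congrFun hC i) j
    refine ⟨(Matrix.of fun a b => C (sJ a) (sJ b) : Mat k n), ?_⟩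
    refine (Submodule.Quotient.eq _).mpr ?_
    let B : Mat k (n + 1) := Matrix.of fun i j =>
      if i = Sum.inr 0 then C (Sum.inl 0) j
      else if j = Sum.inl 0 ∧ i ≠ Sum.inl 0 then -(sgn 1 (par i) • C i (Sum.inr 0)) else 0
    refine ⟨-B, ?_⟩
    change superBr (xRoot k n) (-B) = extJ k n (Matrix.of fun a b => C (sJ a) (sJ b)) - C
    rw [map_neg]
    refine Matrix.ext fun i j => ?_
    have hB : ∀ i j, B i j = if i = Sum.inr 0 then C (Sum.inl 0) j
      else if j = Sum.inl 0 ∧ i ≠ Sum.inl 0 then -(sgn 1 (par i) • C i (Sum.inr 0)) else 0 :=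
      fun _ _ => rfl
    have h11 := hC0 (Sum.inl 0) (Sum.inr 0)
    have hrow : ∀ j, j ≠ Sum.inr 0 → C (Sum.inr 0) j = 0 := fun j hj => by
      simpa [xRoot_br, hj] using hC0 (Sum.inl 0) j
    have hcol : ∀ i, i ≠ Sum.inl 0 → C i (Sum.inl 0) = 0 := fun i hi => by
      have := hC0 i (Sum.inr 0)
      rcases zmod2_cases (par i) with h | h <;> simpa [xRoot_br, hi, h] using this
    have hp0 : par (Sum.inl 0 : Idx (n + 1)) = 0 := rfl
    have hp1 : par (Sum.inr 0 : Idx (n + 1)) = 1 := rfl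
    rw [xRoot_br] at h11
    simp only [hp0, if_true, sgn_zero_right, one_smul] at h11
    rw [Matrix.neg_apply, Matrix.sub_apply, xRoot_br]
    rcases idx_cases i with rfl | rfl | ⟨a, rfl⟩ <;>
      rcases idx_cases j with rfl | rfl | ⟨b, rfl⟩
    · simp [hB, extJ_left _ (fun a => sJ_ne_inl a)]
    · simp [hB, hp0, extJ_left _ (fun a => sJ_ne_inl a)]
    · simp [hB, sJ_ne_inr, extJ_left _ (fun a => sJ_ne_inl a)]
    · simp [extJ_left _ (fun a => sJ_ne_inr a), hrow]
    · simp [hB, hp1, extJ_left _ (fun a => sJ_ne_inr a)]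
      rw [sub_eq_zero] at h11
      exact h11.symm
    · simp [sJ_ne_inr, extJ_left _ (fun a => sJ_ne_inr a), hrow]
    · simp [sJ_ne_inl, extJ_right _ (fun a => sJ_ne_inl a), hcol]
    · rcases zmod2_cases (par (sJ a)) with h | h <;>
        simp [hB, h, sJ_ne_inl, sJ_ne_inr, extJ_right _ (fun a => sJ_ne_inr a)]
    · simp [sJ_ne_inl, sJ_ne_inr, extJ_sJ]

variable {k n}

/-- `DS_{ε_1 - δ_1} M` as a `gl(n|n)`-supermodule, via `gl(n|n) ≅ DS_x gl(n+1|n+1)`. -/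
def DSgl (M : SuperMod (gl k (n + 1))) : SuperMod (gl k n) :=
  (DS M (xRoot_mem k n)).pullback (glJ k n)

end DSgl

end GLSuper

end

/-! Put I = {1, n+1}, y = e_{n+1,1} and C = [x, y] = e_{1,1} + e_{n+1,n+1}. A weight aε + bδ of
gl(1|1) is atypical exactly when a + b = 0, so maximal atypicality means a_i + b_i = 0 for every i.
Then λ is a multiple of the supertrace on each summand of l, hence a character of l, and L^o(λ) is
one-dimensional. Conversely, odd elements act by zero on a one-dimensional supermodule, so
[e_{i,n+i}, e_{n+i,i}], which acts on the highest weight vector by a_i + b_i, must vanish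
(`mem_LambdaMaBG_iff_finrank`).

For such λ the module BG(λ) is generated by a vector v on which the matrix units of p act through
the weight, and it is universal with this property (`exists_bg_lift`). The same vector generates,
over gl(J), the image of a map ψ from BG(pr_J λ). The units of gl(I) supercommute with gl(J), so
they act on im ψ as they do on v; in particular x and C vanish there. The units e_{i,j} with i in I
and j in J kill im ψ. The units with i in J and j in I produce the rest of BG(λ), and each lowers
the eigenvalue of C by one. In characteristic 0 this gives BG(λ) = im ψ ⊕ V', where C is zero on im
ψ and invertible on V' (`range_sup_coprimePart`). Since C = xy + yx commutes with x, the operator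
yC⁻¹ contracts the complex (V', x). Hence DS_x BG(λ) is im ψ (`dsMap_bijective`), and the parity
shift comes from par(λ) = par(pr_J λ) + par(pr_I λ).

What remains is the injectivity of ψ, a statement of PBW type. It is proved by a model
(`exists_embedding`). If matrix units indexed by K act on N, then superpolynomials in variables
indexed by K with coefficients in N carry an action of matrix units with one more index
(`IsWeylGl.isGlFamily_ext`). Two such steps, starting from N = BG(pr_J λ), add the indices n+1 and
1. The vacuum vector over the generator of N satisfies the relations of v; the relation for
e_{n+1,1} is where a_1 + b_1 = 0 enters. The resulting map Ψ out of BG(λ) satisfies Ψ ∘ ψ =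
inclusion of the vacuum vectors, which is injective. -/

noncomputable section

namespace GLSuper

/-! ## Commutation relations with signs -/

section Sign

theorem sgn_add_left (p q r : ZMod 2) : sgn (p + q) r = sgn p r * sgn q r := by
  revert p q r; decide

theorem sgn_add_right (p q r : ZMod 2) : sgn p (q + r) = sgn p q * sgn p r := by
  revert p q r; decide

theorem sgn_comm (p q : ZMod 2) : sgn p q = sgn q p := by
  revert p q; decide

theorem sgn_mul_self (p q : ZMod 2) : sgn p q * sgn p q = 1 := by
  revert p q; decide

end Sign

section SuperComm

variable {A : Type*} [Ring A]

/-- The commutation relation `a b = c + s b a`. -/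
def SuperComm (s : ℤ) (a b c : A) : Prop := a * b = c + s • (b * a)

theorem SuperComm.of_eq {s s' : ℤ} {a b c c' : A} (h : SuperComm s a b c) (hs : s = s')
    (hc : c = c') : SuperComm s' a b c' := hs ▸ hc ▸ h

theorem SuperComm.add_right {s : ℤ} {a b b' c c' : A} (h : SuperComm s a b c)
    (h' : SuperComm s a b' c') : SuperComm s a (b + b') (c + c') := by
  unfold SuperComm at *
  rw [mul_add, h, h', add_mul, smul_add]; abel

theorem SuperComm.add_left {s : ℤ} {a a' b c c' : A} (h : SuperComm s a b c)
    (h' : SuperComm s a' b c') : SuperComm s (a + a') b (c + c') := by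
  unfold SuperComm at *
  rw [add_mul, h, h', mul_add, smul_add]; abel

theorem SuperComm.neg_right {s : ℤ} {a b c : A} (h : SuperComm s a b c) :
    SuperComm s a (-b) (-c) := by
  unfold SuperComm at *
  rw [mul_neg, h, neg_mul, smul_neg]; abel

theorem SuperComm.neg_left {s : ℤ} {a b c : A} (h : SuperComm s a b c) :
    SuperComm s (-a) b (-c) := by
  unfold SuperComm at *
  rw [neg_mul, h, mul_neg, smul_neg]; abel

theorem SuperComm.sub_right {s : ℤ} {a b b' c c' : A} (h : SuperComm s a b c)
    (h' : SuperComm s a b' c') : SuperComm s a (b - b') (c - c') := by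
  rw [sub_eq_add_neg, sub_eq_add_neg]; exact h.add_right h'.neg_right

theorem SuperComm.sub_left {s : ℤ} {a a' b c c' : A} (h : SuperComm s a b c)
    (h' : SuperComm s a' b c') : SuperComm s (a - a') b (c - c') := by
  rw [sub_eq_add_neg, sub_eq_add_neg]; exact h.add_left h'.neg_left

theorem SuperComm.smul_right {s : ℤ} {a b c : A} (t : ℤ) (h : SuperComm s a b c) :
    SuperComm s a (t • b) (t • c) := by
  unfold SuperComm at *
  rw [mul_smul_comm, h, smul_mul_assoc, smul_add, smul_comm s t]

theorem SuperComm.smul_left {s : ℤ} {a b c : A} (t : ℤ) (h : SuperComm s a b c) :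
    SuperComm s (t • a) b (t • c) := by
  unfold SuperComm at *
  rw [smul_mul_assoc, h, mul_smul_comm, smul_add, smul_comm s t]

theorem SuperComm.sum_right {K : Type*} (S : Finset K) {s : ℤ} {a : A} {b c : K → A}
    (h : ∀ i ∈ S, SuperComm s a (b i) (c i)) : SuperComm s a (∑ i ∈ S, b i) (∑ i ∈ S, c i) := by
  unfold SuperComm at *
  rw [Finset.mul_sum, Finset.sum_congr rfl h, Finset.sum_mul, Finset.smul_sum,
    Finset.sum_add_distrib]

theorem SuperComm.sum_left {K : Type*} (S : Finset K) {s : ℤ} {b : A} {a c : K → A}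
    (h : ∀ i ∈ S, SuperComm s (a i) b (c i)) : SuperComm s (∑ i ∈ S, a i) b (∑ i ∈ S, c i) := by
  unfold SuperComm at *
  rw [Finset.sum_mul, Finset.sum_congr rfl h, Finset.mul_sum, Finset.smul_sum,
    Finset.sum_add_distrib]

/-- The supercommutator with a fixed element is a twisted derivation. Together with `mul_left`, this
rule reduces the commutators of the composite operators below to those of their factors. -/
theorem SuperComm.mul_right {s t : ℤ} {a b b' c c' : A} (h : SuperComm s a b c)
    (h' : SuperComm t a b' c') : SuperComm (s * t) a (b * b') (c * b' + s • (b * c')) := by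
  unfold SuperComm at *
  rw [← mul_assoc, h, add_mul, smul_mul_assoc, mul_assoc b a b', h', mul_add, smul_add,
    mul_smul_comm, smul_smul, mul_assoc, add_assoc]

theorem SuperComm.mul_left {s t : ℤ} {a a' b c c' : A} (h : SuperComm s a b c)
    (h' : SuperComm t a' b c') : SuperComm (s * t) (a * a') b (a * c' + t • (c * a')) := by
  unfold SuperComm at *
  rw [mul_assoc, h', mul_add, mul_smul_comm, ← mul_assoc, h, add_mul, smul_add, smul_mul_assoc,
    smul_smul, mul_comm t s, mul_assoc b, add_assoc]

theorem SuperComm.symm {s : ℤ} {a b c : A} (h : SuperComm s a b c) (hs : s * s = 1) :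
    SuperComm s b a (-(s • c)) := by
  unfold SuperComm at *
  rw [h, smul_add, smul_smul, hs, one_smul]; abel

theorem _root_.Commute.superComm {a b : A} (h : Commute a b) : SuperComm 1 a b 0 := by
  simpa [SuperComm] using h.eq

theorem superComm_one_self (a : A) : SuperComm 1 a a 0 := by simp [SuperComm]

end SuperComm

/-! ## Families of matrix units -/

/-- A family of elements satisfying the commutation relations of the matrix units of a general
linear Lie superalgebra with index set `K` and parities `p`. -/
def IsGlFamily {K : Type*} [DecidableEq K] {A : Type*} [Ring A] (p : K → ZMod 2)
    (ρ : K → K → A) : Prop :=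
  ∀ i j a b, SuperComm (sgn (p i + p j) (p a + p b)) (ρ i j) (ρ a b)
    ((if j = a then ρ i b else 0) - sgn (p i + p j) (p a + p b) • (if b = i then ρ a j else 0))

/-- The relations involve only the sums p i + p j, which a common shift leaves unchanged. This lets
a construction that adds an even index also serve for an odd one. -/
theorem IsGlFamily.shift {K : Type*} [DecidableEq K] {A : Type*} [Ring A] {p : K → ZMod 2}
    {ρ : K → K → A} (h : IsGlFamily p ρ) {q : K → ZMod 2} (hq : ∀ i, q i = p i + 1) :
    IsGlFamily q ρ := by
  intro i j a b
  have e : ∀ i j, q i + q j = p i + p j := fun i j => by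
    rw [hq, hq]; generalize p i = x; generalize p j = y; revert x y; decide
  rw [e, e]; exact h i j a b

/-- Canonical (anti)commutation relations between `x`, `d`, together with a family of matrix
units `ρ` supercommuting with them. -/
structure IsWeylGl {K : Type*} [DecidableEq K] {A : Type*} [Ring A] (p : K → ZMod 2)
    (x d : K → A) (ρ : K → K → A) : Prop where
  xx : ∀ i j, SuperComm (sgn (p i) (p j)) (x i) (x j) 0
  dd : ∀ i j, SuperComm (sgn (p i) (p j)) (d i) (d j) 0
  dx : ∀ i j, SuperComm (sgn (p i) (p j)) (d i) (x j) (if i = j then 1 else 0)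
  ρx : ∀ i j a, SuperComm (sgn (p i + p j) (p a)) (ρ i j) (x a) 0
  ρd : ∀ i j a, SuperComm (sgn (p i + p j) (p a)) (ρ i j) (d a) 0
  ρρ : IsGlFamily p ρ

namespace IsWeylGl

variable {K : Type*} [DecidableEq K] {A : Type*} [Ring A] {p : K → ZMod 2}
  {x d : K → A} {ρ : K → K → A}

section

variable (h : IsWeylGl p x d ρ)
include h

theorem xρ (i j a) : SuperComm (sgn (p a) (p i + p j)) (x a) (ρ i j) 0 :=
  ((h.ρx i j a).symm (sgn_mul_self _ _)).of_eq (sgn_comm _ _) (by simp)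

theorem dρ (i j a) : SuperComm (sgn (p a) (p i + p j)) (d a) (ρ i j) 0 :=
  ((h.ρd i j a).symm (sgn_mul_self _ _)).of_eq (sgn_comm _ _) (by simp)

theorem xd (i j) : SuperComm (sgn (p i) (p j)) (x i) (d j)
    (-(sgn (p i) (p j) • if j = i then 1 else 0)) :=
  ((h.dx j i).symm (sgn_mul_self _ _)).of_eq (sgn_comm _ _) (by rw [sgn_comm])

end

/-- The operators `x_i d_j + ρ_{i,j}`. -/
def E (x d : K → A) (ρ : K → K → A) (i j : K) : A := x i * d j + ρ i j

section

variable (h : IsWeylGl p x d ρ)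
include h

/-- Only the factor d_j contributes, because x_i and ρ supercommute with x_a. Thus the x's span the
natural representation for the E's; in `E_d` the d's span its dual. -/
theorem E_x (i j a) : SuperComm (sgn (p i + p j) (p a)) (E x d ρ i j) (x a)
    (if j = a then x i else 0) := by
  refine (((h.xx i a).mul_left (h.dx j a)).of_eq (sgn_add_left _ _ _).symm ?_).add_left
    (h.ρx i j a) |>.of_eq rfl (add_zero _)
  split_ifs <;> simp

theorem E_d (i j a) : SuperComm (sgn (p i + p j) (p a)) (E x d ρ i j) (d a)
    (-(sgn (p i + p j) (p a) • if a = i then d j else 0)) := by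
  refine (((h.xd i a).mul_left (h.dd j a)).of_eq (sgn_add_left _ _ _).symm ?_).add_left
    (h.ρd i j a) |>.of_eq rfl (add_zero _)
  split_ifs <;> simp only [sgn_add_left, smul_mul_assoc, neg_mul, smul_neg, smul_smul, one_mul,
    zero_mul, mul_zero, smul_zero, neg_zero, zero_add, mul_comm (sgn (p j) (p a))]

theorem E_ρ (i j a b) : SuperComm (sgn (p i + p j) (p a + p b)) (E x d ρ i j) (ρ a b)
    ((if j = a then ρ i b else 0) - sgn (p i + p j) (p a + p b) • (if b = i then ρ a j else 0)) :=
  (((h.xρ a b i).mul_left (h.dρ a b j)).of_eq (sgn_add_left _ _ _).symm (by simp)).add_left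
    (h.ρρ i j a b) |>.of_eq rfl (zero_add _)

/-- The E's are the tensor product action: linear vector fields on the variables plus ρ on the
coefficients. The derivation rule applied to x_a d_b + ρ_{a,b} gives the relation from `E_x`, `E_d`
and `E_ρ`. -/
theorem E_E : IsGlFamily p (E x d ρ) := by
  intro i j a b
  refine (((h.E_x i j a).mul_right (h.E_d i j b)).of_eq (sgn_add_right _ _ _).symm rfl).add_right
    (h.E_ρ i j a b) |>.of_eq rfl ?_
  rw [sgn_add_right]
  simp only [E]
  split_ifs <;> simp [-zsmul_eq_mul, smul_smul, smul_add] <;> abel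

end

variable [Fintype K]

/-- The Euler operator `∑ x_k d_k`. -/
def euler (x d : K → A) : A := ∑ a, x a * d a

section

variable (h : IsWeylGl p x d ρ)
include h

/-- The Euler operator is the contraction of the natural representation with its dual, hence
invariant. It measures the degree in the variables, which d lowers and x raises by one. -/
theorem E_euler (i j) : SuperComm 1 (E x d ρ i j) (euler x d) 0 := by
  refine (SuperComm.sum_right Finset.univ fun a _ =>
    ((h.E_x i j a).mul_right (h.E_d i j a)).of_eq (sgn_mul_self _ _) rfl).of_eq rfl ?_
  simp [-zsmul_eq_mul, Finset.sum_add_distrib, smul_smul, sgn_mul_self]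

theorem d_euler (i) : SuperComm 1 (d i) (euler x d) (d i) := by
  refine (SuperComm.sum_right Finset.univ fun a _ =>
    ((h.dx i a).mul_right (h.dd i a)).of_eq (sgn_mul_self _ _) rfl).of_eq rfl ?_
  simp

theorem euler_x (i) : SuperComm 1 (euler x d) (x i) (x i) := by
  refine (SuperComm.sum_left Finset.univ fun a _ =>
    ((h.xx a i).mul_left (h.dx a i)).of_eq (sgn_mul_self _ _) rfl).of_eq rfl ?_
  simp

theorem euler_ρ (i j) : SuperComm 1 (euler x d) (ρ i j) 0 := by
  refine (SuperComm.sum_left Finset.univ fun a _ =>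
    ((h.xρ i j a).mul_left (h.dρ i j a)).of_eq (sgn_mul_self _ _) rfl).of_eq rfl ?_
  simp

end

/-- The sums `∑ ± x_k ρ_{i,k}`. -/
def R (p : K → ZMod 2) (x : K → A) (ρ : K → K → A) (i : K) : A :=
  ∑ a, sgn (p i) (p a) • (x a * ρ i a)

section

variable (h : IsWeylGl p x d ρ)
include h

/-- In R_m the second index of ρ is contracted with x, so only m is free and R_m transforms like
x_m. The sign in `R` is the one for which the two terms x_i ρ_{m,j}, from the variable and from ρ,
cancel. -/
theorem E_R (i j m) : SuperComm (sgn (p i + p j) (p m)) (E x d ρ i j) (R p x ρ m)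
    (if j = m then R p x ρ i else 0) := by
  refine (SuperComm.sum_right Finset.univ fun a _ => SuperComm.smul_right _
    (((h.E_x i j a).mul_right (h.E_ρ i j m a)).of_eq
      (s' := sgn (p i + p j) (p m)) ?_ rfl)).of_eq rfl ?_
  · rw [sgn_add_right, mul_left_comm, sgn_mul_self, mul_one]
  · simp only [ite_mul, zero_mul, mul_sub, mul_ite, mul_zero, smul_sub, smul_add, smul_ite,
      smul_zero, mul_smul_comm, Finset.sum_add_distrib, Finset.sum_sub_distrib,
      Finset.sum_ite_eq, Finset.sum_ite_eq', Finset.mem_univ, if_true, smul_smul]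
    have e1 : sgn (p m) (p i) * (sgn (p i + p j) (p i) * sgn (p i + p j) (p m + p i))
        = sgn (p m) (p j) := by
      generalize p m = a; generalize p i = b; generalize p j = c; revert a b c; decide
    rw [e1]
    split_ifs with hj
    · subst hj
      rw [add_sub_cancel]
      refine Finset.sum_congr rfl fun a _ => ?_
      congr 1
      generalize p a = c; generalize p i = b; generalize p j = a; revert a b c; decide
    · simp

theorem d_R (i m) : SuperComm (sgn (p i) (p m)) (d i) (R p x ρ m)
    (sgn (p i) (p m) • ρ m i) := by
  refine (SuperComm.sum_right Finset.univ fun a _ => SuperComm.smul_right _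
    (((h.dx i a).mul_right (h.dρ m a i)).of_eq
      (s' := sgn (p i) (p m)) ?_ rfl)).of_eq rfl ?_
  · rw [sgn_add_right, mul_left_comm, sgn_mul_self, mul_one]
  · simp [sgn_comm]

theorem euler_R (m) : SuperComm 1 (euler x d) (R p x ρ m) (R p x ρ m) := by
  refine (SuperComm.sum_right Finset.univ fun a _ => SuperComm.smul_right _
    ((h.euler_x a).mul_right (h.euler_ρ m a))).of_eq rfl ?_
  simp [R]

theorem R_x (i j) : SuperComm (sgn (p i) (p j)) (R p x ρ i) (x j) 0 := by
  refine (SuperComm.sum_left Finset.univ fun a _ => SuperComm.smul_left _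
    (((h.xx a j).mul_left (h.ρx i a j)).of_eq
      (s' := sgn (p i) (p j)) ?_ rfl)).of_eq rfl ?_
  · rw [sgn_add_left, mul_left_comm, sgn_mul_self, mul_one]
  · simp

theorem R_ρ (i a b) : SuperComm (sgn (p i) (p a + p b)) (R p x ρ i) (ρ a b)
    (sgn (p i) (p a) • (x a * ρ i b) -
      if b = i then (sgn (p i) (p a) * sgn (p i) (p i)) • R p x ρ a else 0) := by
  refine (SuperComm.sum_left Finset.univ fun l _ => SuperComm.smul_left _
    (((h.xρ a b l).mul_left (h.ρρ i l a b)).of_eq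
      (s' := sgn (p i) (p a + p b)) ?_ rfl)).of_eq rfl ?_
  · rw [sgn_add_left, mul_left_comm, sgn_mul_self, mul_one]
  · simp only [zero_mul, mul_sub, mul_ite, mul_zero, smul_sub, smul_ite, smul_zero, mul_smul_comm,
      Finset.sum_sub_distrib, Finset.sum_ite_eq', Finset.mem_univ, if_true, smul_smul, add_zero]
    congr 1
    split_ifs with hb
    · subst hb
      rw [R, Finset.smul_sum]
      refine Finset.sum_congr rfl fun l _ => ?_
      rw [smul_smul]
      congr 1
      generalize p a = c; generalize p b = b; generalize p l = a; revert a b c; decide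
    · simp

end

/-- The operators `x_i (c - ∑ x_k d_k) - ∑ ± x_k ρ_{i,k}`. -/
def Y (p : K → ZMod 2) (x d : K → A) (ρ : K → K → A) (c : A) (i : K) : A :=
  x i * (c - euler x d) - R p x ρ i

section

variable (h : IsWeylGl p x d ρ) {c : A} (hc : ∀ a, Commute c a)
include h hc

theorem E_Z (i j) : SuperComm 1 (E x d ρ i j) (c - euler x d) 0 :=
  (((hc (E x d ρ i j)).superComm.symm rfl).sub_right (h.E_euler i j)).of_eq rfl (by simp)

theorem d_Z (i) : SuperComm 1 (d i) (c - euler x d) (-d i) :=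
  (((hc (d i)).superComm.symm rfl).sub_right (h.d_euler i)).of_eq rfl (by simp)

theorem Z_x (i) : SuperComm 1 (c - euler x d) (x i) (-x i) :=
  ((hc (x i)).superComm.sub_left (h.euler_x i)).of_eq rfl (by simp)

theorem Z_ρ (i j) : SuperComm 1 (c - euler x d) (ρ i j) 0 :=
  ((hc (ρ i j)).superComm.sub_left (h.euler_ρ i j)).of_eq rfl (by simp)

theorem Z_R (i) : SuperComm 1 (c - euler x d) (R p x ρ i) (-R p x ρ i) :=
  ((hc (R p x ρ i)).superComm.sub_left (h.euler_R i)).of_eq rfl (by simp)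

theorem E_Y (i j m) : SuperComm (sgn (p i + p j) (p m)) (E x d ρ i j) (Y p x d ρ c m)
    (if j = m then Y p x d ρ c i else 0) := by
  refine ((((h.E_x i j m).mul_right (h.E_Z hc i j)).of_eq (mul_one _) rfl).sub_right
    (h.E_R i j m)).of_eq rfl ?_
  simp only [Y]
  split_ifs <;> simp

/-- This relation dictates the shape of Y: commuting d_i past the Euler operator produces x_m d_i,
commuting it past R_m produces ρ_{m,i}, and together they form E_{m,i}. -/
theorem d_Y (i m) : SuperComm (sgn (p i) (p m)) (d i) (Y p x d ρ c m)
    ((if i = m then c - euler x d else 0) - sgn (p i) (p m) • E x d ρ m i) := by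
  refine ((((h.dx i m).mul_right (h.d_Z hc i)).of_eq (mul_one _) rfl).sub_right
    (h.d_R i m)).of_eq rfl ?_
  simp only [E]
  split_ifs <;> simp [-zsmul_eq_mul, smul_add] <;> abel

theorem Z_Y (i) : SuperComm 1 (c - euler x d) (Y p x d ρ c i) (-Y p x d ρ c i) := by
  refine ((((h.Z_x hc i).mul_right (superComm_one_self _)).of_eq (mul_one _) rfl).sub_right
    (h.Z_R hc i)).of_eq rfl ?_
  simp [Y]; abel

theorem Y_x (i j) : SuperComm (sgn (p i) (p j)) (Y p x d ρ c i) (x j) (-(x i * x j)) := by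
  refine ((((h.xx i j).mul_left (h.Z_x hc j)).of_eq (mul_one _) rfl).sub_left
    (h.R_x i j)).of_eq rfl ?_
  simp

theorem Y_ρ (i a b) : SuperComm (sgn (p i) (p a + p b)) (Y p x d ρ c i) (ρ a b)
    (-(sgn (p i) (p a) • (x a * ρ i b) -
      if b = i then (sgn (p i) (p a) * sgn (p i) (p i)) • R p x ρ a else 0)) := by
  refine ((((h.xρ a b i).mul_left (h.Z_ρ hc a b)).of_eq (mul_one _) rfl).sub_left
    (h.R_ρ i a b)).of_eq rfl ?_
  simp

/-- The terms of `Y_x` and `Y_ρ` that do not contain x_j sum to -x_i R_j + x_i R_j = 0. What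
survives is rewritten by moving x_j to the left past x_a. -/
theorem Y_R (i j) : SuperComm (sgn (p i) (p j)) (Y p x d ρ c i) (R p x ρ j)
    (-(sgn (p i) (p j) • (x j * R p x ρ i))) := by
  refine (SuperComm.sum_right Finset.univ fun a _ => SuperComm.smul_right _
    (((h.Y_x hc i a).mul_right (h.Y_ρ hc i j a)).of_eq
      (s' := sgn (p i) (p j)) ?_ rfl)).of_eq rfl ?_
  · rw [sgn_add_right, mul_left_comm, sgn_mul_self, mul_one]
  · simp only [smul_add, mul_neg, mul_sub, smul_neg, smul_sub, mul_ite, mul_zero, smul_ite,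
      smul_zero, mul_smul_comm, smul_smul, Finset.sum_add_distrib, Finset.sum_neg_distrib,
      Finset.sum_sub_distrib, Finset.sum_ite_eq', Finset.mem_univ, if_true, neg_mul]
    have e1 : sgn (p j) (p i) * (sgn (p i) (p i) * (sgn (p i) (p j) * sgn (p i) (p i))) = 1 := by
      generalize p j = a; generalize p i = b; revert a b; decide
    have e2 : ∑ a, sgn (p j) (p a) • (x i * x a * ρ j a) = x i * R p x ρ j := by
      simp [-zsmul_eq_mul, R, Finset.mul_sum, mul_assoc]
    have e3 : ∑ a, (sgn (p j) (p a) * (sgn (p i) (p a) * sgn (p i) (p j))) • (x a * (x j * ρ i a))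
        = sgn (p i) (p j) • (x j * R p x ρ i) := by
      rw [R, Finset.mul_sum, Finset.smul_sum]
      refine Finset.sum_congr rfl fun a _ => ?_
      have := h.xx a j
      rw [SuperComm, zero_add] at this
      rw [← mul_assoc (x a), this, mul_smul_comm, smul_mul_assoc, smul_smul, smul_smul,
        mul_assoc (x j)]
      congr 1
      generalize p a = a; generalize p j = b; generalize p i = c; revert a b c; decide
    rw [e1, e2, e3, one_smul]
    abel

/-- With Z = c - `euler`, the contributions are -x_i x_j Z, ±x_j Y_i and ±x_j R_i. Substituting Y_i
= x_i Z - R_i and x_i x_j = ±x_j x_i makes them cancel. -/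
theorem Y_Y (i j) : SuperComm (sgn (p i) (p j)) (Y p x d ρ c i) (Y p x d ρ c j) 0 := by
  refine ((((h.Y_x hc i j).mul_right ((h.Z_Y hc i).symm rfl)).of_eq (mul_one _) rfl).sub_right
    (h.Y_R hc i j)).of_eq rfl ?_
  have := h.xx i j
  rw [SuperComm, zero_add] at this
  rw [this, Y]
  simp only [mul_sub, smul_sub, mul_assoc, one_smul, neg_neg, neg_mul, smul_mul_assoc]
  abel

end

/-- The extension of the family `x_i d_j + ρ_{i,j}` by one more (even) index. -/
def ext (p : K → ZMod 2) (x d : K → A) (ρ : K → K → A) (c : A) : Option K → Option K → A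
  | some i, some j => E x d ρ i j
  | none, some j => d j
  | some i, none => Y p x d ρ c i
  | none, none => c - euler x d

/-- This is the super version of the projective action on an affine chart, twisted by c and ρ: units
out of the new index act by constant vector fields, units into it by the quadratic expressions Y.
The sixteen cases record which of the four indices are new; several are swapped forms of the
relations above, obtained through `SuperComm.symm`. -/
theorem isGlFamily_ext (h : IsWeylGl p x d ρ) {c : A} (hc : ∀ a, Commute c a) :
    IsGlFamily (fun i : Option K => i.elim 0 p) (ext p x d ρ c) := by
  rintro (_ | i) (_ | j) (_ | a) (_ | b) <;>
    simp only [Option.elim_none, Option.elim_some, add_zero, zero_add, sgn_zero_left,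
      sgn_zero_right, ext, if_true, reduceCtorEq, if_false, Option.some_inj, smul_zero, sub_zero,
      one_smul, zero_sub]
  · simpa using superComm_one_self _
  · exact ((h.d_Z hc b).symm rfl).of_eq rfl (by simp)
  · exact h.Z_Y hc a
  · exact ((h.E_Z hc a b).symm rfl).of_eq rfl (by simp)
  · exact h.d_Z hc j
  · exact (h.dd j b).of_eq rfl (by simp)
  · exact h.d_Y hc j a
  · refine ((h.E_d a b j).symm (sgn_mul_self _ _)).of_eq (sgn_comm _ _) ?_
    simp only [smul_neg, neg_neg, smul_smul, sgn_mul_self, one_smul]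
  · refine ((h.Z_Y hc i).symm rfl).of_eq rfl (by simp)
  · refine ((h.d_Y hc b i).symm (sgn_mul_self _ _)).of_eq (sgn_comm _ _) ?_
    rw [smul_sub, smul_smul, sgn_mul_self, one_smul, sgn_comm (p i)]
    abel
  · exact (h.Y_Y hc i a).of_eq rfl (by simp)
  · refine ((h.E_Y hc a b i).symm (sgn_mul_self _ _)).of_eq (sgn_comm _ _) ?_
    rw [sgn_comm]
  · exact (h.E_Z hc i j).of_eq rfl (by simp)
  · exact (h.E_d i j b)
  · exact (h.E_Y hc i j a)
  · exact h.E_E i j a b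

end IsWeylGl

/-! ## Realization of the commutation relations -/

namespace Fock

section Abstract

variable {K : Type} [DecidableEq K] {k : Type u} [Field k]

variable (k) in
/-- The exterior algebra with generators indexed by `K`. -/
abbrev Ext (K : Type) [DecidableEq K] : Type u := CliffordAlgebra (0 : QuadraticForm k (K → k))

/-- Multiplication by a variable. -/
def polyX (i : K) : Module.End k (MvPolynomial K k) := LinearMap.mulLeft k (MvPolynomial.X i)

/-- Partial derivative. -/
def polyD (i : K) : Module.End k (MvPolynomial K k) := (MvPolynomial.pderiv i).toLinearMap

/-- Multiplication by a generator. -/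
def extX (i : K) : Module.End k (Ext k K) :=
  LinearMap.mulLeft k (CliffordAlgebra.ι (0 : QuadraticForm k (K → k)) (Pi.single i 1))

/-- Contraction with a coordinate form. -/
def extD (i : K) : Module.End k (Ext k K) :=
  CliffordAlgebra.contractLeft (LinearMap.proj i : Module.Dual k (K → k))

/-- The powers of the parity involution of the exterior algebra. -/
def extS (p : ZMod 2) : Module.End k (Ext k K) :=
  if p = 0 then 1 else (CliffordAlgebra.involute (Q := (0 : QuadraticForm k (K → k)))).toLinearMap

omit [DecidableEq K] in
theorem polyX_polyX (i j : K) : Commute (polyX (k := k) i) (polyX j) :=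
  LinearMap.ext fun a => by simp [polyX, mul_left_comm]

theorem polyD_polyD (i j : K) : Commute (polyD (k := k) i) (polyD j) :=
  LinearMap.ext fun a => by
    have : (⁅MvPolynomial.pderiv i, MvPolynomial.pderiv j⁆ :
        Derivation k (MvPolynomial K k) (MvPolynomial K k)) = 0 :=
      MvPolynomial.derivation_ext fun l => by
        rw [Derivation.commutator_apply, MvPolynomial.pderiv_X, MvPolynomial.pderiv_X]
        simp only [Pi.single_apply, Derivation.zero_apply]
        split_ifs <;> simp
    have := DFunLike.congr_fun this a
    rw [Derivation.commutator_apply, Derivation.zero_apply, sub_eq_zero] at this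
    exact this

theorem polyD_polyX (i j : K) : SuperComm 1 (polyD (k := k) i) (polyX j)
    (if i = j then 1 else 0) := by
  refine LinearMap.ext fun a => ?_
  rcases eq_or_ne i j with rfl | h
  · simp [polyD, polyX, add_comm]
  · simp [polyD, polyX, h, MvPolynomial.pderiv_X]

theorem extX_extX (i j : K) : SuperComm (-1) (extX (k := k) i) (extX j) 0 := by
  refine LinearMap.ext fun a => ?_
  have := CliffordAlgebra.ι_mul_ι_add_swap (Q := (0 : QuadraticForm k (K → k)))
    (Pi.single i 1) (Pi.single j 1)
  simp only [QuadraticMap.polar, zero_apply, sub_zero, map_zero] at this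
  simp [extX, ← mul_assoc, eq_neg_of_add_eq_zero_left this]

theorem extD_extD (i j : K) : SuperComm (-1) (extD (k := k) i) (extD j) 0 := by
  refine LinearMap.ext fun a => ?_
  simpa [extD] using CliffordAlgebra.contractLeft_comm (LinearMap.proj i) (LinearMap.proj j) a

theorem extD_extX (i j : K) : SuperComm (-1) (extD (k := k) i) (extX j)
    (if i = j then 1 else 0) := by
  refine LinearMap.ext fun a => ?_
  have := CliffordAlgebra.contractLeft_ι_mul (Q := (0 : QuadraticForm k (K → k)))
    (d := LinearMap.proj i) (Pi.single j 1) a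
  rcases eq_or_ne i j with rfl | h
  · simpa [extD, extX, sub_eq_add_neg] using this
  · simpa [extD, extX, h, sub_eq_add_neg] using this

theorem extS_add (p q : ZMod 2) : extS (k := k) (K := K) (p + q) = extS p * extS q := by
  have h : extS (k := k) (K := K) 1 * extS 1 = 1 := LinearMap.ext fun a => by
    simp [extS]
  rcases zmod2_cases p with rfl | rfl <;> rcases zmod2_cases q with rfl | rfl
  · simp [extS]
  · simp [extS]
  · simp [extS]
  · rw [one_add_one_zmod2, h, extS, if_pos rfl]

theorem extS_extX (p : ZMod 2) (i : K) :
    SuperComm (sgn p 1) (extS (k := k) p) (extX i) 0 := by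
  refine LinearMap.ext fun a => ?_
  rcases zmod2_cases p with rfl | rfl <;> simp [extS, extX]

theorem involute_extD (i : K) (a : Ext k K) :
    CliffordAlgebra.involute (extD i a) = -extD i (CliffordAlgebra.involute a) := by
  induction a using CliffordAlgebra.left_induction with
  | algebraMap r => simp [extD, CliffordAlgebra.contractLeft_algebraMap]
  | add a b ha hb => simp only [map_add, ha, hb, neg_add]
  | ι_mul a m h =>
    simp only [extD] at h
    simp [extD, CliffordAlgebra.contractLeft_ι_mul, h, sub_eq_add_neg]

theorem extS_extD (p : ZMod 2) (i : K) :
    SuperComm (sgn p 1) (extS (k := k) p) (extD i) 0 := by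
  refine LinearMap.ext fun a => ?_
  rcases zmod2_cases p with rfl | rfl
  · simp [extS]
  · simp [extS, involute_extD]

end Abstract

end Fock

theorem SuperComm.map {A B F : Type*} [Ring A] [Ring B] [FunLike F A B] [RingHomClass F A B]
    (f : F) {s : ℤ} {a b c : A} (h : SuperComm s a b c) : SuperComm s (f a) (f b) (f c) := by
  unfold SuperComm at *
  rw [← map_mul, h, map_add, map_zsmul, map_mul]

/-! ### Superpolynomials with coefficients in a module. -/

namespace Fock

variable {K : Type} [DecidableEq K] {k : Type u} [Field k] {N : Type u} [AddCommGroup N]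
  [Module k N]

variable (k N K) in
/-- Superpolynomials with coefficients in `N`. -/
def Space : Type u := (MvPolynomial K k ⊗[k] Ext k K) ⊗[k] N

instance : AddCommGroup (Space K k N) :=
  inferInstanceAs (AddCommGroup ((MvPolynomial K k ⊗[k] Ext k K) ⊗[k] N))

instance : Module k (Space K k N) :=
  inferInstanceAs (Module k ((MvPolynomial K k ⊗[k] Ext k K) ⊗[k] N))

/-- The pure tensors. -/
def tm (a : MvPolynomial K k) (b : Ext k K) (n : N) : Space K k N := (a ⊗ₜ[k] b) ⊗ₜ[k] n

theorem end_ext {f g : Module.End k (Space K k N)} (h : ∀ a b n, f (tm a b n) = g (tm a b n)) :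
    f = g :=
  TensorProduct.ext_threefold h

/-- Operators acting on the polynomial factor. -/
def opP : Module.End k (MvPolynomial K k) →ₐ[k] Module.End k (Space K k N) :=
  (Module.End.rTensorAlgHom k (MvPolynomial K k ⊗[k] Ext k K) N).comp
    (Module.End.rTensorAlgHom k (MvPolynomial K k) (Ext k K))

/-- Operators acting on the exterior factor. -/
def opE : Module.End k (Ext k K) →ₐ[k] Module.End k (Space K k N) :=
  (Module.End.rTensorAlgHom k (MvPolynomial K k ⊗[k] Ext k K) N).comp
    (Module.End.lTensorAlgHom k (Ext k K) (MvPolynomial K k))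

/-- Operators acting on the coefficients. -/
def opN : Module.End k N →ₐ[k] Module.End k (Space K k N) :=
  Module.End.lTensorAlgHom k N (MvPolynomial K k ⊗[k] Ext k K)

theorem opP_tm (f : Module.End k (MvPolynomial K k)) (a : MvPolynomial K k) (b : Ext k K) (n : N) :
    opP f (tm a b n) = tm (f a) b n := rfl

theorem opE_tm (f : Module.End k (Ext k K)) (a : MvPolynomial K k) (b : Ext k K) (n : N) :
    opE f (tm a b n) = tm a (f b) n := rfl

theorem opN_tm (f : Module.End k N) (a : MvPolynomial K k) (b : Ext k K) (n : N) :
    opN f (tm a b n) = tm a b (f n) := rfl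

theorem opP_opE (f : Module.End k (MvPolynomial K k)) (g : Module.End k (Ext k K)) :
    Commute (opP (N := N) f) (opE g) :=
  end_ext fun a b n => by simp [opP_tm, opE_tm]

theorem opP_opN (f : Module.End k (MvPolynomial K k)) (g : Module.End k N) :
    Commute (opP (K := K) f) (opN g) :=
  end_ext fun a b n => by simp [opP_tm, opN_tm]

theorem opE_opN (f : Module.End k (Ext k K)) (g : Module.End k N) :
    Commute (opE f) (opN g) :=
  end_ext fun a b n => by simp [opE_tm, opN_tm]

variable (k N) in
/-- The creation operators. -/
def X (p : K → ZMod 2) (i : K) : Module.End k (Space K k N) :=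
  if p i = 0 then opP (polyX i) else opE (extX i)

variable (k N) in
/-- The annihilation operators. -/
def D (p : K → ZMod 2) (i : K) : Module.End k (Space K k N) :=
  if p i = 0 then opP (polyD i) else opE (extD i)

/-- The action on the coefficients, twisted by parities. -/
def rho (p : K → ZMod 2) (ρ : K → K → Module.End k N) (i j : K) : Module.End k (Space K k N) :=
  opE (extS (p i + p j)) * opN (ρ i j)

theorem superComm_of_commute {A : Type*} [Ring A] {s : ℤ} {a b : A} (hs : s = 1)
    (h : Commute a b) : SuperComm s a b 0 := hs ▸ h.superComm

/-- Even variables act on polynomials and odd ones on the exterior algebra, so x and d satisfy the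
canonical relations with the correct signs. The powers of the parity involution built into `rho`
make odd units anticommute with the odd variables. -/
theorem isWeylGl (p : K → ZMod 2) {ρ : K → K → Module.End k N} (hρ : IsGlFamily p ρ) :
    IsWeylGl p (X k N p) (D k N p) (rho p ρ) where
  xx i j := by
    rcases zmod2_cases (p i) with hi | hi <;> rcases zmod2_cases (p j) with hj | hj <;>
      simp only [X, hi, hj, if_true, one_ne_zero, if_false]
    · exact ((polyX_polyX i j).map opP).superComm
    · exact (opP_opE _ _).superComm
    · exact (opP_opE _ _).symm.superComm
    · exact ((extX_extX (k := k) i j).map (opE (N := N))).of_eq rfl (map_zero _)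
  dd i j := by
    rcases zmod2_cases (p i) with hi | hi <;> rcases zmod2_cases (p j) with hj | hj <;>
      simp only [D, hi, hj, if_true, one_ne_zero, if_false]
    · exact ((polyD_polyD i j).map opP).superComm
    · exact (opP_opE _ _).superComm
    · exact (opP_opE _ _).symm.superComm
    · exact ((extD_extD (k := k) i j).map (opE (N := N))).of_eq rfl (map_zero _)
  dx i j := by
    have hne : p i ≠ p j → i ≠ j := fun h e => h (congrArg p e)
    rcases zmod2_cases (p i) with hi | hi <;> rcases zmod2_cases (p j) with hj | hj <;>
      simp only [X, D, hi, hj, if_true, one_ne_zero, if_false]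
    · exact ((polyD_polyX i j).map opP).of_eq rfl (by split_ifs <;> simp)
    · rw [if_neg (hne (by simp [hi, hj]))]; exact (opP_opE _ _).superComm
    · rw [if_neg (hne (by simp [hi, hj]))]; exact (opP_opE _ _).symm.superComm
    · exact ((extD_extX (k := k) i j).map (opE (N := N))).of_eq rfl (by split_ifs <;> simp)
  ρx i j a := by
    rcases zmod2_cases (p a) with ha | ha <;> simp only [X, rho, ha, if_true, one_ne_zero, if_false]
    · exact superComm_of_commute (sgn_zero_right _)
        ((opP_opE _ _).symm.mul_left (opP_opN _ _).symm)
    · exact (((extS_extX (k := k) (p i + p j) a).map (opE (N := N))).mul_left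
        (opE_opN _ _).symm.superComm).of_eq (mul_one _) (by simp)
  ρd i j a := by
    rcases zmod2_cases (p a) with ha | ha <;> simp only [D, rho, ha, if_true, one_ne_zero, if_false]
    · exact superComm_of_commute (sgn_zero_right _)
        ((opP_opE _ _).symm.mul_left (opP_opN _ _).symm)
    · exact (((extS_extD (k := k) (p i + p j) a).map (opE (N := N))).mul_left
        (opE_opN _ _).symm.superComm).of_eq (mul_one _) (by simp)
  ρρ i j a b := by
    -- The twist depends only on the total parity, which is the same for both orders of the product
    -- and for the bracket, so it factors out of the relation.
    have key : ∀ i j a b, rho p ρ i j * rho p ρ a b =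
        opE (extS (p i + p j + (p a + p b))) * opN (ρ i j * ρ a b) := fun i j a b => by
      rw [rho, rho, (opE_opN (extS (p a + p b)) (ρ i j)).symm.mul_mul_mul_comm,
        extS_add (p i + p j), map_mul, map_mul]
    have h := hρ i j a b
    unfold SuperComm at h ⊢
    rw [key, key, h, add_comm (p a + p b), map_add, mul_add, map_zsmul, mul_smul_comm]
    congr 1
    rw [map_sub, mul_sub, map_zsmul, mul_smul_comm]
    have e : ∀ x y z : ZMod 2, x + y + (y + z) = x + z := by decide
    have e' : ∀ x y z : ZMod 2, x + y + (z + x) = z + y := by decide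
    congr 2
    · split_ifs with hj
      · subst hj; rw [rho, e]
      · simp
    · split_ifs with hj
      · subst hj; rw [rho, e']
      · simp

/-- The vacuum vectors. -/
def vac : N →ₗ[k] Space K k N := TensorProduct.mk k (MvPolynomial K k ⊗[k] Ext k K) N (1 ⊗ₜ 1)

theorem vac_apply (n : N) : vac (K := K) (k := k) n = tm 1 1 n := rfl

/-- Setting all variables, even and odd, to zero is a left inverse. -/
theorem vac_injective : Function.Injective (vac (K := K) (k := k) (N := N)) := by
  let ε : (MvPolynomial K k ⊗[k] Ext k K) →ₗ[k] k := (TensorProduct.lid k k).toLinearMap ∘ₗ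
    TensorProduct.map (MvPolynomial.aeval (fun _ : K => (0 : k))).toLinearMap
      (ExteriorAlgebra.algebraMapInv (R := k) (M := K → k)).toLinearMap
  refine Function.LeftInverse.injective
    (g := (TensorProduct.lid k N).toLinearMap ∘ₗ ε.rTensor N) fun n => ?_
  change TensorProduct.lid k N (ε.rTensor N ((1 ⊗ₜ 1) ⊗ₜ n)) = n
  simp [ε]

theorem tm_zero_left (b : Ext k K) (n : N) : tm (0 : MvPolynomial K k) b n = 0 := by
  change (0 ⊗ₜ[k] b) ⊗ₜ[k] n = 0
  rw [TensorProduct.zero_tmul, TensorProduct.zero_tmul]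

theorem tm_zero_right (a : MvPolynomial K k) (n : N) : tm a (0 : Ext k K) n = 0 := by
  change (a ⊗ₜ[k] 0) ⊗ₜ[k] n = 0
  rw [TensorProduct.tmul_zero, TensorProduct.zero_tmul]

theorem D_vac (p : K → ZMod 2) (i : K) (n : N) : D k N p i (vac n) = 0 := by
  unfold D
  split_ifs
  · simp [vac_apply, opP_tm, polyD, tm_zero_left]
  · simp [vac_apply, opE_tm, extD, tm_zero_right]

theorem rho_vac (p : K → ZMod 2) (ρ : K → K → Module.End k N) (i j : K) (n : N) :
    rho p ρ i j (vac n) = vac (ρ i j n) := by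
  unfold rho extS
  split_ifs <;> simp [vac_apply, opN_tm, opE_tm]

variable [Fintype K]

/-- The family of matrix units for the index set `Option K`. -/
def family (p : K → ZMod 2) (ρ : K → K → Module.End k N) (c : k) :
    Option K → Option K → Module.End k (Space K k N) :=
  IsWeylGl.ext p (X k N p) (D k N p) (rho p ρ) (algebraMap k _ c)

theorem isGlFamily_family {p : K → ZMod 2} {ρ : K → K → Module.End k N} (hρ : IsGlFamily p ρ)
    (c : k) : IsGlFamily (fun i : Option K => i.elim 0 p) (family p ρ c) :=
  IsWeylGl.isGlFamily_ext (isWeylGl p hρ) fun a => Algebra.commutes c a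

variable (p : K → ZMod 2) (ρ : K → K → Module.End k N) (c : k) (n : N)

theorem family_none_some (j : K) : family p ρ c none (some j) (vac n) = 0 := D_vac p j n

theorem family_some_some (i j : K) :
    family p ρ c (some i) (some j) (vac n) = vac (ρ i j n) := by
  simp [family, IsWeylGl.ext, IsWeylGl.E, D_vac, rho_vac]

theorem euler_vac : IsWeylGl.euler (X k N p) (D k N p) (vac n) = 0 := by
  simp [IsWeylGl.euler, LinearMap.sum_apply, D_vac]

theorem family_none_none : family p ρ c none none (vac n) = c • vac n := by
  simp [family, IsWeylGl.ext, euler_vac]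

/-- If only the diagonal matrix unit in row `i` acts nontrivially on `n`, and if its eigenvalue
satisfies the atypicality condition, then so does `e_{i, none}`. -/
theorem family_some_none (i : K) (hi : p i = 1) (h : ∀ j, j ≠ i → ρ i j n = 0)
    (hc : ρ i i n = (-c) • n) : family p ρ c (some i) none (vac n) = 0 := by
  simp only [family, IsWeylGl.ext, IsWeylGl.Y, IsWeylGl.R, LinearMap.sub_apply,
    Module.End.mul_apply, euler_vac, sub_zero, LinearMap.sum_apply, LinearMap.smul_apply, rho_vac]
  rw [Finset.sum_eq_single i (fun j _ hj => by rw [h j hj]; simp) (by simp), hc, hi]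
  simp

end Fock

/-! ## Enveloping superalgebras and induced modules -/

section UEAInduction

variable {k : Type u} [Field k]

/-- L generates U(L): the universal property gives a map from U(L) to B, and its composite with the
inclusion agrees with the identity on L. -/
theorem UEA.mem_of_ι_mem {L : LieSuperalg k} (B : Subalgebra k (UEA L))
    (h : ∀ x, UEA.ι L x ∈ B) (a : UEA L) : a ∈ B := by
  let g : UEA L →ₐ[k] B := UEA.lift L
    ((UEA.ι L).codRestrict (Subalgebra.toSubmodule B) h : L →ₗ[k] B)
    (fun hx hy => Subtype.ext (UEA.ι_br L hx hy))
  have : B.val.comp g = AlgHom.id k _ := UEA.hom_ext L fun x => by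
    rw [AlgHom.comp_apply, UEA.lift_ι]; rfl
  have e := DFunLike.congr_fun this a
  rw [AlgHom.comp_apply, AlgHom.id_apply] at e
  rw [← e]
  exact (g a).2

theorem UEA.smul_mem_of_stable {L : LieSuperalg k} {V : Type*} [AddCommGroup V] [Module k V]
    [Module (UEA L) V] [IsScalarTower k (UEA L) V] (S : Submodule k V)
    (h : ∀ x, ∀ w ∈ S, UEA.ι L x • w ∈ S) (a : UEA L) {w : V} (hw : w ∈ S) : a • w ∈ S := by
  let B : Subalgebra k (UEA L) :=
    { carrier := {a | ∀ w ∈ S, a • w ∈ S}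
      mul_mem' := fun ha hb w hw => by rw [mul_smul]; exact ha _ (hb _ hw)
      add_mem' := fun ha hb w hw => by rw [add_smul]; exact add_mem (ha _ hw) (hb _ hw)
      algebraMap_mem' := fun r w hw => by rw [algebraMap_smul]; exact S.smul_mem r hw }
  exact UEA.mem_of_ι_mem B h a w hw

end UEAInduction

/-! ### Cyclicity and the universal property of induced modules. -/

section IndLemmas

variable {k : Type u} [Field k] {P G : LieSuperalg k} (f : LieSuperalg.Hom P G) (M : SuperMod P)

/-- The induced module is cyclic. This serves as an induction principle: two maps that agree on the
generator agree everywhere once their equalizer is stable under the algebra. -/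
theorem ind_eq_top_of_stable {m₀ : M} (hm : ∀ m : M, ∃ c : k, m = c • m₀)
    (S : Submodule k (IndSpace f M)) (h0 : indMk f M 1 m₀ ∈ S)
    (h : ∀ x, ∀ w ∈ S, UEA.ι G x • w ∈ S) : S = ⊤ := by
  rw [eq_top_iff]
  rintro w -
  induction w using ind_induction with
  | h0 => exact zero_mem _
  | hadd x y hx hy => exact add_mem hx hy
  | hmk a m =>
    obtain ⟨c, rfl⟩ := hm m
    rw [map_smul, ← mul_one a, ← smul_indMk]
    exact S.smul_mem c (UEA.smul_mem_of_stable S h a h0)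

variable {C : Type*} [AddCommGroup C] [Module k C]

/-- The universal property of the induced module. -/
def indLift (φ : UEA G →ₐ[k] Module.End k C) (g : M →ₗ[k] C)
    (h : ∀ p m, φ (UEA.ι G (f.toLin p)) (g m) = g (M.act p m)) : IndSpace f M →ₗ[k] C :=
  ((indRel f M).restrictScalars k).liftQ
    (TensorProduct.lift ((LinearMap.lcomp k C g) ∘ₗ φ.toLinearMap)) (by
      intro t ht
      rw [LinearMap.mem_ker]
      change t ∈ indRel f M at ht
      induction ht using Submodule.span_induction with
      | mem t ht =>
        obtain ⟨p, m, rfl⟩ := ht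
        simp [h]
      | zero => exact map_zero _
      | add s t _ _ hs ht => rw [map_add, hs, ht, add_zero]
      | smul a t _ ht =>
        have key : ∀ t : UEA G ⊗[k] M,
            TensorProduct.lift ((LinearMap.lcomp k C g) ∘ₗ φ.toLinearMap) (a • t) =
              φ a (TensorProduct.lift ((LinearMap.lcomp k C g) ∘ₗ φ.toLinearMap) t) := by
          intro t
          induction t using TensorProduct.induction_on with
          | zero => simp
          | tmul b m => simp [TensorProduct.smul_tmul']
          | add s t hs ht => rw [smul_add, map_add, map_add, map_add, hs, ht]
        rw [key, ht, map_zero])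

theorem indLift_mk (φ : UEA G →ₐ[k] Module.End k C) (g : M →ₗ[k] C)
    (h : ∀ p m, φ (UEA.ι G (f.toLin p)) (g m) = g (M.act p m)) (a : UEA G) (m : M) :
    indLift f M φ g h (indMk f M a m) = φ a (g m) := rfl

theorem indLift_smul (φ : UEA G →ₐ[k] Module.End k C) (g : M →ₗ[k] C)
    (h : ∀ p m, φ (UEA.ι G (f.toLin p)) (g m) = g (M.act p m)) (a : UEA G) (w : IndSpace f M) :
    indLift f M φ g h (a • w) = φ a (indLift f M φ g h w) := by
  induction w using ind_induction with
  | h0 => simp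
  | hadd x y hx hy => rw [smul_add, map_add, map_add, map_add, hx, hy]
  | hmk b m => rw [smul_indMk, indLift_mk, indLift_mk, map_mul, Module.End.mul_apply]

end IndLemmas

/-! ## Splitting off the kernel of an operator -/

section Coprime

open Polynomial

variable {k : Type*} [Field k] {V : Type*} [AddCommGroup V] [Module k V]

/-- The vectors annihilated by a polynomial in `H` with nonzero constant term. -/
def coprimePart (H : Module.End k V) : Submodule k V where
  carrier := {w | ∃ p : k[X], p.eval 0 ≠ 0 ∧ aeval H p w = 0}
  zero_mem' := ⟨1, by simp, by simp⟩
  add_mem' := by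
    rintro v w ⟨p, hp, hv⟩ ⟨q, hq, hw⟩
    refine ⟨p * q, by simp [hp, hq], ?_⟩
    rw [map_add]
    nth_rewrite 1 [mul_comm]
    rw [map_mul, map_mul, Module.End.mul_apply, Module.End.mul_apply, hv, hw, map_zero, map_zero,
      add_zero]
  smul_mem' := by
    rintro c w ⟨p, hp, hw⟩
    exact ⟨p, hp, by rw [map_smul, hw, smul_zero]⟩

theorem mem_coprimePart_of_eigen {H : Module.End k V} {c : k} (hc : c ≠ 0) {w : V}
    (hw : H w = c • w) : w ∈ coprimePart H :=
  ⟨X - C c, by simpa using hc, by simp [hw, Algebra.algebraMap_eq_smul_one]⟩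

theorem aeval_of_apply_eq_zero {H : Module.End k V} {w : V} (hw : H w = 0) (p : k[X]) :
    aeval H p w = p.eval 0 • w := by
  rw [← Polynomial.divX_mul_X_add p]
  simp [hw, Algebra.algebraMap_eq_smul_one]

/-- On the kernel of H a polynomial p(H) acts by p(0), so a nonzero constant term forces the vector
to vanish. Hence the sum of ker H and `coprimePart H` is direct. -/
theorem eq_zero_of_mem_coprimePart {H : Module.End k V} {w : V} (hw : H w = 0)
    (h : w ∈ coprimePart H) : w = 0 := by
  obtain ⟨p, hp, h⟩ := h
  rw [aeval_of_apply_eq_zero hw] at h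
  exact (smul_eq_zero.mp h).resolve_left hp

theorem commute_aeval {H T : Module.End k V} (hT : Commute H T) (p : k[X]) :
    Commute (aeval H p) T := by
  induction p using Polynomial.induction_on' with
  | add p q hp hq => rw [map_add]; exact hp.add_left hq
  | monomial n a =>
    rw [aeval_monomial]
    exact (Algebra.commute_algebraMap_left a T).mul_left (hT.pow_left n)

theorem map_mem_coprimePart {H T : Module.End k V} (hT : Commute H T) {w : V}
    (h : w ∈ coprimePart H) : T w ∈ coprimePart H := by
  obtain ⟨p, hp, h⟩ := h
  refine ⟨p, hp, ?_⟩
  rw [← Module.End.mul_apply, (commute_aeval hT p).eq, Module.End.mul_apply, h, map_zero]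

/-- On the part where `H` is invertible, `w = H w'` with `w'` a polynomial in `H` applied
to `w`. -/
theorem exists_eq_of_mem_coprimePart {H : Module.End k V} {w : V} (h : w ∈ coprimePart H) :
    ∃ q : k[X], w = H (aeval H q w) := by
  obtain ⟨p, hp, h⟩ := h
  -- Writing p = X · p.divX + p(0), the equation p(H) w = 0 is solved for w.
  refine ⟨C (-(p.eval 0)⁻¹) * p.divX, ?_⟩
  have e : p.divX * X = p - C (p.eval 0) := by
    rw [← coeff_zero_eq_eval_zero, eq_sub_iff_add_eq, divX_mul_X_add]
  have e2 : H (aeval H (C (-(p.eval 0)⁻¹) * p.divX) w) =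
      aeval H (C (-(p.eval 0)⁻¹) * (p.divX * X)) w := by
    rw [← mul_assoc, mul_comm _ X, map_mul (aeval H) X, aeval_X, Module.End.mul_apply]
  rw [e2, e, map_mul, aeval_C, map_sub, aeval_C, Module.End.mul_apply, LinearMap.sub_apply, h]
  simp [Algebra.algebraMap_eq_smul_one, hp]

theorem span_apply_mem {S : Set (Module.End k V)} {F : Submodule k V} {w : V}
    (h : ∀ a ∈ S, a w ∈ F) {c : Module.End k V} (hc : c ∈ Submodule.span k S) : c w ∈ F := by
  induction hc using Submodule.span_induction with
  | mem a ha => exact h a ha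
  | zero => exact zero_mem _
  | add a b _ _ ha hb => exact add_mem ha hb
  | smul t a _ ha => exact F.smul_mem t ha

/-- The filtration steps of a module generated by a subspace `F` under lowering operators. -/
def lowering (Sm : Set (Module.End k V)) (F : Submodule k V) : ℕ → Submodule k V
  | 0 => F
  | r + 1 => Submodule.span k {v | ∃ b ∈ Sm, ∃ w ∈ lowering Sm F r, v = b w}

/-- A triangular decomposition argument. The r-th lowering step is stable under S0, and Sp maps it
to the previous one, so the sum of all steps is stable under every operator and is the whole space.
H acts on the r-th step by -r, which is nonzero for r > 0 in characteristic 0. -/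
theorem sup_coprimePart_eq_top [CharZero k] {S0 Sm Sp : Set (Module.End k V)}
    {H : Module.End k V} {F : Submodule k V}
    (h0 : ∀ a ∈ S0, ∀ w ∈ F, a w ∈ F) (hp : ∀ a ∈ Sp, ∀ w ∈ F, a w = 0)
    (h0m : ∀ a ∈ S0, ∀ b ∈ Sm, ∃ c ∈ Submodule.span k Sm, ∃ s, SuperComm s a b c)
    (hpm : ∀ a ∈ Sp, ∀ b ∈ Sm, ∃ c ∈ Submodule.span k S0, ∃ s, SuperComm s a b c)
    (hH : ∀ b ∈ Sm, SuperComm 1 H b (-b)) (hH0 : ∀ w ∈ F, H w = 0)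
    (hgen : ∀ S : Submodule k V, F ≤ S → (∀ a, a ∈ S0 ∨ a ∈ Sm ∨ a ∈ Sp → ∀ w ∈ S, a w ∈ S) →
      S = ⊤) : F ⊔ coprimePart H = ⊤ := by
  have hm : ∀ r, ∀ b ∈ Sm, ∀ w ∈ lowering Sm F r, b w ∈ lowering Sm F (r + 1) :=
    fun r b hb w hw => Submodule.subset_span ⟨b, hb, w, hw, rfl⟩
  have e0 : ∀ r, ∀ a ∈ S0, ∀ w ∈ lowering Sm F r, a w ∈ lowering Sm F r := by
    intro r
    induction r with
    | zero => exact h0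
    | succ r ih =>
      intro a ha w hw
      induction hw using Submodule.span_induction with
      | mem v hv =>
        obtain ⟨b, hb, w, hw, rfl⟩ := hv
        obtain ⟨c, hc, s, h⟩ := h0m a ha b hb
        rw [← Module.End.mul_apply, h]
        exact add_mem (span_apply_mem (fun b hb => hm r b hb w hw) hc)
          (zsmul_mem (hm r b hb _ (ih a ha w hw)) s)
      | zero => rw [map_zero]; exact zero_mem _
      | add v w _ _ hv hw => rw [map_add]; exact add_mem hv hw
      | smul t v _ hv => rw [map_smul]; exact Submodule.smul_mem _ t hv
  have eH : ∀ r : ℕ, ∀ w ∈ lowering Sm F r, H w = (-(r : k)) • w := by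
    intro r
    induction r with
    | zero => intro w hw; simp [hH0 w hw]
    | succ r ih =>
      intro w hw
      induction hw using Submodule.span_induction with
      | mem v hv =>
        obtain ⟨b, hb, w, hw, rfl⟩ := hv
        rw [← Module.End.mul_apply, hH b hb]
        simp [ih w hw, add_smul, add_comm]
      | zero => simp
      | add v w _ _ hv hw => rw [map_add, hv, hw, smul_add]
      | smul t v _ hv => rw [map_smul, hv, smul_comm]
  let S : Submodule k V := ⨆ r, lowering Sm F r
  have hle : ∀ r, lowering Sm F r ≤ S := fun r => le_iSup _ r
  -- At r = 0 the truncated r - 1 is again 0; this is harmless because raising operators kill F. The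
  -- case r = 0 inside the successor step uses the same vanishing.
  have ep : ∀ r, ∀ a ∈ Sp, ∀ w ∈ lowering Sm F r, a w ∈ lowering Sm F (r - 1) := by
    intro r
    induction r with
    | zero => intro a ha w hw; rw [hp a ha w hw]; exact zero_mem _
    | succ r ih =>
      intro a ha w hw
      rw [Nat.add_sub_cancel]
      induction hw using Submodule.span_induction with
      | mem v hv =>
        obtain ⟨b, hb, w, hw, rfl⟩ := hv
        obtain ⟨c, hc, s, h⟩ := hpm a ha b hb
        rw [← Module.End.mul_apply, h]
        refine add_mem (span_apply_mem (fun a ha => e0 r a ha w hw) hc) (zsmul_mem ?_ s)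
        rcases r with _ | r
        · rw [Module.End.mul_apply, hp a ha w hw, map_zero]; exact zero_mem _
        · exact hm r b hb _ (ih a ha w hw)
      | zero => rw [map_zero]; exact zero_mem _
      | add v w _ _ hv hw => rw [map_add]; exact add_mem hv hw
      | smul t v _ hv => rw [map_smul]; exact Submodule.smul_mem _ t hv
  have hS : S = ⊤ := by
    refine hgen S (hle 0) fun a ha w hw => ?_
    induction hw using Submodule.iSup_induction' with
    | mem r w hw =>
      rcases ha with ha | ha | ha
      · exact hle r (e0 r a ha w hw)
      · exact hle _ (hm r a ha w hw)
      · exact hle _ (ep r a ha w hw)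
    | zero => rw [map_zero]; exact zero_mem _
    | add v w _ _ hv hw => rw [map_add]; exact add_mem hv hw
  rw [eq_top_iff, ← hS]
  refine iSup_le fun r => ?_
  rcases r with _ | r
  · exact le_sup_left
  · intro w hw
    refine Submodule.mem_sup_right (mem_coprimePart_of_eigen ?_ (eH _ w hw))
    exact neg_ne_zero.mpr (by exact_mod_cast Nat.succ_ne_zero r)

end Coprime

/-! ## Matrix units -/

section MatrixUnits

variable {k : Type u} [Field k] {n : ℕ}

/-- The matrix units of `gl(n|n)`. -/
def unit (k : Type u) [Field k] {n : ℕ} (i j : Idx n) : Mat k n := Matrix.single i j 1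

theorem unit_mem (i j : Idx n) : unit k i j ∈ glGr k n (par i + par j) := by
  intro a b h
  refine Matrix.single_apply_of_ne _ _ _ _ _ ?_
  rintro ⟨rfl, rfl⟩
  exact h rfl

theorem unit_mem_supp {R : Idx n → Idx n → Prop} {i j : Idx n} (h : R i j) :
    unit k i j ∈ supp k R := by
  intro a b hab
  refine Matrix.single_apply_of_ne _ _ _ _ _ ?_
  rintro ⟨rfl, rfl⟩
  exact hab h

theorem superBr_unit (i j a b : Idx n) :
    superBr (unit k i j) (unit k a b) = (if j = a then unit k i b else 0) -
      sgn (par i + par j) (par a + par b) • (if b = i then unit k a j else 0) := by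
  rw [superBr_homog (unit_mem i j) (unit_mem a b)]
  unfold unit
  congr 2
  · split_ifs with h
    · subst h; simp
    · simp [h]
  · split_ifs with h
    · subst h; simp
    · simp [h]

theorem eq_sum_unit (A : Mat k n) : A = ∑ i, ∑ j, A i j • unit k i j := by
  conv_lhs => rw [Matrix.matrix_eq_sum_single A]
  simp [unit, Matrix.smul_single]

theorem IsGlFamily.comp {K K' : Type*} [DecidableEq K] [DecidableEq K'] {A : Type*} [Ring A]
    {p : K → ZMod 2} {ρ : K → K → A} (h : IsGlFamily p ρ) {e : K' → K}
    (he : Function.Injective e) {q : K' → ZMod 2} (hq : ∀ i, q i = p (e i)) :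
    IsGlFamily q (fun i j => ρ (e i) (e j)) := by
  intro i j a b
  simpa [hq, he.eq_iff] using h (e i) (e j) (e a) (e b)

/-- The linear extension of a family of elements indexed like the matrix units. -/
def famLin {A : Type*} [Ring A] [Algebra k A] (ρ : Idx n → Idx n → A) : Mat k n →ₗ[k] A :=
  ∑ i, ∑ j, (Matrix.entryLinearMap k k i j).smulRight (ρ i j)

theorem famLin_apply {A : Type*} [Ring A] [Algebra k A] (ρ : Idx n → Idx n → A) (B : Mat k n) :
    famLin ρ B = ∑ i, ∑ j, B i j • ρ i j := by
  simp [famLin, LinearMap.sum_apply]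

theorem famLin_unit {A : Type*} [Ring A] [Algebra k A] (ρ : Idx n → Idx n → A) (i j : Idx n) :
    famLin ρ (unit k i j) = ρ i j := by
  rw [famLin_apply, Finset.sum_eq_single i, Finset.sum_eq_single j]
  · simp [unit]
  · intro b _ hb; simp [unit, hb.symm]
  · simp
  · intro a _ ha; simp [unit, ha.symm]
  · simp

/-- The Koszul sign depends on the parities, so the super relation is bilinear only with the
parities fixed. Homogeneous matrices involve only matrix units of their own parity. -/
theorem mat_bilin_ext {A : Type*} [AddCommGroup A] [Module k A] {p q : ZMod 2}
    {β : Mat k n →ₗ[k] Mat k n →ₗ[k] A}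
    (h : ∀ i j a b, par i + par j = p → par a + par b = q → β (unit k i j) (unit k a b) = 0)
    {B C : Mat k n} (hB : B ∈ glGr k n p) (hC : C ∈ glGr k n q) : β B C = 0 := by
  rw [eq_sum_unit B, eq_sum_unit C]
  simp only [map_sum, map_smul, LinearMap.sum_apply, LinearMap.smul_apply]
  refine Finset.sum_eq_zero fun a _ => Finset.sum_eq_zero fun b _ => ?_
  by_cases h2 : par a + par b = q
  · refine smul_eq_zero_of_right _ (Finset.sum_eq_zero fun i _ => Finset.sum_eq_zero fun j _ => ?_)
    by_cases h1 : par i + par j = p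
    · rw [h i j a b h1 h2, smul_zero]
    · rw [hB i j h1, zero_smul]
  · rw [hC a b h2, zero_smul]

theorem famLin_br {A : Type*} [Ring A] [Algebra k A] {ρ : Idx n → Idx n → A}
    (h : IsGlFamily par ρ) {p q : ZMod 2} {B C : Mat k n} (hB : B ∈ glGr k n p)
    (hC : C ∈ glGr k n q) :
    famLin (k := k) ρ (superBr B C) =
      famLin ρ B * famLin ρ C - sgn p q • (famLin ρ C * famLin ρ B) := by
  let β : Mat k n →ₗ[k] Mat k n →ₗ[k] A :=
    LinearMap.compr₂ superBr (famLin ρ) - ((LinearMap.mul k A).compl₁₂ (famLin ρ) (famLin ρ) -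
      sgn p q • (LinearMap.mul k A).flip.compl₁₂ (famLin ρ) (famLin ρ))
  refine sub_eq_zero.mp (mat_bilin_ext (β := β) ?_ hB hC)
  rintro i j a b rfl rfl
  have := h i j a b
  change famLin ρ (superBr (unit k i j) (unit k a b)) - (famLin ρ (unit k i j) *
    famLin ρ (unit k a b) - sgn (par i + par j) (par a + par b) •
      (famLin ρ (unit k a b) * famLin ρ (unit k i j))) = 0
  rw [superBr_unit, map_sub, map_zsmul, apply_ite (famLin ρ), apply_ite (famLin ρ)]
  simp only [famLin_unit, map_zero]
  rw [this]
  abel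

/-- The algebra homomorphism on `U(gl(n|n))` defined by a family of matrix units. -/
def famHom {A : Type u} [Ring A] [Algebra k A] {ρ : Idx n → Idx n → A}
    (h : IsGlFamily par ρ) : UEA (gl k n) →ₐ[k] A :=
  UEA.lift (gl k n) (famLin ρ) (fun hx hy => famLin_br h hx hy)

theorem famHom_ι {A : Type u} [Ring A] [Algebra k A] {ρ : Idx n → Idx n → A}
    (h : IsGlFamily par ρ) (B : Mat k n) : famHom h (UEA.ι (gl k n) B) = famLin ρ B :=
  UEA.lift_ι _ _ _ _

theorem isGlFamily_act (M : SuperMod (gl k n)) :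
    IsGlFamily par (fun i j => (M.act (unit k i j) : Module.End k M)) := by
  intro i j a b
  refine LinearMap.ext fun v => ?_
  have h := M.act_br v (unit_mem (k := k) i j) (unit_mem a b)
  change M.act (superBr _ _) v = _ at h
  rw [superBr_unit, map_sub, map_zsmul, apply_ite M.act, apply_ite M.act, map_zero] at h
  rw [LinearMap.sub_apply] at h
  change M.act (unit k i j) (M.act (unit k a b) v) = _
  rw [eq_add_of_sub_eq h.symm]
  rfl

end MatrixUnits

/-! ## Weights of maximal atypicality -/

/-- For n = 1 the Weyl vector is zero and ε - δ is the only odd root modulo sign. The form is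
negative on δ, so pairing aε + bδ with ε - δ gives a + b. -/
theorem aty_one (μ : Weight 1) :
    aty μ = if μ (Sum.inl 0) + μ (Sum.inr 0) = 0 then 1 else 0 := by
  have hform : ∀ r, form (μ + rho 1) (oddRoot r) = μ (Sum.inl 0) + μ (Sum.inr 0) := by
    rintro ⟨i, j⟩
    obtain rfl := Subsingleton.elim i 0
    obtain rfl := Subsingleton.elim j 0
    simp [form, oddRoot, rho, par, Fintype.sum_sum_type]
  unfold aty
  split_ifs with h
  · refine le_antisymm (Finset.sup_le fun S _ => ?_) ?_
    · exact (Finset.card_le_univ S).trans (by simp)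
    · refine Finset.le_sup_of_le (b := {(0, 0)}) ?_ (by simp)
      simp [hform, h]
  · refine Nat.eq_zero_of_le_zero (Finset.sup_le fun S hS => ?_)
    rw [Finset.mem_filter] at hS
    rw [Nat.le_zero, Finset.card_eq_zero, Finset.eq_empty_iff_forall_notMem]
    intro r hr
    exact h (hform r ▸ hS.2.1 r hr)

/-- Each of the n atypicalities is at most 1, so their sum is n only if all of them equal 1. -/
theorem mem_LambdaMaBG {n : ℕ} {lam : Weight n} :
    lam ∈ LambdaMaBG n ↔ ∀ i, lam (Sum.inl i) + lam (Sum.inr i) = 0 := by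
  have h1 : ∀ i ∈ Finset.univ, aty (restr i lam) ≤ 1 := fun i _ => by
    rw [aty_one]; split_ifs <;> simp
  have h2 := Finset.sum_eq_sum_iff_of_le h1
  have h3 : lam ∈ LambdaMaBG n ↔ ∑ i, aty (restr i lam) = ∑ _i : Fin n, 1 := by
    simp [LambdaMaBG]
  rw [h3, h2]
  refine forall_congr' fun i => ?_
  rw [aty_one]
  change _ → (if lam (Sum.inl i) + lam (Sum.inr i) = 0 then 1 else 0) = 1 ↔ _
  split_ifs with h <;> simp [h]

/-! ## Subalgebras spanned by matrix units -/

section Supp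

variable {k : Type u} [Field k] {n : ℕ}

theorem map_mem_of_unit {R : Idx n → Idx n → Prop} {X : Type*} [AddCommGroup X] [Module k X]
    (T : supp k R →ₗ[k] X) (S : Submodule k X)
    (h : ∀ i j (hR : R i j), T ⟨unit k i j, unit_mem_supp hR⟩ ∈ S) (x : supp k R) : T x ∈ S := by
  classical
  have e : x = ∑ i, ∑ j, if hR : R i j then
      x.1 i j • (⟨unit k i j, unit_mem_supp hR⟩ : supp k R) else 0 := by
    apply Subtype.ext
    conv_lhs => rw [eq_sum_unit x.1]
    rw [AddSubmonoidClass.coe_finsetSum]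
    refine Finset.sum_congr rfl fun i _ => ?_
    rw [AddSubmonoidClass.coe_finsetSum]
    refine Finset.sum_congr rfl fun j _ => ?_
    split_ifs with hR
    · rfl
    · rw [x.2 i j hR, zero_smul]; rfl
  rw [e]
  simp only [map_sum]
  refine sum_mem fun i _ => sum_mem fun j _ => ?_
  split_ifs with hR
  · rw [map_smul]; exact S.smul_mem _ (h i j hR)
  · rw [map_zero]; exact zero_mem _

theorem SuperMod.superComm_act {L : LieSuperalg k} (M : SuperMod L) {p q : ZMod 2} {x y : L}
    (hx : x ∈ L.gr p) (hy : y ∈ L.gr q) :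
    SuperComm (A := Module.End k M) (sgn p q) (M.act x) (M.act y) (M.act (L.br x y)) :=
  LinearMap.ext fun v => by
    have := M.act_br v hx hy
    change M.act x (M.act y v) = M.act (L.br x y) v + sgn p q • M.act y (M.act x v)
    rw [this]; abel

end Supp

/-! ## The modules `L^o(lam)` -/

section Verma

variable (k : Type u) [Field k] [CharZero k] {n : ℕ} (lam : Weight n)

/-- The matrix units of `l_pr`. -/
def lUnit (i j : Idx n) (h : pos i = pos j) : (lPr k n).toAlg := ⟨unit k i j, unit_mem_supp h⟩

/-- The generator of the one-dimensional module of the Borel subalgebra. -/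
def oneVec : oneDim k lam := (1 : k)

/-- The highest weight vector of the Verma module. -/
def vermaVec : vermaO k lam :=
  indMk ((bO k n).inclLE (lPr k n) (bO_le_lPr k n)) (oneDim k lam) 1 (oneVec k lam)

variable {k lam}

omit [CharZero k] in
theorem lUnit_mem {i j : Idx n} (h : pos i = pos j) :
    lUnit k i j h ∈ (lPr k n).toAlg.gr (par i + par j) := unit_mem i j

omit [CharZero k] in
theorem eq_smul_oneVec (m : oneDim k lam) : ∃ c : k, m = c • oneVec k lam :=
  ⟨(m : k), (mul_one (M := k) m).symm⟩

theorem vermaVec_mem : vermaVec k lam ∈ (vermaO k lam).gr (wtPar lam) := by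
  change indMk _ _ _ _ ∈ indGr _ _ (wtPar lam + wtPar lam)
  -- The generator is even before the shift; the two copies of its parity cancel modulo 2.
  rw [CharTwo.add_self_eq_zero]
  refine Submodule.subset_span ⟨0, 0, rfl, 1, ?_, oneVec k lam, ?_, rfl⟩
  · rw [UEA.mem_gr]; simp
  · change (1 : k) ∈ (if (0 : ZMod 2) = 0 then (⊤ : Submodule k k) else ⊥)
    simp

theorem verma_act_bO {A : Mat k n} (hA : A ∈ (bO k n).S) :
    (vermaO k lam).act ⟨A, bO_le_lPr k n hA⟩ (vermaVec k lam) =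
      wtFun lam A • vermaVec k lam := by
  let f := (bO k n).inclLE (lPr k n) (bO_le_lPr k n)
  let p : (bO k n).toAlg := ⟨A, hA⟩
  have e : (oneDim k lam).act p (oneVec k lam) = wtFun lam A • oneVec k lam := rfl
  have h : UEA.ι (lPr k n).toAlg (f.toLin p) • indMk f (oneDim k lam) 1 (oneVec k lam) =
      wtFun lam A • indMk f (oneDim k lam) 1 (oneVec k lam) := by
    rw [smul_indMk, mul_one, indMk_ι f (oneDim k lam) p, e, map_smul]
  exact h

theorem verma_eq_top {S : Submodule k (vermaO k lam)} (h0 : vermaVec k lam ∈ S)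
    (h : ∀ x, ∀ w ∈ S, (vermaO k lam).act x w ∈ S) : S = ⊤ :=
  ind_eq_top_of_stable _ (oneDim k lam) eq_smul_oneVec S h0 h

theorem wtFun_unit (i j : Idx n) :
    wtFun (k := k) lam (unit k i j) = if i = j then (lam i : k) else 0 := by
  rw [wtFun_apply]
  split_ifs with h
  · subst h
    rw [Finset.sum_eq_single i]
    · simp [unit]
    · intro j _ hj; simp [unit, hj.symm]
    · simp
  · refine Finset.sum_eq_zero fun a _ => ?_
    rw [unit, Matrix.single_apply_of_ne, mul_zero]
    rintro ⟨rfl, rfl⟩; exact h rfl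

theorem verma_act_diag (i : Idx n) :
    (vermaO k lam).act (lUnit k i i rfl) (vermaVec k lam) =
      (lam i : k) • vermaVec k lam := by
  have := verma_act_bO (k := k) (lam := lam) (unit_mem_supp (k := k) (i := i) (j := i) (Or.inl rfl))
  rw [wtFun_unit, if_pos rfl] at this
  exact this

theorem verma_act_raise (a : Fin n) :
    (vermaO k lam).act (lUnit k (Sum.inl a) (Sum.inr a) rfl) (vermaVec k lam) =
      0 := by
  have := verma_act_bO (k := k) (lam := lam)
    (unit_mem_supp (k := k) (i := Sum.inl a) (j := Sum.inr a) (Or.inr ⟨a, rfl, rfl⟩))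
  rw [wtFun_unit, if_neg (by simp), zero_smul] at this
  exact this

theorem pos_cases {i j : Idx n} (h : pos i = pos j) :
    i = j ∨ (∃ a, i = Sum.inl a ∧ j = Sum.inr a) ∨ ∃ a, i = Sum.inr a ∧ j = Sum.inl a := by
  rcases i with i | i <;> rcases j with j | j <;> simp_all [pos]

omit [CharZero k] in
theorem lUnit_br {i j a b : Idx n} (h : pos i = pos j) (h' : pos a = pos b) :
    (((lPr k n).toAlg.br (lUnit k i j h) (lUnit k a b h') : (lPr k n).toAlg) : (lPr k n).S).1 =
      (if j = a then unit k i b else 0) -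
      sgn (par i + par j) (par a + par b) • (if b = i then unit k a j else 0) :=
  superBr_unit i j a b

omit [CharZero k] in
theorem lUnit_br_diag_lower (i : Idx n) (a : Fin n) :
    ∃ c : k, (lPr k n).toAlg.br (lUnit k i i rfl) (lUnit k (Sum.inr a) (Sum.inl a) rfl) =
      c • lUnit k (Sum.inr a) (Sum.inl a) rfl := by
  refine ⟨(if i = Sum.inr a then 1 else 0) - (if i = Sum.inl a then 1 else 0),
    Subtype.ext ((lUnit_br _ _).trans ?_)⟩
  change _ = _ • unit k (Sum.inr a) (Sum.inl a)
  have hp : par i + par i = 0 := CharTwo.add_self_eq_zero _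
  rcases eq_or_ne i (Sum.inr a) with rfl | h1
  · simp [hp]
  · rcases eq_or_ne i (Sum.inl a) with rfl | h2
    · simp [hp]
    · simp [h1, h2, h2.symm]

omit [CharZero k] in
theorem lUnit_br_raise_lower (b a : Fin n) :
    (lPr k n).toAlg.br (lUnit k (Sum.inl b) (Sum.inr b) rfl)
      (lUnit k (Sum.inr a) (Sum.inl a) rfl) =
      if b = a then lUnit k (Sum.inl a) (Sum.inl a) rfl + lUnit k (Sum.inr a) (Sum.inr a) rfl
      else 0 := by
  refine Subtype.ext ((lUnit_br _ _).trans ?_)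
  rcases eq_or_ne b a with rfl | h
  · simp only [if_true]
    change _ = unit k _ _ + unit k _ _
    simp [par, add_comm]
  · rw [if_neg (by simpa using h), if_neg (by simpa using h.symm), if_neg h, smul_zero, sub_zero]
    rfl

variable (k n) in
/-- The element `∑ e_{i,i}`, `1 ≤ i ≤ n`, of the Cartan subalgebra. -/
def heightElt : (lPr k n).toAlg := ∑ a : Fin n, lUnit k (Sum.inl a) (Sum.inl a) rfl

/-- The operator by which the height of weights below the highest weight is measured. -/
def heightOp (k : Type u) [Field k] [CharZero k] (lam : Weight n) :
    Module.End k (vermaO k lam) :=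
  (vermaO k lam).act (heightElt k n) - (∑ a : Fin n, (lam (Sum.inl a) : k)) • LinearMap.id

theorem heightOp_vec : heightOp k lam (vermaVec k lam) = 0 := by
  simp only [heightOp, heightElt, map_sum, LinearMap.sub_apply, LinearMap.sum_apply,
    verma_act_diag, LinearMap.smul_apply, LinearMap.id_apply, Finset.sum_smul, sub_self]

omit [CharZero k] in
theorem heightElt_br (a : Fin n) :
    (lPr k n).toAlg.br (heightElt k n) (lUnit k (Sum.inr a) (Sum.inl a) rfl) =
      -lUnit k (Sum.inr a) (Sum.inl a) rfl := by
  rw [heightElt, map_sum, LinearMap.sum_apply, Finset.sum_eq_single a]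
  · refine Subtype.ext ((lUnit_br _ _).trans ?_)
    change _ = -unit k _ _
    simp [par]
  · intro b _ hb
    refine Subtype.ext ((lUnit_br _ _).trans ?_)
    change _ = (0 : Mat k n)
    simp [hb.symm]
  · simp

omit [CharZero k] in
theorem heightElt_mem : heightElt k n ∈ (lPr k n).toAlg.gr 0 :=
  sum_mem fun a _ => by
    have h : lUnit k (Sum.inl a) (Sum.inl a) rfl ∈ (lPr k n).toAlg.gr (0 + 0) :=
      lUnit_mem (i := Sum.inl a) (j := Sum.inl a) rfl
    rwa [add_zero] at h

/-- Each e_{n+a,a} lowers the eigenvalue of the height by one, so the highest weight vector spans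
the part of height zero and everything else lies where the height operator is invertible. -/
theorem verma_sup : Submodule.span k {vermaVec k lam} ⊔ coprimePart (heightOp k lam) = ⊤ := by
  refine sup_coprimePart_eq_top
    (S0 := {T | ∃ i : Idx n, T = (vermaO k lam).act (lUnit k i i rfl)})
    (Sm := {T | ∃ a : Fin n, T =
      (vermaO k lam).act (lUnit k (Sum.inr a) (Sum.inl a) rfl)})
    (Sp := {T | ∃ a : Fin n, T =
      (vermaO k lam).act (lUnit k (Sum.inl a) (Sum.inr a) rfl)})
    ?_ ?_ ?_ ?_ ?_ ?_ ?_
  · rintro _ ⟨i, rfl⟩ w hw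
    obtain ⟨c, rfl⟩ := Submodule.mem_span_singleton.mp hw
    rw [map_smul, verma_act_diag]
    exact Submodule.smul_mem _ _ (Submodule.smul_mem _ _ (Submodule.mem_span_singleton_self _))
  · rintro _ ⟨i, rfl⟩ w hw
    obtain ⟨c, rfl⟩ := Submodule.mem_span_singleton.mp hw
    rw [map_smul, verma_act_raise, smul_zero]
  · rintro _ ⟨i, rfl⟩ _ ⟨a, rfl⟩
    refine ⟨_, ?_, _, (vermaO k lam).superComm_act (lUnit_mem _) (lUnit_mem _)⟩
    obtain ⟨c, hc⟩ := lUnit_br_diag_lower (k := k) i a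
    rw [hc, map_smul]
    exact Submodule.smul_mem _ _ (Submodule.subset_span ⟨a, rfl⟩)
  · rintro _ ⟨b, rfl⟩ _ ⟨a, rfl⟩
    refine ⟨_, ?_, _, (vermaO k lam).superComm_act (lUnit_mem _) (lUnit_mem _)⟩
    rw [lUnit_br_raise_lower]
    split_ifs
    · rw [map_add]
      exact add_mem (Submodule.subset_span ⟨_, rfl⟩) (Submodule.subset_span ⟨_, rfl⟩)
    · rw [map_zero]; exact zero_mem _
  · rintro _ ⟨a, rfl⟩
    have h := (vermaO k lam).superComm_act heightElt_mem (lUnit_mem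
      (i := Sum.inr a) (j := Sum.inl a) rfl)
    rw [heightElt_br, map_neg, sgn_zero_left] at h
    refine (h.sub_left (Commute.superComm ?_)).of_eq rfl (sub_zero _)
    exact (Commute.one_left _).smul_left _
  · intro w hw
    obtain ⟨c, rfl⟩ := Submodule.mem_span_singleton.mp hw
    rw [map_smul, heightOp_vec, smul_zero]
  · intro S hS h
    refine verma_eq_top (hS (Submodule.mem_span_singleton_self _)) fun x w hw => ?_
    refine map_mem_of_unit ((vermaO k lam).act.flip w) S (fun i j hij => ?_) x
    rcases pos_cases hij with rfl | ⟨a, rfl, rfl⟩ | ⟨a, rfl, rfl⟩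
    · exact h _ (Or.inl ⟨i, rfl⟩) w hw
    · exact h _ (Or.inr (Or.inr ⟨a, rfl⟩)) w hw
    · exact h _ (Or.inr (Or.inl ⟨a, rfl⟩)) w hw

/-- Let w = c v + κ lie in a proper submodule, where v is the highest weight vector and p(H) κ = 0
with p(0) ≠ 0. Applying p(H) puts c p(0) v into the submodule, which does not contain v, so c = 0.
The bound passes to sums, whereas properness alone would not. -/
theorem sumProper_le_coprimePart : (vermaO k lam).sumProper ≤ coprimePart (heightOp k lam) := by
  refine sSup_le fun N ⟨hN, hN'⟩ w hw => ?_
  have hv : vermaVec k lam ∉ N := fun h => hN' (verma_eq_top h hN.invariant)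
  obtain ⟨u, hu, κ, hκ, rfl⟩ := Submodule.mem_sup.mp
    (verma_sup (k := k) (lam := lam) ▸ Submodule.mem_top : w ∈ _)
  obtain ⟨c, rfl⟩ := Submodule.mem_span_singleton.mp hu
  obtain ⟨p, hp, h⟩ := hκ
  have hinv : ∀ x ∈ N, heightOp k lam x ∈ N := fun x hx =>
    sub_mem (hN.invariant _ x hx) (N.smul_mem _ hx)
  have hpN : ∀ x ∈ N, Polynomial.aeval (heightOp k lam) p x ∈ N := fun x hx =>
    Polynomial.aeval_apply_smul_mem_of_le_comap hx p _ hinv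
  have := hpN _ hw
  rw [map_add, h, add_zero, map_smul, aeval_of_apply_eq_zero heightOp_vec, smul_smul] at this
  rcases eq_or_ne c 0 with rfl | hc
  · rw [zero_smul, zero_add]; exact ⟨p, hp, h⟩
  · exact absurd ((N.smul_mem_iff (mul_ne_zero hc hp)).mp this) hv

end Verma

/-! ### Maximal atypicality and one-dimensionality. -/

section LO

variable {k : Type u} [Field k] {n : ℕ} {lam : Weight n}

theorem lPr_mul_apply {A B : Mat k n} (hA : A ∈ (lPr k n).S) {i j : Idx n} {a : Fin n}
    (hi : pos i = a) : (A * B) i j =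
      A i (Sum.inl a) * B (Sum.inl a) j + A i (Sum.inr a) * B (Sum.inr a) j := by
  have h : ∀ b, b ≠ a → ∀ l : Idx n, pos l = b → A i l = 0 := fun b hb l hl =>
    hA i l fun e => hb (hl.symm.trans (e.symm.trans hi))
  rw [Matrix.mul_apply, Fintype.sum_sum_type]
  congr 1
  · exact Finset.sum_eq_single a (fun b _ hb => by rw [h b hb (Sum.inl b) rfl, zero_mul]) (by simp)
  · exact Finset.sum_eq_single a (fun b _ hb => by rw [h b hb (Sum.inr b) rfl, zero_mul]) (by simp)

/-- Under the hypothesis λ is a multiple of the supertrace on each summand gl(1|1), and the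
supertrace vanishes on supercommutators. -/
theorem wtFun_br_lPr (h : ∀ i, lam (Sum.inl i) + lam (Sum.inr i) = 0) {p q : ZMod 2} {A B : Mat k n}
    (hA : A ∈ glGr k n p) (hB : B ∈ glGr k n q) (hA' : A ∈ (lPr k n).S) (hB' : B ∈ (lPr k n).S) :
    wtFun (k := k) lam (superBr A B) = 0 := by
  rw [wtFun_apply, Fintype.sum_sum_type, ← Finset.sum_add_distrib]
  refine Finset.sum_eq_zero fun a _ => ?_
  have hl : (lam (Sum.inr a) : k) = -(lam (Sum.inl a) : k) := by
    have := congrArg (Int.cast : ℤ → k) (h a)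
    push_cast at this
    exact eq_neg_of_add_eq_zero_right this
  rw [hl, superBr_homog hA hB]
  simp only [Matrix.sub_apply, Matrix.smul_apply,
    lPr_mul_apply hA' (i := Sum.inl a) (a := a) rfl,
    lPr_mul_apply hA' (i := Sum.inr a) (a := a) rfl,
    lPr_mul_apply hB' (i := Sum.inl a) (a := a) rfl,
    lPr_mul_apply hB' (i := Sum.inr a) (a := a) rfl]
  rcases zmod2_cases p with rfl | rfl
  · rw [hA (Sum.inl a) (Sum.inr a) (by simp [par]), hA (Sum.inr a) (Sum.inl a) (by simp [par])]
    simp only [sgn_zero_left, one_smul]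
    ring
  · rw [hA (Sum.inl a) (Sum.inl a) (by simp [par]), hA (Sum.inr a) (Sum.inr a) (by simp [par])]
    rcases zmod2_cases q with rfl | rfl
    · rw [hB (Sum.inl a) (Sum.inr a) (by simp [par]), hB (Sum.inr a) (Sum.inl a) (by simp [par])]
      simp
    · rw [hB (Sum.inl a) (Sum.inl a) (by simp [par]), hB (Sum.inr a) (Sum.inr a) (by simp [par])]
      simp only [sgn_one_one, neg_smul, one_smul]
      ring

variable (k lam) in
/-- The linear functional on `l_pr` defined by a weight. -/
def lWt : (lPr k n).toAlg →ₗ[k] k := wtFun lam ∘ₗ (lPr k n).S.subtype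

theorem lWt_odd {x : (lPr k n).toAlg} (hx : x ∈ (lPr k n).toAlg.gr 1) : lWt k lam x = 0 :=
  wtFun_odd lam hx

theorem lWt_br (h : ∀ i, lam (Sum.inl i) + lam (Sum.inr i) = 0)
    {p q : ZMod 2} {x y : (lPr k n).toAlg} (hx : x ∈ (lPr k n).toAlg.gr p)
    (hy : y ∈ (lPr k n).toAlg.gr q) :
    (Algebra.linearMap k (Module.End k k) ∘ₗ lWt k lam) ((lPr k n).toAlg.br x y) =
      (Algebra.linearMap k (Module.End k k) ∘ₗ lWt k lam) x *
        (Algebra.linearMap k (Module.End k k) ∘ₗ lWt k lam) y -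
      sgn p q • ((Algebra.linearMap k (Module.End k k) ∘ₗ lWt k lam) y *
        (Algebra.linearMap k (Module.End k k) ∘ₗ lWt k lam) x) := by
  have h0 : lWt k lam ((lPr k n).toAlg.br x y) = 0 := wtFun_br_lPr h hx hy x.2 y.2
  simp only [LinearMap.comp_apply, Algebra.linearMap_apply, h0, map_zero]
  rcases zmod2_cases p with rfl | rfl
  · rw [sgn_zero_left, one_smul, Algebra.commutes, sub_self]
  · rw [lWt_odd hx]; simp

/-- The character of `U(l_pr)` defined by a weight of maximal atypicality. -/
def lChar (h : ∀ i, lam (Sum.inl i) + lam (Sum.inr i) = 0) :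
    UEA (lPr k n).toAlg →ₐ[k] Module.End k k :=
  UEA.lift _ (Algebra.linearMap k (Module.End k k) ∘ₗ lWt k lam) (lWt_br h)

theorem lChar_ι (h : ∀ i, lam (Sum.inl i) + lam (Sum.inr i) = 0) (x : (lPr k n).toAlg) (t : k) :
    lChar h (UEA.ι (lPr k n).toAlg x) t = lWt k lam x * t := by
  rw [lChar, UEA.lift_ι]
  simp

/-- The parity automorphism only changes signs of odd generators, and the character is zero on
those. -/
theorem lChar_parity (h : ∀ i, lam (Sum.inl i) + lam (Sum.inr i) = 0)
    (a : UEA (lPr k n).toAlg) : lChar h (UEA.parity _ a) = lChar h a := by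
  have : (lChar h).comp (UEA.parity (lPr k n).toAlg) = lChar h := UEA.hom_ext _ fun x => by
    rw [AlgHom.comp_apply, UEA.parity_ι]
    obtain ⟨y, hy, z, hz, rfl⟩ := exists_decomp (lPr k n).toAlg.isCompl x
    have hz0 : lChar h (UEA.ι (lPr k n).toAlg z) = 0 := LinearMap.ext fun t => by
      refine (lChar_ι h z t).trans ?_
      rw [lWt_odd hz, zero_mul]; rfl
    rw [map_add, parityOp_apply _ hy, parityOp_apply _ hz, sgn_zero_right, sgn_one_one, one_smul]
    simp only [neg_smul, one_smul, map_add, map_neg, hz0, neg_zero]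
  exact DFunLike.congr_fun this a

variable [CharZero k]

/-- The map from the Verma module onto its one-dimensional quotient. -/
def vermaFun (h : ∀ i, lam (Sum.inl i) + lam (Sum.inr i) = 0) : vermaO k lam →ₗ[k] k :=
  indLift ((bO k n).inclLE (lPr k n) (bO_le_lPr k n)) (oneDim k lam) (lChar h)
    (LinearMap.id : k →ₗ[k] k) (fun _ (m : k) => lChar_ι (k := k) h _ m)

variable (h : ∀ i, lam (Sum.inl i) + lam (Sum.inr i) = 0)

theorem vermaFun_vec : vermaFun h (vermaVec k lam) = 1 := by
  exact DFunLike.congr_fun (map_one (lChar h)) (1 : k)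

theorem vermaFun_act (x : (lPr k n).toAlg) (w : vermaO k lam) :
    vermaFun h ((vermaO k lam).act x w) = lWt k lam x * vermaFun h w :=
  (indLift_smul ((bO k n).inclLE (lPr k n) (bO_le_lPr k n)) (oneDim k lam) (lChar h)
    (LinearMap.id : k →ₗ[k] k) (fun _ (m : k) => lChar_ι (k := k) h _ m)
    (UEA.ι (lPr k n).toAlg x) w).trans (lChar_ι h x _)

/-- The functional is even relative to the parity of the highest weight vector; this is what makes
its kernel a graded submodule. -/
theorem vermaFun_odd {w : vermaO k lam} (hw : w ∈ (vermaO k lam).gr (1 + wtPar lam)) :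
    vermaFun h w = 0 := by
  change w ∈ indGr _ _ (1 + wtPar lam + wtPar lam) at hw
  rw [add_assoc, CharTwo.add_self_eq_zero, add_zero] at hw
  induction hw using Submodule.span_induction with
  | mem v hv =>
    obtain ⟨p, q, hpq, a, ha, m, hm, rfl⟩ := hv
    refine (indLift_mk ((bO k n).inclLE (lPr k n) (bO_le_lPr k n)) (oneDim k lam) (lChar h)
      (LinearMap.id : k →ₗ[k] k)
      (fun _ (m : k) => lChar_ι (k := k) h _ m) a m).trans ?_
    rcases zmod2_cases q with rfl | rfl
    · rw [add_zero] at hpq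
      subst hpq
      rw [UEA.mem_gr] at ha
      have e := lChar_parity h a
      rw [ha, map_zsmul] at e
      -- For odd a, invariance under parity makes the value equal to its own negative.
      have e2 : lChar h a = 0 := by
        simp only [sgn_one_one, neg_smul, one_smul] at e
        have h2 : (2 : k) • lChar h a = 0 := by
          rw [two_smul]; nth_rewrite 1 [← e]; exact neg_add_cancel _
        exact (smul_eq_zero.mp h2).resolve_left two_ne_zero
      rw [e2]; rfl
    · have hm0 : m = 0 := by
        change m ∈ (if (1 : ZMod 2) = 0 then (⊤ : Submodule k k) else ⊥) at hm
        rw [if_neg one_ne_zero] at hm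
        exact (Submodule.mem_bot k).mp hm
      rw [hm0]
      exact map_zero (lChar h a)
  | zero => exact map_zero _
  | add s t _ _ hs ht => exact (map_add (vermaFun h) s t).trans (by rw [hs, ht, add_zero])
  | smul c t _ ht => exact (map_smul (vermaFun h) c t).trans (by rw [ht, smul_zero])

theorem ker_vermaFun_isSub : (vermaO k lam).IsSub (LinearMap.ker (vermaFun h)) := by
  constructor
  · intro v hv
    obtain ⟨a, ha, b, hb, rfl⟩ := exists_decomp (vermaO k lam).isCompl v
    rw [LinearMap.mem_ker, map_add] at hv
    have hab : vermaFun h a = 0 ∧ vermaFun h b = 0 := by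
      rcases zmod2_cases (wtPar lam) with e | e
      · have := vermaFun_odd h (w := b) (by rw [e]; exact hb)
        rw [this, add_zero] at hv
        exact ⟨hv, this⟩
      · have := vermaFun_odd h (w := a) (by rw [e]; exact ha)
        rw [this, zero_add] at hv
        exact ⟨this, hv⟩
    exact ⟨a, ha, b, hb, hab.1, hab.2, rfl⟩
  · intro x v hv
    rw [LinearMap.mem_ker] at hv ⊢
    exact (vermaFun_act h x v).trans (by rw [hv, mul_zero])

/-- A vector of height zero in `coprimePart` is zero, but the highest weight vector is nonzero
because `vermaFun` sends it to 1. -/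
theorem vermaVec_notMem (h : ∀ i, lam (Sum.inl i) + lam (Sum.inr i) = 0) :
    vermaVec k lam ∉ (vermaO k lam).sumProper := fun hv => by
  have := eq_zero_of_mem_coprimePart heightOp_vec (sumProper_le_coprimePart hv)
  have h1 := vermaFun_vec (k := k) h
  rw [this, map_zero] at h1
  exact zero_ne_one h1

theorem ker_vermaFun_le : LinearMap.ker (vermaFun h) ≤ (vermaO k lam).sumProper := by
  refine le_sSup ⟨ker_vermaFun_isSub h, fun e => ?_⟩
  have : vermaVec k lam ∈ LinearMap.ker (vermaFun h) := e ▸ Submodule.mem_top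
  rw [LinearMap.mem_ker, vermaFun_vec] at this
  exact one_ne_zero this

variable (k lam) in
/-- The projection of the Verma module onto `L^o(lam)`. -/
def loMk : vermaO k lam →ₗ[k] LO k lam := (vermaO k lam).sumProper.mkQ

omit h in
theorem loMk_eq_zero {w : vermaO k lam} : loMk k lam w = 0 ↔ w ∈ (vermaO k lam).sumProper :=
  Submodule.Quotient.mk_eq_zero _

variable (k lam) in
/-- The highest weight vector of `L^o(lam)`. -/
def loVec : LO k lam := loMk k lam (vermaVec k lam)

theorem loVec_mem : loVec k lam ∈ (LO k lam).gr (wtPar lam) :=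
  ⟨_, vermaVec_mem, rfl⟩

theorem lo_act_mk (x : (lPr k n).toAlg) (w : vermaO k lam) :
    (LO k lam).act x (loMk k lam w) = loMk k lam ((vermaO k lam).act x w) := rfl

include h in
theorem loVec_ne_zero : loVec k lam ≠ 0 :=
  fun e => vermaVec_notMem (k := k) h (loMk_eq_zero.mp e)

include h in
theorem lo_eq_smul (w : LO k lam) : ∃ c : k, w = c • loVec k lam := by
  obtain ⟨w, rfl⟩ : ∃ w', loMk k lam w' = w := Submodule.mkQ_surjective _ w
  refine ⟨vermaFun h w, ?_⟩
  rw [loVec, ← map_smul, ← sub_eq_zero, ← map_sub, loMk_eq_zero]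
  refine ker_vermaFun_le h ?_
  rw [LinearMap.mem_ker, map_sub, map_smul, vermaFun_vec, smul_eq_mul, mul_one, sub_self]

include h in
theorem lo_act (x : (lPr k n).toAlg) :
    (LO k lam).act x (loVec k lam) = lWt k lam x • loVec k lam := by
  rw [loVec, lo_act_mk, ← map_smul, ← sub_eq_zero, ← map_sub, loMk_eq_zero]
  refine ker_vermaFun_le h ?_
  rw [LinearMap.mem_ker, map_sub, map_smul, vermaFun_act, vermaFun_vec, smul_eq_mul, sub_self]

include h in
theorem finrank_lo : Module.finrank k (LO k lam) = 1 :=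
  finrank_eq_one (loVec k lam) (loVec_ne_zero h) fun w => by
    obtain ⟨c, hc⟩ := lo_eq_smul h w
    exact ⟨c, hc.symm⟩

/-- With e = e_{i,n+i} and f = e_{n+i,i}, both kill the highest weight vector, while [e, f] =
e_{i,i} + e_{n+i,n+i} acts on it by a_i + b_i. -/
theorem atypical_of_finrank_lo (hr : Module.finrank k (LO k lam) = 1) (i : Fin n) :
    lam (Sum.inl i) + lam (Sum.inr i) = 0 := by
  -- If the generator vanished in the quotient, the sum of proper submodules would be everything and
  -- the quotient would have dimension 0.
  have hv : loVec k lam ≠ 0 := fun e => by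
    have hmem : vermaVec k lam ∈ (vermaO k lam).sumProper :=
      loMk_eq_zero.mp e
    have htop := verma_eq_top hmem (vermaO k lam).sumProper_isSub.invariant
    have : Subsingleton (LO k lam) := Submodule.Quotient.subsingleton_iff.mpr htop
    rw [Module.finrank_zero_of_subsingleton] at hr
    exact zero_ne_one hr
  let M := LO k lam
  let e := lUnit k (Sum.inl i : Idx n) (Sum.inr i) rfl
  let f := lUnit k (Sum.inr i : Idx n) (Sum.inl i) rfl
  have he : M.act e (loVec k lam) = 0 := by
    change (LO k lam).act e (loVec k lam) = 0
    rw [loVec, lo_act_mk, verma_act_raise]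
    exact map_zero _
  -- In dimension one this vector is a multiple of the highest weight vector, yet it has the
  -- opposite parity.
  have hf : M.act f (loVec k lam) = 0 := by
    obtain ⟨c, hc⟩ := exists_smul_eq_of_finrank_eq_one hr hv (M.act f (loVec k lam))
    have h1 : M.act f (loVec k lam) ∈ M.gr (1 + wtPar lam) :=
      M.act_mem (p := 1) (lUnit_mem (i := (Sum.inr i : Idx n)) (j := Sum.inl i) rfl) loVec_mem
    have h2 : M.act f (loVec k lam) ∈ M.gr (wtPar lam) :=
      hc ▸ Submodule.smul_mem _ c loVec_mem
    rcases zmod2_cases (wtPar lam) with e | e <;> rw [e] at h1 h2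
    · exact Submodule.disjoint_def.mp M.isCompl.disjoint _ h2 h1
    · exact Submodule.disjoint_def.mp M.isCompl.disjoint _ h1 h2
  have hbr := DFunLike.congr_fun (M.superComm_act (lUnit_mem (k := k) (i := (Sum.inl i : Idx n))
    (j := Sum.inr i) rfl) (lUnit_mem (i := (Sum.inr i : Idx n)) (j := Sum.inl i) rfl))
    (loVec k lam)
  rw [lUnit_br_raise_lower, if_pos rfl] at hbr
  have hd : ∀ j, M.act (lUnit k j j rfl) (loVec k lam) = (lam j : k) • loVec k lam := fun j => by
    change (LO k lam).act _ (loVec k lam) = _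
    rw [loVec, lo_act_mk, verma_act_diag]
    exact map_smul _ _ _
  change M.act e (M.act f (loVec k lam)) = M.act _ (loVec k lam) +
    (_ : ℤ) • M.act f (M.act e (loVec k lam)) at hbr
  rw [he, hf, map_zero, map_zero, smul_zero, add_zero, map_add, LinearMap.add_apply, hd, hd,
    ← add_smul] at hbr
  have := (smul_eq_zero.mp hbr.symm).resolve_right hv
  exact_mod_cast this

theorem mem_LambdaMaBG_iff_finrank :
    lam ∈ LambdaMaBG n ↔ Module.finrank k (LO k lam) = 1 :=
  ⟨fun h => finrank_lo (mem_LambdaMaBG.mp h),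
    fun h => mem_LambdaMaBG.mpr (atypical_of_finrank_lo h)⟩

end LO

/-! ## Modules induced from one-dimensional modules -/

section IndOneDim

variable {k : Type u} [Field k] [CharZero k] {P G : LieSuperalg k} (f : LieSuperalg.Hom P G)
  (M : SuperMod P) {m₀ : M} {χ : P → k}

theorem ind_act_of_char (hχ : ∀ p, M.act p m₀ = χ p • m₀) (p : P) :
    (Ind f M).act (f.toLin p) (indMk f M 1 m₀) = χ p • (indMk f M 1 m₀ : Ind f M) := by
  change UEA.ι G (f.toLin p) • indMk f M 1 m₀ = χ p • indMk f M 1 m₀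
  rw [smul_indMk, mul_one, indMk_ι f M p, hχ, map_smul]

/-- When the inducing module is a line with character χ, a map out of the induced module amounts to
a vector on which P acts by χ. -/
theorem exists_ind_lift {C : Type*} [AddCommGroup C] [Module k C] (hm : ∀ m : M, ∃ c : k, m = c • m₀)
    (h0 : m₀ ≠ 0) (hχ : ∀ p, M.act p m₀ = χ p • m₀) (φ : UEA G →ₐ[k] Module.End k C) {c : C}
    (hc : ∀ p, φ (UEA.ι G (f.toLin p)) c = χ p • c) :
    ∃ Ψ : Ind f M →ₗ[k] C, Ψ (indMk f M 1 m₀) = c ∧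
      ∀ x w, Ψ ((Ind f M).act x w) = φ (UEA.ι G x) (Ψ w) := by
  let e : k ≃ₗ[k] M := LinearEquiv.ofBijective (LinearMap.toSpanSingleton k _ m₀)
    ⟨smul_left_injective k h0, fun w => by
      obtain ⟨c, hc⟩ := hm w
      exact ⟨c, hc.symm⟩⟩
  let g : M →ₗ[k] C := LinearMap.toSpanSingleton k C c ∘ₗ e.symm.toLinearMap
  have he : e.symm m₀ = 1 := by
    rw [LinearEquiv.symm_apply_eq]
    exact (one_smul k _).symm
  have hg : g m₀ = c := by
    change e.symm m₀ • c = c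
    rw [he, one_smul]
  have hφ : ∀ p m, φ (UEA.ι G (f.toLin p)) (g m) = g (M.act p m) := by
    intro p m
    obtain ⟨t, rfl⟩ := hm m
    rw [map_smul g, map_smul, hg, hc, map_smul, hχ, map_smul, map_smul, hg]
  refine ⟨indLift f M φ g hφ, ?_, fun x w => indLift_smul f M φ g hφ (UEA.ι G x) w⟩
  refine (indLift_mk f M φ g hφ 1 m₀).trans ?_
  rw [map_one]; exact hg

end IndOneDim

/-! ## Brundan--Goodwin modules of maximal atypicality -/

section BG

variable {k : Type u} [Field k] {n : ℕ} {lam : Weight n}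

theorem SuperMod.act_eq_sum (M : SuperMod (gl k n)) (A : Mat k n) (w : M) :
    M.act A w = ∑ i, ∑ j, A i j • M.act (unit k i j) w := by
  have : M.act A = ∑ i, ∑ j, A i j • M.act (unit k i j) := by
    conv_lhs => rw [eq_sum_unit A]
    simp only [map_sum, map_smul]
  rw [this]
  simp only [LinearMap.sum_apply, LinearMap.smul_apply]

theorem wtFun_degZero (A : Mat k n) : wtFun lam (degZero A) = wtFun lam A := by
  simp [wtFun_apply, degZero_apply]

variable (k lam) in
/-- The linear functional on `p_pr` defined by a weight. -/
def pWt : (pPr k n).toAlg →ₗ[k] k := wtFun lam ∘ₗ (pPr k n).S.subtype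

variable (k n) in
/-- The matrix units of `p_pr`. -/
def pUnit {i j : Idx n} (h : pos i ≤ pos j) : (pPr k n).toAlg := ⟨unit k i j, unit_mem_supp h⟩

variable [CharZero k]

theorem pWt_pUnit {i j : Idx n} (h : pos i ≤ pos j) :
    pWt k lam (pUnit k n h) = if i = j then (lam i : k) else 0 := wtFun_unit i j

variable (k lam) in
/-- The inflation of `L^o(lam)` to `p_pr`. -/
def infl : SuperMod (pPr k n).toAlg := (LO k lam).pullback (pToL k n)

variable (k lam) in
/-- The highest weight vector of the inflation of `L^o(lam)`. -/
def inflVec : infl k lam := loVec k lam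

variable (k lam) in
/-- The highest weight vector of `BG(lam)`. -/
def bgVec : BG k lam := indMk (pPr k n).incl (infl k lam) 1 (inflVec k lam)

theorem bgVec_mem : bgVec k lam ∈ (BG k lam).gr (wtPar lam) := by
  refine Submodule.subset_span
    (s := {v | ∃ p q : ZMod 2, p + q = wtPar lam ∧ ∃ a ∈ UEA.gr (gl k n) p,
      ∃ m ∈ (infl k lam).gr q, v = indMk (pPr k n).incl (infl k lam) a m})
    ⟨0, wtPar lam, zero_add _, 1, ?_, inflVec k lam, loVec_mem, rfl⟩
  rw [UEA.mem_gr]; simp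

variable (h : ∀ i, lam (Sum.inl i) + lam (Sum.inr i) = 0)

include h in
theorem infl_act (x : (pPr k n).toAlg) :
    (infl k lam).act x (inflVec k lam) = pWt k lam x • inflVec k lam := by
  have e : pWt k lam x = lWt k lam ((pToL k n).toLin x) := (wtFun_degZero _).symm
  rw [e]
  exact lo_act h ((pToL k n).toLin x)

include h in
theorem infl_eq_smul (w : infl k lam) : ∃ c : k, w = c • inflVec k lam := lo_eq_smul h w

include h in
-- Units of positive degree act by zero through the projection to l, and off-diagonal units of l are
-- odd, so the character kills them. In particular e_{n+i,i} also annihilates the generator.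
theorem bg_act_unit {i j : Idx n} (hij : pos i ≤ pos j) :
    (BG k lam).act (unit k i j) (bgVec k lam) = if i = j then (lam i : k) • bgVec k lam else 0 := by
  have := ind_act_of_char (pPr k n).incl (infl k lam) (infl_act h) (pUnit k n hij)
  rw [pWt_pUnit] at this
  refine Eq.trans this ?_
  split_ifs
  · rfl
  · exact zero_smul _ _

include h in
theorem bg_eq_top {S : Submodule k (BG k lam)} (h0 : bgVec k lam ∈ S)
    (hS : ∀ i j, ∀ w ∈ S, (BG k lam).act (unit k i j) w ∈ S) : S = ⊤ := by
  refine ind_eq_top_of_stable _ (infl k lam) (infl_eq_smul h) S h0 fun (x : Mat k n) (w : BG k lam) hw => ?_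
  change (BG k lam).act x w ∈ S
  rw [SuperMod.act_eq_sum]
  exact sum_mem fun i _ => sum_mem fun j _ => S.smul_mem _ (hS i j w hw)

include h in
/-- The universal property of `BG(lam)`. -/
theorem exists_bg_lift {C : Type u} [AddCommGroup C] [Module k C] {ρ : Idx n → Idx n → Module.End k C}
    (hρ : IsGlFamily par ρ) {c : C}
    (hc : ∀ i j, pos i ≤ pos j → ρ i j c = if i = j then (lam i : k) • c else 0) :
    ∃ Ψ : BG k lam →ₗ[k] C, Ψ (bgVec k lam) = c ∧
      ∀ i j w, Ψ ((BG k lam).act (unit k i j) w) = ρ i j (Ψ w) := by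
  have hx : ∀ x : supp k (fun i j : Idx n => pos i ≤ pos j),
      famLin (k := k) ρ x.1 c = wtFun lam x.1 • c := by
    intro x
    let T : supp k (fun i j : Idx n => pos i ≤ pos j) →ₗ[k] C :=
      ((LinearMap.applyₗ c) ∘ₗ famLin ρ - (wtFun lam).smulRight c) ∘ₗ Submodule.subtype _
    have hT : T x ∈ (⊥ : Submodule k C) := map_mem_of_unit T ⊥ (fun i j hij => by
      rw [Submodule.mem_bot]
      change famLin (k := k) ρ (unit k i j) c - wtFun lam (unit k i j) • c = 0
      rw [famLin_unit, hc i j hij, wtFun_unit]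
      split_ifs <;> simp) x
    exact sub_eq_zero.mp ((Submodule.mem_bot k).mp hT)
  obtain ⟨Ψ, h1, h2⟩ := exists_ind_lift (pPr k n).incl (infl k lam) (infl_eq_smul h)
    (loVec_ne_zero h) (infl_act h) (famHom (k := k) hρ) (c := c) (fun p => by
      rw [famHom_ι]; exact hx p)
  refine ⟨Ψ, h1, fun i j w => (h2 (unit k i j) w).trans ?_⟩
  rw [famHom_ι, famLin_unit]
  rfl

end BG

/-! ## The embedding of the smaller module -/

section Embedding

variable {k : Type u} [Field k] [CharZero k] {n : ℕ} {lam : Weight (n + 1)}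

theorem pos_sJ (a : Idx n) : pos (sJ a) = (pos a).succ := by
  rcases a with a | a <;> rfl

omit [CharZero k] in
theorem extJ_unit (a b : Idx n) : extJ k n (unit k a b) = unit k (sJ a) (sJ b) := by
  refine Matrix.ext fun i j => ?_
  rw [extJ_apply, Finset.sum_eq_single a, Finset.sum_eq_single b]
  · simp [unit, Matrix.single_apply]
  · intro d _ hd; simp [unit, hd.symm]
  · simp
  · intro c _ hc; simp [unit, hc.symm]
  · simp

theorem prJ_apply (a : Idx n) : prJ lam a = lam (sJ a) := rfl

theorem prJ_atypical (h : ∀ i, lam (Sum.inl i) + lam (Sum.inr i) = 0) (i : Fin n) :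
    prJ lam (Sum.inl i) + prJ lam (Sum.inr i) = 0 := h i.succ

/-- The enumeration of the indices of `gl(n+1|n+1)` by two copies of those of `gl(n|n)` and two new
ones. -/
def idxOption : Idx (n + 1) → Option (Option (Idx n)) :=
  Sum.elim (Fin.cases none fun a => some (some (Sum.inl a)))
    (Fin.cases (some none) fun a => some (some (Sum.inr a)))

theorem idxOption_inl : idxOption (n := n) (Sum.inl 0) = none := rfl
theorem idxOption_inr : idxOption (n := n) (Sum.inr 0) = some none := rfl
theorem idxOption_sJ (a : Idx n) : idxOption (sJ a) = some (some a) := by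
  rcases a with a | a <;> rfl

theorem idxOption_injective : Function.Injective (idxOption (n := n)) := by
  intro i j
  rcases idx_cases i with rfl | rfl | ⟨a, rfl⟩ <;> rcases idx_cases j with rfl | rfl | ⟨b, rfl⟩ <;>
    simp only [idxOption_inl, idxOption_inr, idxOption_sJ, reduceCtorEq, Option.some_inj,
      false_implies, imp_self]
  rintro rfl; rfl

omit [CharZero k] in
theorem isGlFamily_sJ (M : SuperMod (gl k (n + 1))) :
    IsGlFamily par (fun i j : Idx n => (M.act (unit k (sJ i) (sJ j)) : Module.End k M)) :=
  (isGlFamily_act M).comp sJ_inj fun i => (par_sJ i).symm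

/-- The map ψ exists by universality. It is injective because the Fock model over BG(pr_J λ)
receives a map Ψ from BG(λ) for which Ψ ∘ ψ is the inclusion of vacuum vectors. -/
theorem exists_embedding (h : ∀ i, lam (Sum.inl i) + lam (Sum.inr i) = 0) :
    ∃ ψ : BG k (prJ lam) →ₗ[k] BG k lam, ψ (bgVec k (prJ lam)) = bgVec k lam ∧
      (∀ a b w, ψ ((BG k (prJ lam)).act (unit k a b) w) =
        (BG k lam).act (unit k (sJ a) (sJ b)) (ψ w)) ∧ Function.Injective ψ := by
  obtain ⟨ψ, hψ, hψ'⟩ := exists_bg_lift (prJ_atypical h) (isGlFamily_sJ (BG k lam))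
    (c := bgVec k lam) (fun i j hij => by
      rw [bg_act_unit h (by rw [pos_sJ, pos_sJ]; exact Fin.succ_le_succ_iff.mpr hij)]
      simp only [sJ_inj.eq_iff, prJ_apply])
  refine ⟨ψ, hψ, hψ', ?_⟩
  let N := BG k (prJ lam)
  -- `Fock.family` always adds an even index. Shifting parities by one before and after the first
  -- extension makes its new index, n+1, odd and restores the parities of J. The second extension
  -- then adds the even index 1.
  let q : Idx n → ZMod 2 := fun i => par i + 1
  let q' : Option (Idx n) → ZMod 2 := fun i => i.elim 0 q + 1
  let ρ : Idx n → Idx n → Module.End k N := fun i j => N.act (unit k i j)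
  have hρ : IsGlFamily q ρ := (isGlFamily_act N).shift fun _ => rfl
  -- On the vacuum the new diagonal unit acts by this constant, so the two constants must be b_1
  -- here and a_1 in the next extension.
  let ρ₁ := Fock.family q ρ (lam (Sum.inr 0) : k)
  have hρ₁ : IsGlFamily q' ρ₁ := (Fock.isGlFamily_family hρ _).shift fun _ => rfl
  let ρ₂ := Fock.family q' ρ₁ (lam (Sum.inl 0) : k)
  have hρ₂ := Fock.isGlFamily_family hρ₁ (lam (Sum.inl 0) : k)
  have hρ₃ : IsGlFamily par (fun i j : Idx (n + 1) => ρ₂ (idxOption i) (idxOption j)) := by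
    refine hρ₂.comp idxOption_injective fun i => ?_
    rcases idx_cases i with rfl | rfl | ⟨a, rfl⟩
    · rfl
    · rfl
    · rw [idxOption_sJ, par_sJ]
      change par a = par a + 1 + 1
      rw [add_assoc, one_add_one_zmod2, add_zero]
  let v : N →ₗ[k] Fock.Space (Option (Idx n)) k (Fock.Space (Idx n) k N) := Fock.vac ∘ₗ Fock.vac
  have hsJ : ∀ a b w, ρ₂ (some (some a)) (some (some b)) (v w) = v (N.act (unit k a b) w) := by
    intro a b w
    refine (Fock.family_some_some _ _ _ _ _ _).trans ?_
    exact congrArg Fock.vac (Fock.family_some_some _ _ _ _ _ _)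
  obtain ⟨Ψ, hΨ, hΨ'⟩ := exists_bg_lift h hρ₃ (c := v (bgVec k (prJ lam))) (fun i j hij => by
    have hl : (lam (Sum.inr 0) : k) = -(lam (Sum.inl 0) : k) := by
      have := congrArg (Int.cast : ℤ → k) (h 0)
      push_cast at this
      exact eq_neg_of_add_eq_zero_right this
    rcases idx_cases i with rfl | rfl | ⟨a, rfl⟩
    · rcases idx_cases j with rfl | rfl | ⟨b, rfl⟩
      · rw [if_pos rfl]
        exact Fock.family_none_none _ _ _ _
      · rw [if_neg (by simp)]
        exact Fock.family_none_some _ _ _ _ _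
      · rw [if_neg (sJ_ne_inl b).symm, idxOption_sJ]
        exact Fock.family_none_some _ _ _ _ _
    · rcases idx_cases j with rfl | rfl | ⟨b, rfl⟩
      · rw [if_neg (by simp)]
        -- The unit e_{n+1,1} must kill the vacuum. It sends it to the odd variable with coefficient
        -- a_1 + b_1, which is zero by atypicality.
        refine Fock.family_some_none _ _ _ _ _ (by rfl) (fun j hj => ?_) ?_
        · rcases j with _ | j
          · exact absurd rfl hj
          · exact Fock.family_none_some _ _ _ _ _
        · rw [← hl]
          exact Fock.family_none_none _ _ _ _
      · rw [if_pos rfl]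
        refine (Fock.family_some_some _ _ _ _ _ _).trans ?_
        refine (congrArg Fock.vac (Fock.family_none_none _ _ _ _)).trans ?_
        exact map_smul _ _ _
      · rw [if_neg (sJ_ne_inr b).symm, idxOption_sJ]
        refine (Fock.family_some_some _ _ _ _ _ _).trans ?_
        refine (congrArg Fock.vac (Fock.family_none_some _ _ _ _ _)).trans ?_
        exact map_zero _
    · rcases idx_cases j with rfl | rfl | ⟨b, rfl⟩
      · rw [pos_sJ] at hij
        exact absurd hij (not_le.mpr (Fin.succ_pos _))
      · rw [pos_sJ] at hij
        exact absurd hij (not_le.mpr (Fin.succ_pos _))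
      · rw [pos_sJ, pos_sJ, Fin.succ_le_succ_iff] at hij
        rw [idxOption_sJ, idxOption_sJ, hsJ, bg_act_unit (prJ_atypical h) hij]
        simp only [sJ_inj.eq_iff, prJ_apply]
        split_ifs
        · exact map_smul _ _ _
        · exact map_zero _)
  -- Both maps are equivariant for gl(J) and agree on the generator.
  have key : LinearMap.eqLocus (Ψ ∘ₗ ψ) v = ⊤ := by
    refine bg_eq_top (prJ_atypical h) ?_ fun a b w hw => ?_
    · change Ψ (ψ _) = v _
      rw [hψ, hΨ]
    · change Ψ (ψ w) = v w at hw
      change Ψ (ψ _) = v _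
      rw [hψ', hΨ', hw, idxOption_sJ, idxOption_sJ, hsJ]
  have hv : Function.Injective v := Fock.vac_injective.comp Fock.vac_injective
  intro w w' hw
  have e : ∀ w, Ψ (ψ w) = v w := fun w => by
    have : w ∈ LinearMap.eqLocus (Ψ ∘ₗ ψ) v := key ▸ Submodule.mem_top
    exact this
  exact hv (by rw [← e, ← e, hw])

end Embedding

/-! ## Parity -/

section Parity

variable {k : Type u} [Field k]

/-- Turns membership in a graded component into an eigenvalue equation for a linear operator, which
can be checked by cyclicity on the generator. -/
theorem mem_gr_of_parityOp [CharZero k] {V : Type u} [AddCommGroup V] [Module k V]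
    {gr : ZMod 2 → Submodule k V} (h : IsCompl (gr 0) (gr 1)) {q : ZMod 2} {v : V}
    (hv : parityOp gr h v = sgn 1 q • v) : v ∈ gr q := by
  obtain ⟨a, ha, b, hb, rfl⟩ := exists_decomp h v
  rw [map_add, parityOp_apply h ha, parityOp_apply h hb] at hv
  have h2 : ∀ x : V, x = -x → x = 0 := fun x hx =>
    (smul_eq_zero.mp (by rw [two_smul]; nth_rewrite 1 [hx]; exact neg_add_cancel x :
      (2 : k) • x = 0)).resolve_left two_ne_zero
  rcases zmod2_cases q with rfl | rfl
  · simp only [sgn_zero_right, sgn_one_one, one_smul, neg_smul, add_right_inj] at hv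
    rw [h2 b hv.symm, add_zero]; exact ha
  · simp only [sgn_zero_right, sgn_one_one, one_smul, neg_smul, neg_add, add_left_inj] at hv
    rw [h2 a hv, zero_add]; exact hb

/-- A bijective even equivariant map is an isomorphism, here taken in the inverse direction. -/
def SuperMod.Iso.ofBijective {L : LieSuperalg k} {M N : SuperMod L} (Φ : N →ₗ[k] M)
    (hΦ : Function.Bijective Φ) (hgr : ∀ {p : ZMod 2} {v : N}, v ∈ N.gr p → Φ v ∈ M.gr p)
    (hact : ∀ (x : L) (v : N), Φ (N.act x v) = M.act x (Φ v)) : SuperMod.Iso M N where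
  toEquiv := (LinearEquiv.ofBijective Φ hΦ).symm
  map_gr := by
    intro p v hv
    obtain ⟨w, rfl⟩ := hΦ.2 v
    rw [LinearEquiv.ofBijective_symm_apply_apply]
    -- The component of the wrong parity has zero image, by uniqueness of the decomposition in M,
    -- and so vanishes by injectivity.
    obtain ⟨a, ha, b, hb, rfl⟩ := exists_decomp N.isCompl w
    rw [map_add] at hv
    rcases zmod2_cases p with rfl | rfl
    · have := (decomp_unique M.isCompl (hgr ha) (hgr hb) hv (zero_mem _) (add_zero _).symm).2
      rw [hΦ.1 (this.trans (map_zero Φ).symm), add_zero]; exact ha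
    · have := (decomp_unique M.isCompl (hgr ha) (hgr hb) (zero_mem _) hv (zero_add _).symm).1
      rw [hΦ.1 (this.trans (map_zero Φ).symm), zero_add]; exact hb
  map_act := by
    intro x v
    obtain ⟨w, rfl⟩ := hΦ.2 v
    rw [← hact, LinearEquiv.ofBijective_symm_apply_apply,
      LinearEquiv.ofBijective_symm_apply_apply]

end Parity

/-! ## The weight space decomposition along the embedding -/

section Duflo

variable {k : Type u} [Field k]

theorem SuperMod.act_act_unit {m : ℕ} (M : SuperMod (gl k m)) (i j a b : Idx m) (w : M) :
    M.act (unit k i j) (M.act (unit k a b) w) =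
      (if j = a then M.act (unit k i b) w else 0) -
        sgn (par i + par j) (par a + par b) • (if b = i then M.act (unit k a j) w else 0) +
      sgn (par i + par j) (par a + par b) • M.act (unit k a b) (M.act (unit k i j) w) := by
  have := DFunLike.congr_fun (isGlFamily_act M i j a b : _ = _) w
  refine this.trans ?_
  split_ifs <;> rfl

variable [CharZero k] {n : ℕ} {lam : Weight (n + 1)}

theorem exists_pos_zero {i : Idx (n + 1)} (hi : pos i ≠ 0) : ∃ a : Idx n, i = sJ a := by
  rcases idx_cases i with rfl | rfl | h
  · exact absurd rfl hi
  · exact absurd rfl hi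
  · exact h

theorem ne_sJ_of_pos {i : Idx (n + 1)} (hi : pos i = 0) (a : Idx n) : i ≠ sJ a := by
  rintro rfl
  rw [pos_sJ] at hi
  exact Fin.succ_ne_zero _ hi

variable (h : ∀ i, lam (Sum.inl i) + lam (Sum.inr i) = 0)
  {ψ : BG k (prJ lam) →ₗ[k] BG k lam} (hψ : ψ (bgVec k (prJ lam)) = bgVec k lam)
  (hψ' : ∀ a b w, ψ ((BG k (prJ lam)).act (unit k a b) w) =
    (BG k lam).act (unit k (sJ a) (sJ b)) (ψ w))

include h hψ hψ'

/-- Units of gl(I) supercommute with gl(J), so their action on the generator propagates. No sign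
appears: off the diagonal the action is zero, and diagonal units are even. -/
theorem act_unit_of_pos {i j : Idx (n + 1)} (hi : pos i = 0) (hj : pos j = 0)
    (w : BG k (prJ lam)) : (BG k lam).act (unit k i j) (ψ w) =
      if i = j then (lam i : k) • ψ w else 0 := by
  have key : LinearMap.eqLocus ((BG k lam).act (unit k i j) ∘ₗ ψ)
      ((if i = j then (lam i : k) else 0) • ψ) = ⊤ := by
    refine bg_eq_top (prJ_atypical h) ?_ fun a b w hw => ?_
    · change (BG k lam).act (unit k i j) (ψ _) = (if i = j then (lam i : k) else 0) • ψ _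
      rw [hψ, bg_act_unit h (by rw [hi, hj])]
      split_ifs
      · rfl
      · exact (zero_smul _ _).symm
    · change (BG k lam).act (unit k i j) (ψ w) = (if i = j then (lam i : k) else 0) • ψ w at hw
      change (BG k lam).act (unit k i j) (ψ _) = (if i = j then (lam i : k) else 0) • ψ _
      rw [hψ', SuperMod.act_act_unit, hw, if_neg (ne_sJ_of_pos hj a), if_neg (ne_sJ_of_pos hi b).symm,
        smul_zero, sub_zero, zero_add, map_smul]
      rcases eq_or_ne i j with rfl | hij
      · rw [CharTwo.add_self_eq_zero, sgn_zero_left, one_smul]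
      · rw [if_neg hij, zero_smul, smul_zero]
  have : w ∈ LinearMap.eqLocus ((BG k lam).act (unit k i j) ∘ₗ ψ)
      ((if i = j then (lam i : k) else 0) • ψ) := key ▸ Submodule.mem_top
  refine Eq.trans this ?_
  change (if i = j then (lam i : k) else 0) • ψ w = _
  split_ifs
  · rfl
  · exact zero_smul _ _

theorem act_unit_raise {i j : Idx (n + 1)} (hi : pos i = 0) (hj : pos j ≠ 0)
    (w : BG k (prJ lam)) : (BG k lam).act (unit k i j) (ψ w) = 0 := by
  -- All columns are treated at once, because commuting e_{i,c} past e_{a,b} can produce e_{i,b}.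
  have key : ⨅ c : Idx n, LinearMap.ker ((BG k lam).act (unit k i (sJ c)) ∘ₗ ψ) = ⊤ := by
    refine bg_eq_top (prJ_atypical h) ?_ fun a b w hw => ?_
    · rw [Submodule.mem_iInf]
      intro c
      change (BG k lam).act (unit k i (sJ c)) (ψ _) = 0
      rw [hψ, bg_act_unit h (by rw [hi]; exact Fin.zero_le _), if_neg (ne_sJ_of_pos hi c)]
    · rw [Submodule.mem_iInf] at hw ⊢
      have hw' : ∀ c, (BG k lam).act (unit k i (sJ c)) (ψ w) = 0 := hw
      intro c
      change (BG k lam).act (unit k i (sJ c)) (ψ _) = 0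
      rw [hψ', SuperMod.act_act_unit, hw', hw', if_neg (ne_sJ_of_pos hi b).symm]
      simp
  obtain ⟨c, rfl⟩ := exists_pos_zero hj
  have : w ∈ ⨅ c : Idx n, LinearMap.ker ((BG k lam).act (unit k i (sJ c)) ∘ₗ ψ) :=
    key ▸ Submodule.mem_top
  exact (Submodule.mem_iInf _).mp this c

omit h hψ hψ' in
variable (k lam) in
/-- The central element of `gl(I)`, acting on `BG(lam)`. -/
def centralOp : Module.End k (BG k lam) :=
  (BG k lam).act (unit k (Sum.inl 0) (Sum.inl 0)) + (BG k lam).act (unit k (Sum.inr 0) (Sum.inr 0))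

theorem centralOp_apply (w : BG k (prJ lam)) : centralOp k lam (ψ w) = 0 := by
  have h1 := act_unit_of_pos h hψ hψ' (i := Sum.inl 0) (j := Sum.inl 0) rfl rfl w
  have h2 := act_unit_of_pos h hψ hψ' (i := Sum.inr 0) (j := Sum.inr 0) rfl rfl w
  change (BG k lam).act _ (ψ w) + (BG k lam).act _ (ψ w) = 0
  rw [h1, h2, if_pos rfl, if_pos rfl, ← add_smul, ← Int.cast_add, h 0, Int.cast_zero, zero_smul]

/-- Here S0 consists of the units of gl(I) and gl(J), and the lowering units e_{i,j} have i in J and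
j in I. Exactly one of the two diagonal units in C has the index j, so bracketing with C multiplies
such a unit by -1. -/
theorem range_sup_coprimePart : LinearMap.range ψ ⊔ coprimePart (centralOp k lam) = ⊤ := by
  let E : Idx (n + 1) → Idx (n + 1) → Module.End k (BG k lam) := fun i j => (BG k lam).act (unit k i j)
  have hE : IsGlFamily par E := isGlFamily_act (BG k lam)
  refine sup_coprimePart_eq_top
    (S0 := {T | ∃ i j, (pos i = 0 ↔ pos j = 0) ∧ T = E i j})
    (Sm := {T | ∃ i j, pos i ≠ 0 ∧ pos j = 0 ∧ T = E i j})
    (Sp := {T | ∃ i j, pos i = 0 ∧ pos j ≠ 0 ∧ T = E i j}) ?_ ?_ ?_ ?_ ?_ ?_ ?_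
  · rintro _ ⟨i, j, hij, rfl⟩ _ ⟨w, rfl⟩
    by_cases hi : pos i = 0
    · refine (act_unit_of_pos h hψ hψ' hi (hij.mp hi) w).symm ▸ ?_
      split_ifs
      · exact Submodule.smul_mem _ _ ⟨w, rfl⟩
      · exact zero_mem _
    · obtain ⟨a, rfl⟩ := exists_pos_zero hi
      obtain ⟨b, rfl⟩ := exists_pos_zero fun hj => hi (hij.mpr hj)
      exact ⟨_, hψ' a b w⟩
  · rintro _ ⟨i, j, hi, hj, rfl⟩ _ ⟨w, rfl⟩
    exact act_unit_raise h hψ hψ' hi hj w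
  · rintro _ ⟨i, j, hij, rfl⟩ _ ⟨a, b, ha, hb, rfl⟩
    refine ⟨_, ?_, _, hE i j a b⟩
    refine sub_mem ?_ (zsmul_mem ?_ _)
    · split_ifs with hja
      · subst hja
        exact Submodule.subset_span ⟨i, b, fun hi => ha (hij.mp hi), hb, rfl⟩
      · exact zero_mem _
    · split_ifs with hbi
      · subst hbi
        exact Submodule.subset_span ⟨a, j, ha, hij.mp hb, rfl⟩
      · exact zero_mem _
  · rintro _ ⟨i, j, hi, hj, rfl⟩ _ ⟨a, b, ha, hb, rfl⟩
    refine ⟨_, ?_, _, hE i j a b⟩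
    refine sub_mem ?_ (zsmul_mem ?_ _)
    · split_ifs
      · exact Submodule.subset_span ⟨i, b, by simp [hi, hb], rfl⟩
      · exact zero_mem _
    · split_ifs
      · exact Submodule.subset_span ⟨a, j, by simp [ha, hj], rfl⟩
      · exact zero_mem _
  · rintro _ ⟨a, b, ha, hb, rfl⟩
    obtain ⟨a, rfl⟩ := exists_pos_zero ha
    have h1 := hE (Sum.inl 0) (Sum.inl 0) (sJ a) b
    have h2 := hE (Sum.inr 0) (Sum.inr 0) (sJ a) b
    rw [CharTwo.add_self_eq_zero, sgn_zero_left, if_neg (sJ_ne_inl a).symm, zero_sub, one_smul] at h1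
    rw [CharTwo.add_self_eq_zero, sgn_zero_left, if_neg (sJ_ne_inr a).symm, zero_sub, one_smul] at h2
    refine (h1.add_left h2).of_eq rfl ?_
    rcases idx_cases b with rfl | rfl | ⟨b, rfl⟩
    · simp
    · simp
    · exact absurd hb fun e => ne_sJ_of_pos e b rfl
  · rintro _ ⟨w, rfl⟩
    exact centralOp_apply h hψ hψ' w
  · intro S hS hSt
    refine bg_eq_top h (hS ⟨_, hψ⟩) fun i j w hw => hSt (E i j) ?_ w hw
    by_cases hi : pos i = 0 <;> by_cases hj : pos j = 0
    · exact Or.inl ⟨i, j, by simp [hi, hj], rfl⟩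
    · exact Or.inr (Or.inr ⟨i, j, hi, hj, rfl⟩)
    · exact Or.inr (Or.inl ⟨i, j, hi, hj, rfl⟩)
    · exact Or.inl ⟨i, j, by simp [hi, hj], rfl⟩

/-- The parities of the two generators differ by par(pr_I λ), and ψ intertwines matrix units of
equal parity, so the discrepancy is the same on the whole module. -/
theorem embedding_gr {r : ZMod 2} {w : BG k (prJ lam)} (hw : w ∈ (BG k (prJ lam)).gr r) :
    ψ w ∈ (BG k lam).gr (r + wtPar (prI lam)) := by
  have hsgn : ∀ p q : ZMod 2, sgn 1 (p + q) = sgn 1 q * sgn 1 p := by decide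
  have hpar : wtPar lam = wtPar (prJ lam) + wtPar (prI lam) := by
    simp only [wtPar, Fin.sum_univ_succ]
    push_cast
    simp [prJ, prI, restr, add_comm]
  let π := parityOp (BG k (prJ lam)).gr (BG k (prJ lam)).isCompl
  let π' := parityOp (BG k lam).gr (BG k lam).isCompl
  have key : LinearMap.eqLocus (π' ∘ₗ ψ) (sgn 1 (wtPar (prI lam)) • ψ ∘ₗ π) = ⊤ := by
    refine bg_eq_top (prJ_atypical h) ?_ fun a b w hw => ?_
    · change π' (ψ _) = sgn 1 (wtPar (prI lam)) • ψ (π _)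
      rw [parityOp_apply _ bgVec_mem, hψ, parityOp_apply _ bgVec_mem, map_zsmul, hψ, smul_smul,
        hpar, hsgn]
    · change π' (ψ w) = sgn 1 (wtPar (prI lam)) • ψ (π w) at hw
      change π' (ψ _) = sgn 1 (wtPar (prI lam)) • ψ (π _)
      have e1 : parityOp (gl k n).gr (gl k n).isCompl (unit k a b) =
        sgn 1 (par a + par b) • unit k a b := parityOp_apply _ (unit_mem a b)
      have e2 : parityOp (gl k (n + 1)).gr (gl k (n + 1)).isCompl (unit k (sJ a) (sJ b)) =
        sgn 1 (par a + par b) • unit k (sJ a) (sJ b) := by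
        refine (parityOp_apply (gl k (n + 1)).isCompl (unit_mem (sJ a) (sJ b))).trans ?_
        rw [par_sJ, par_sJ]
      rw [parityOp_act, e1, hψ', parityOp_act, e2, hw]
      simp only [map_zsmul, LinearMap.smul_apply, hψ']
      rw [smul_comm]
  have : w ∈ LinearMap.eqLocus (π' ∘ₗ ψ) (sgn 1 (wtPar (prI lam)) • ψ ∘ₗ π) :=
    key ▸ Submodule.mem_top
  refine mem_gr_of_parityOp (BG k lam).isCompl (Eq.trans this ?_)
  change sgn 1 (wtPar (prI lam)) • ψ (π w) = _
  rw [parityOp_apply _ hw, map_zsmul, smul_smul, hsgn]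

/-! ### The homology of the odd root vector. -/

theorem xRoot_apply (w : BG k (prJ lam)) : (BG k lam).act (xRoot k n) (ψ w) = 0 :=
  (act_unit_of_pos h hψ hψ' (i := Sum.inl 0) (j := Sum.inr 0) rfl rfl w).trans
    (if_neg (by simp))

/-- The map induced by the embedding on the homology of `e_{1,n+1}`. -/
def dsMap : BG k (prJ lam) →ₗ[k] DSgl (BG k lam) :=
  (((LinearMap.range ((BG k lam).act (xRoot k n))).comap
    (LinearMap.ker ((BG k lam).act (xRoot k n))).subtype).mkQ) ∘ₗ
      ψ.codRestrict (LinearMap.ker ((BG k lam).act (xRoot k n))) (xRoot_apply h hψ hψ')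

theorem dsMap_act (A : Mat k n) (w : BG k (prJ lam)) :
    dsMap h hψ hψ' ((BG k (prJ lam)).act A w) =
      (DSgl (BG k lam)).act A (dsMap h hψ hψ' w) := by
  have e : ψ ((BG k (prJ lam)).act A w) = (BG k lam).act (extJ k n A) (ψ w) := by
    have e1 : extJ k n A = ∑ i, ∑ j, A i j • unit k (sJ i) (sJ j) := by
      conv_lhs => rw [eq_sum_unit A]
      simp only [map_sum, map_smul, extJ_unit]
    have e2 : (BG k lam).act (extJ k n A) =
        ∑ i, ∑ j, A i j • (BG k lam).act (unit k (sJ i) (sJ j)) := by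
      rw [e1]; simp only [map_sum, map_smul]
    rw [SuperMod.act_eq_sum, e2]
    simp only [map_sum, map_smul, hψ', LinearMap.sum_apply, LinearMap.smul_apply]
  have hk : ∀ v ∈ LinearMap.ker ((BG k lam).act (xRoot k n)),
      (BG k lam).act (extJ k n A) v ∈ LinearMap.ker ((BG k lam).act (xRoot k n)) := fun v hv =>
    ds_h1 (BG k lam) (xRoot_odd k n) _ (extJ_mem_ker A) _ hv
  have e' : (⟨_, xRoot_apply h hψ hψ' ((BG k (prJ lam)).act A w)⟩ :
      LinearMap.ker ((BG k lam).act (xRoot k n))) =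
      ⟨_, hk _ (xRoot_apply h hψ hψ' w)⟩ := Subtype.ext e
  exact congrArg (Submodule.Quotient.mk
    (p := (LinearMap.range ((BG k lam).act (xRoot k n))).comap
      (LinearMap.ker ((BG k lam).act (xRoot k n))).subtype)) e'

/-- The operator x kills im ψ, and the summand where H = xy + yx is invertible is stable under x and
acyclic, so the homology is im ψ. -/
theorem dsMap_bijective (hinj : Function.Injective ψ) : Function.Bijective (dsMap h hψ hψ') := by
  let E : Idx (n + 1) → Idx (n + 1) → Module.End k (BG k lam) :=
    fun i j => (BG k lam).act (unit k i j)
  have hE : IsGlFamily par E := isGlFamily_act (BG k lam)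
  let X := E (Sum.inl 0) (Sum.inr 0)
  let Y := E (Sum.inr 0) (Sum.inl 0)
  let H := centralOp k lam
  have hX0 : ∀ w, X (ψ w) = 0 := xRoot_apply h hψ hψ'
  have hXY : H = X * Y + Y * X := by
    have := hE (Sum.inl 0) (Sum.inr 0) (Sum.inr 0) (Sum.inl 0)
    simp only [SuperComm, par, Sum.elim_inl, Sum.elim_inr, zero_add, add_zero, sgn_one_one, if_true,
      neg_smul, one_smul, sub_neg_eq_add] at this
    change X * Y = H + -(Y * X) at this
    rw [this, neg_add_cancel_right]
  have hHX : Commute H X := by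
    have h1 := hE (Sum.inl 0) (Sum.inl 0) (Sum.inl 0) (Sum.inr 0)
    have h2 := hE (Sum.inr 0) (Sum.inr 0) (Sum.inl 0) (Sum.inr 0)
    rw [CharTwo.add_self_eq_zero, sgn_zero_left] at h1 h2
    have h3 := h1.add_left h2
    simp only [SuperComm, if_true, one_smul, reduceCtorEq, if_false, sub_zero, zero_sub,
      add_neg_cancel, zero_add] at h3
    exact h3
  have hdec : ∀ v : BG k lam, ∃ w, ∃ κ ∈ coprimePart H, v = ψ w + κ := by
    intro v
    have : v ∈ LinearMap.range ψ ⊔ coprimePart H :=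
      range_sup_coprimePart h hψ hψ' ▸ Submodule.mem_top
    obtain ⟨_, ⟨w, rfl⟩, κ, hκ, e⟩ := Submodule.mem_sup.mp this
    exact ⟨w, κ, hκ, e.symm⟩
  constructor
  · rw [← LinearMap.ker_eq_bot, LinearMap.ker_eq_bot']
    intro w hw
    obtain ⟨v, hv⟩ := (Submodule.Quotient.mk_eq_zero _).mp hw
    change X v = ψ w at hv
    obtain ⟨w', κ, hκ, rfl⟩ := hdec v
    rw [map_add, hX0, zero_add] at hv
    -- A boundary in im ψ comes from the complementary part alone, so it is both killed by H and
    -- contained in `coprimePart H`.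
    have : ψ w ∈ coprimePart H := hv ▸ map_mem_coprimePart hHX hκ
    exact hinj ((eq_zero_of_mem_coprimePart (centralOp_apply h hψ hψ' w) this).trans
      (map_zero ψ).symm)
  · intro c
    obtain ⟨⟨v, hv⟩, rfl⟩ := Submodule.Quotient.mk_surjective _ c
    change X v = 0 at hv
    obtain ⟨w, κ, hκ, rfl⟩ := hdec v
    rw [map_add, hX0, zero_add] at hv
    obtain ⟨q, hq⟩ := exists_eq_of_mem_coprimePart hκ
    refine ⟨w, (Submodule.Quotient.eq _).mpr ?_⟩
    -- Here κ = H q(H) κ, and x commutes with q(H), so x q(H) κ = 0. Expanding H = xy + yx leaves κ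
    -- = x y q(H) κ, a boundary; the sign comes from the order of the difference of representatives.
    refine ⟨-(Y (Polynomial.aeval H q κ)), ?_⟩
    change X (-(Y (Polynomial.aeval H q κ))) = ψ w - (ψ w + κ)
    have hq0 : X (Polynomial.aeval H q κ) = 0 := by
      have := DFunLike.congr_fun (commute_aeval hHX q).eq κ
      exact this.symm.trans (by rw [Module.End.mul_apply, hv, map_zero])
    have e : κ = X (Y (Polynomial.aeval H q κ)) := by
      refine hq.trans ((DFunLike.congr_fun hXY _).trans ?_)
      change X (Y _) + Y (X _) = _
      rw [hq0, map_zero, add_zero]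
    rw [map_neg, ← e, sub_add_cancel_left]

theorem dsMap_gr {p : ZMod 2} {w : (BG k (prJ lam)).shift (wtPar (prI lam))}
    (hw : w ∈ ((BG k (prJ lam)).shift (wtPar (prI lam))).gr p) :
    dsMap h hψ hψ' w ∈ (DSgl (BG k lam)).gr p := by
  have := embedding_gr h hψ hψ' (w := w) hw
  rw [add_assoc, CharTwo.add_self_eq_zero, add_zero] at this
  exact ⟨⟨ψ w, xRoot_apply h hψ hψ' w⟩, this, rfl⟩

omit hψ hψ' in
theorem nonempty_iso_DSgl :
    Nonempty (SuperMod.Iso (DSgl (BG k lam)) ((BG k (prJ lam)).shift (wtPar (prI lam)))) := by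
  obtain ⟨ψ, hψ, hψ', hinj⟩ := exists_embedding (k := k) h
  exact ⟨SuperMod.Iso.ofBijective (dsMap h hψ hψ') (dsMap_bijective h hψ hψ' hinj)
    (dsMap_gr h hψ hψ') (dsMap_act h hψ hψ')⟩

end Duflo

end GLSuper

end

theorem mainTheorem1 (k : Type u) [Field k] [IsAlgClosed k] [CharZero k] (n : ℕ)
    (lam : GLSuper.Weight (n + 1)) :
    (lam ∈ GLSuper.LambdaMaBG (n + 1) ↔ Module.finrank k (GLSuper.LO k lam) = 1) ∧
    (lam ∈ GLSuper.LambdaMaBG (n + 1) →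
      Nonempty (GLSuper.SuperMod.Iso (GLSuper.DSgl (GLSuper.BG k lam))
        ((GLSuper.BG k (GLSuper.prJ lam)).shift (GLSuper.wtPar (GLSuper.prI lam)))) ∧
      GLSuper.prJ lam ∈ GLSuper.LambdaMaBG n) :=
  ⟨GLSuper.mem_LambdaMaBG_iff_finrank, fun h =>
    ⟨GLSuper.nonempty_iso_DSgl (GLSuper.mem_LambdaMaBG.mp h),
      GLSuper.mem_LambdaMaBG.mpr (GLSuper.prJ_atypical (GLSuper.mem_LambdaMaBG.mp h))⟩⟩
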